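/- Let $C\subset\mathbb{P}^2$ be a smooth complex plane cubic curve whose equation has real coefficients, and suppose that its set of real points $C(\mathbb{R})$ has exactly two connected components in the Euclidean topology. An inflection point of $C$ is a point at which the tangent line meets $C$ with multiplicity at least $3$. For a point $p\in C$ that is not an inflection point, the points associated with $p$ are the points $q\in C\setminus\{p\}$ such that the tangent line to $C$ at $q$ passes through $p$; there are precisely four of them. Points $p_1,\dots,p_s\in C$ are called independent if, for an inflection point $p_0\in C$ (equivalently, for every inflection point $p_0\in C$), the classes of the divisors $p_1-p_0,\dots,p_s-p_0$ are $\mathbb{Z}$-linearly independent in $\operatorname{Pic}^0(C)$. Then, for every integer $r\ge 1$, there exist points $p_{10},\dots,p_{r0}\in C$ which are independent, such that every $p_{i0}$ ($1\le i\le r$) is real, is not an inflection point, has precisely four associated points $p_{i1},\dots,p_{i4}$, and all of these associated points are real. -/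

import Mathlib

open scoped LinearAlgebra.Projectivization

noncomputable section

/-- The quotient topology on a projective space `ℙ K V`, coming from `V ∖ {0}`.
For `K = ℂ` and `V = ℂ³` this is the Euclidean topology of `ℙ²(ℂ)`. -/
instance Projectivization.instTopologicalSpaceQuotient {K V : Type*} [DivisionRing K]
    [AddCommGroup V] [Module K V] [TopologicalSpace V] : TopologicalSpace (ℙ K V) :=
  inferInstanceAs (TopologicalSpace (Quotient (projectivizationSetoid K V)))

namespace PlaneCubic

open MvPolynomial

/-- The complex projective plane, as a set of points. -/
abbrev Plane : Type := ℙ ℂ (Fin 3 → ℂ)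

/-- The homogeneous coordinate ring of the complex projective plane. -/
abbrev Forms : Type := MvPolynomial (Fin 3) ℂ

/-- A point of the plane is real if it has a vector of real homogeneous coordinates. -/
def IsReal (P : Plane) : Prop :=
  ∃ (v : Fin 3 → ℝ) (hv : (fun i => (v i : ℂ)) ≠ 0),
    P = Projectivization.mk ℂ (fun i => (v i : ℂ)) hv

/-- The set of complex points of the plane curve `F = 0`, for a form `F`. -/
def curve (F : Forms) : Set Plane := {P | eval P.rep F = 0}

/-- The set of real points of the plane curve `F = 0`. -/
def realPoints (F : Forms) : Set Plane := {P | P ∈ curve F ∧ IsReal P}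

/-- The plane curve `F = 0` is smooth: the partial derivatives of `F` have no common zero on it. -/
def IsSmooth (F : Forms) : Prop :=
  ∀ v : Fin 3 → ℂ, v ≠ 0 → eval v F = 0 → ∃ i, eval v (pderiv i F) ≠ 0

/-- The linear form that defines the tangent line to the curve `F = 0` at `P`. -/
def tangentForm (F : Forms) (P : Plane) : Forms :=
  ∑ i, C (eval P.rep (pderiv i F)) * X i

/-- The homogeneous prime ideal of the point `P = [a : b : c]`: the polynomials that vanish
on the line `{(ta, tb, tc)}`. -/
def pointIdeal (P : Plane) : Ideal Forms :=
  RingHom.ker (aeval (fun i => Polynomial.C (P.rep i) * Polynomial.X) :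
    Forms →ₐ[ℂ] Polynomial ℂ)

instance pointIdeal_isPrime (P : Plane) : (pointIdeal P).IsPrime :=
  RingHom.ker_isPrime _

/-- The intersection multiplicity at `P` of the plane curves `F = 0` and `G = 0`: the length of
`S_𝔭 / (F, G)`, where `S` is the homogeneous coordinate ring of the plane and `𝔭` is the
homogeneous prime ideal of `P`. -/
def interMult (F G : Forms) (P : Plane) : ℕ∞ :=
  Module.length (Localization.AtPrime (pointIdeal P))
    (Localization.AtPrime (pointIdeal P) ⧸
      (Ideal.span {F, G}).map (algebraMap Forms (Localization.AtPrime (pointIdeal P))))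

/-- The point `P` of the curve `F = 0` is an inflection point: the tangent line at `P` meets
the curve at `P` with multiplicity at least three. -/
def IsInflection (F : Forms) (P : curve F) : Prop :=
  3 ≤ interMult F (tangentForm F P) P

/-- The point `Q` of the curve `F = 0` is associated with the point `P`, which is meant not to be
an inflection point: the tangent line to the curve at `Q ≠ P` passes through `P`. -/
def IsAssociated (F : Forms) (P Q : curve F) : Prop :=
  Q ≠ P ∧ eval (P : Plane).rep (tangentForm F Q) = 0

/-- Divisors on the (smooth) curve `F = 0`. -/
abbrev Divisor (F : Forms) : Type := curve F →₀ ℤ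

/-- The degree of a divisor. -/
def degree (F : Forms) : Divisor F →+ ℤ :=
  Finsupp.degree

/-- The group of principal divisors on the smooth cubic curve `F = 0`: the divisors of the
rational functions `G / H`, for forms `G`, `H` of equal degree that do not vanish identically on
the curve. The order of `G / H` at a point is the difference of the intersection
multiplicities. -/
def principal (F : Forms) : AddSubgroup (Divisor F) :=
  AddSubgroup.closure {D | ∃ (d : ℕ) (G H : Forms), G.IsHomogeneous d ∧ H.IsHomogeneous d ∧
    ¬ F ∣ G ∧ ¬ F ∣ H ∧ ∀ P : curve F,
      D P = ((interMult F G P).toNat : ℤ) - ((interMult F H P).toNat : ℤ)}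

/-- The Picard group of the smooth cubic curve `F = 0`: divisors modulo linear equivalence. -/
abbrev Pic (F : Forms) : Type := Divisor F ⧸ principal F

/-- The subgroup `Pic⁰` of the classes of divisors of degree zero. -/
def Pic0 (F : Forms) : AddSubgroup (Pic F) :=
  (degree F).ker.map (QuotientAddGroup.mk' (principal F))

/-- The class of the divisor `P - P₀` in `Pic⁰`. -/
def diffClass (F : Forms) (P₀ P : curve F) : Pic0 F :=
  ⟨QuotientAddGroup.mk' (principal F) (Finsupp.single P 1 - Finsupp.single P₀ 1),
    AddSubgroup.mem_map_of_mem _ (by simp [degree])⟩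

/-- The points `p i` are independent with respect to the inflection point `P₀`: the classes
`p i - P₀` are `ℤ`-linearly independent in `Pic⁰`. -/
def Independent (F : Forms) (P₀ : curve F) {r : ℕ} (p : Fin r → curve F) : Prop :=
  LinearIndependent ℤ fun i => diffClass F P₀ (p i)

end PlaneCubic

end

/-! A smooth real cubic with a real point has a real flex, and a real linear change of coordinates
that sends a flex to infinity gives y² = x³ + a₂x² + a₄x + a₆ with real coefficients. If this cubic
polynomial had only one real root, the real locus would be connected; so two components force real
roots e₁ < e₂ < e₃.

With the flex at infinity as origin, the tangent at q passes through p exactly when 2q + p = 0, so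
associated points are the halves of -p. Over a point with real abscissa X > e₃ the numbers X - eᵢ
are squares of positive reals s₁ > s₂ > s₃, and the halves are explicit polynomials in the sᵢ
(`halfX`, `halfY`), hence real and distinct. One of them coincides with p only if X is a root of the
three-division polynomial, that is, only if p is a flex.

Independence comes from derivations of ℂ. If δ kills the coefficients, evaluating the invariant
differential dx/y along δ gives a homomorphism P ↦ δ(x)/y from the group of the curve to ℂ
(`logDeriv_add`). It vanishes at flexes, whose abscissas are algebraic over the coefficients. By
countability there are abscissas X₁, …, X_r > e₃, each transcendental over the field generated by
the coefficients and the earlier Xⱼ, and derivations δᵢ with δᵢ(Xᵢ) = 1 and δᵢ(Xⱼ) = 0 for j < i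
(`exists_reals_derivations`). The matrix of values is triangular with nonzero diagonal, so the
classes are independent; transcendence also excludes flexes.

To use this on `Pic0`, one needs that principal divisors add up to zero in the Weierstrass group
(`divisorSum_eq_zero`). The length that defines `interMult` is identified with the exponent of the
ideal of a point in the affine coordinate ring (`interMult_eq`), and injectivity of the map from
points to the ideal class group does the rest. The point at infinity is the origin, so its
multiplicity is irrelevant. -/

noncomputable section

namespace PlaneCubic
open MvPolynomial

/-! ### Lengths over a local ring with maximal ideal (F, T). -/

section Length

variable {A : Type*} [CommRing A] [IsLocalRing A] [IsNoetherianRing A]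

/-- In a Noetherian local ring whose maximal ideal is generated by `t`, with `t` not nilpotent,
the quotient by `t ^ e` has length `e`. -/
theorem ord_pow_of_maximalIdeal_eq (t : A) (hm : IsLocalRing.maximalIdeal A = Ideal.span {t})
    (ht : ∀ n, t ^ n ≠ 0) (e : ℕ) : Ring.ord A (t ^ e) = e := by
  have hreg : t ∈ nonZeroDivisors A := by
    rw [mem_nonZeroDivisors_iff_right]
    intro x hx
    by_contra hx0
    -- By Krull's intersection theorem x = t ^ k * u with u a unit, so x * t = 0 would make t ^ (k +
    -- 1) vanish.
    have hk : ∃ k, x ∉ Ideal.span {t} ^ k := by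
      by_contra! h
      have := Ideal.iInf_pow_eq_bot_of_isLocalRing (Ideal.span {t})
        (hm ▸ (IsLocalRing.maximalIdeal.isMaximal A).ne_top)
      exact hx0 (by simpa [this] using (Submodule.mem_iInf (fun i => Ideal.span {t} ^ i)).mpr h)
    classical
    obtain ⟨k, hk1, hk2⟩ : ∃ k, x ∉ Ideal.span {t} ^ (k + 1) ∧ x ∈ Ideal.span {t} ^ k := by
      have h0 : Nat.find hk ≠ 0 := fun h => by
        have := Nat.find_spec hk
        simp [h] at this
      obtain ⟨k, hk'⟩ := Nat.exists_eq_succ_of_ne_zero h0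
      exact ⟨k, by simpa [hk'] using Nat.find_spec hk, by
        simpa using Nat.find_min hk (m := k) (by omega)⟩
    rw [Ideal.span_singleton_pow, Ideal.mem_span_singleton] at hk1 hk2
    obtain ⟨u, rfl⟩ := hk2
    have hu : IsUnit u := by
      by_contra hu
      have : u ∈ IsLocalRing.maximalIdeal A := hu
      rw [hm, Ideal.mem_span_singleton] at this
      exact hk1 (pow_succ t k ▸ mul_dvd_mul_left _ this)
    refine ht (k + 1) ((hu.mul_left_eq_zero).mp ?_)
    rw [← hx]; ring
  have h1 : Ring.ord A t = 1 := by
    rw [Ring.ord, ← hm, Module.length_eq_one_iff, isSimpleModule_iff_isCoatom]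
    exact (IsLocalRing.maximalIdeal.isMaximal A).out
  rw [Ring.ord_pow hreg, h1]
  simp

/-- In a Noetherian local ring whose maximal ideal is `(F, T)`, with no power of `T` in `(F)`,
the quotient by `(F, T ^ e)` has length `e`. -/
theorem length_quotient_span_pair_pow (F T : A)
    (hm : IsLocalRing.maximalIdeal A = Ideal.span {F, T})
    (hT : ∀ n, T ^ n ∉ Ideal.span {F}) (e : ℕ) :
    Module.length A (A ⧸ Ideal.span {F, T ^ e}) = e := by
  have hne : Ideal.span {F} ≠ ⊤ := fun h => hT 0 (h ▸ Submodule.mem_top)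
  have : Nontrivial (A ⧸ Ideal.span {F}) := Ideal.Quotient.nontrivial_iff.mpr hne
  -- Modulo F the maximal ideal is generated by the image of T, so the principal case applies to
  -- A/(F); length is unchanged by restriction of scalars along a surjection.
  set π : A →+* A ⧸ Ideal.span {F} := Ideal.Quotient.mk _ with hπ
  have hsurj : Function.Surjective π := Ideal.Quotient.mk_surjective
  have : IsLocalRing (A ⧸ Ideal.span {F}) := IsLocalRing.of_surjective' π hsurj
  have hF : π F = 0 := Ideal.Quotient.eq_zero_iff_mem.mpr (Ideal.mem_span_singleton_self F)
  have hmap : ∀ x, (Ideal.span {F, x}).map π = Ideal.span {π x} := fun x => by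
    rw [Ideal.map_span, Set.image_pair, hF, Ideal.span_insert_zero]
  have hcomap : ∀ x, (Ideal.span {π x}).comap π = Ideal.span {F, x} := fun x => by
    rw [← hmap, Ideal.comap_map_of_surjective' π hsurj, hπ, Ideal.mk_ker, sup_eq_left,
      Ideal.span_le]
    simpa using Ideal.subset_span (by simp)
  have hmB : IsLocalRing.maximalIdeal (A ⧸ Ideal.span {F}) = Ideal.span {π T} := by
    have h := ((IsLocalRing.local_hom_TFAE π).out 0 4).mp
      (IsLocalHom.of_surjective π hsurj)
    rw [← hmap, ← hm, ← h, Ideal.map_comap_of_surjective π hsurj]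
  have hord := ord_pow_of_maximalIdeal_eq (π T) hmB (fun n h => by
    rw [← map_pow, hπ, Ideal.Quotient.eq_zero_iff_mem] at h
    exact hT n h) e
  rw [← hord, Ring.ord, ← map_pow, ← Module.length_eq_of_surjective (S := A) hsurj]
  refine LinearEquiv.length_eq (Submodule.quotEquivOfEq _ _ ?_ ≪≫ₗ
    (LinearMap.quotKerEquivOfSurjective
      ((Ideal.Quotient.mkₐ A (Ideal.span {π (T ^ e)})).toLinearMap ∘ₗ
        (Ideal.Quotient.mkₐ A (Ideal.span {F})).toLinearMap) ?_))
  · ext x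
    rw [← hcomap]
    simp [Ideal.Quotient.eq_zero_iff_mem, hπ]
  · exact (Ideal.Quotient.mkₐ_surjective A (Ideal.span {π (T ^ e)})).comp
      (Ideal.Quotient.mkₐ_surjective A (Ideal.span {F}))

end Length
end PlaneCubic

namespace PlaneCubic
open MvPolynomial

/-! ### Polar forms and linear substitution. -/

section Substitution

variable {K : Type*} [Field K]

/-- The derivative of the form `G` at `u` in the direction `w`. -/
def polar (G : MvPolynomial (Fin 3) K) (u w : Fin 3 → K) : K :=
  ∑ i, eval u (pderiv i G) * w i

theorem polar_add (G H : MvPolynomial (Fin 3) K) (u w : Fin 3 → K) :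
    polar (G + H) u w = polar G u w + polar H u w := by
  simp [polar, add_mul, Finset.sum_add_distrib]

theorem polar_mul (G H : MvPolynomial (Fin 3) K) (u w : Fin 3 → K) :
    polar (G * H) u w = polar G u w * eval u H + eval u G * polar H u w := by
  simp only [polar, Derivation.leibniz, smul_eq_mul, map_add, map_mul, Finset.sum_mul,
    Finset.mul_sum, ← Finset.sum_add_distrib]
  exact Finset.sum_congr rfl fun i _ => by ring

theorem polar_C (a : K) (u w : Fin 3 → K) : polar (C a) u w = 0 := by
  simp [polar]

theorem polar_C_mul (a : K) (G : MvPolynomial (Fin 3) K) (u w : Fin 3 → K) :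
    polar (C a * G) u w = a * polar G u w := by
  rw [polar_mul, polar_C]; simp

theorem polar_X (i : Fin 3) (u w : Fin 3 → K) : polar (X i) u w = w i := by
  simp [polar, pderiv_X, Pi.single_apply, apply_ite]

theorem polar_smul_right (G : MvPolynomial (Fin 3) K) (u w : Fin 3 → K) (c : K) :
    polar G u (c • w) = c * polar G u w := by
  simp [polar, Finset.mul_sum, mul_left_comm]

/-- Evaluation of a form of degree `d` at a multiple of a vector, with values in an algebra. -/
theorem aeval_mul_of_isHomogeneous {B : Type*} [CommRing B] [Algebra K B]
    {G : MvPolynomial (Fin 3) K} {d : ℕ} (hG : G.IsHomogeneous d) (a : Fin 3 → B) (t : B) :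
    aeval (fun i => a i * t) G = aeval a G * t ^ d := by
  rw [aeval_def, aeval_def, eval₂_eq, eval₂_eq, Finset.sum_mul]
  refine Finset.sum_congr rfl fun m hm => ?_
  have hd : ∑ i ∈ m.support, m i = d := by
    have := hG (mem_support_iff.mp hm)
    rw [Finsupp.weight_apply, Finsupp.sum] at this
    simpa using this
  rw [← hd, ← Finset.prod_pow_eq_pow_sum, mul_assoc, ← Finset.prod_mul_distrib]
  simp_rw [mul_pow]

theorem eval_smul_of_isHomogeneous {G : MvPolynomial (Fin 3) K} {d : ℕ}
    (hG : G.IsHomogeneous d) (u : Fin 3 → K) (t : K) :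
    eval (t • u) G = t ^ d * eval u G := by
  have := aeval_mul_of_isHomogeneous hG u t
  rw [mul_comm, ← coe_aeval_eq_eval, ← coe_aeval_eq_eval]
  simpa [Pi.smul_def, mul_comm] using this

theorem polar_smul_left {G : MvPolynomial (Fin 3) K} {d : ℕ}
    (hG : G.IsHomogeneous (d + 1)) (u w : Fin 3 → K) (t : K) :
    polar G (t • u) w = t ^ d * polar G u w := by
  simp only [polar, Finset.mul_sum]
  refine Finset.sum_congr rfl fun i _ => ?_
  have : (pderiv i G).IsHomogeneous d := by simpa using hG.pderiv (i := i)
  rw [eval_smul_of_isHomogeneous this, mul_assoc]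

/-- Linear substitution in polynomials in three variables: `subst M G` is `G ∘ M`. -/
def subst (M : (Fin 3 → K) →ₗ[K] (Fin 3 → K)) :
    MvPolynomial (Fin 3) K →ₐ[K] MvPolynomial (Fin 3) K :=
  aeval fun i => ∑ j, C (M (Pi.single j 1) i) * X j

theorem eval_substVar (M : (Fin 3 → K) →ₗ[K] (Fin 3 → K)) (u : Fin 3 → K) (i : Fin 3) :
    ∑ j, M (Pi.single j 1) i * u j = M u i := by
  conv_rhs => rw [← (Pi.basisFun K (Fin 3)).sum_repr u, map_sum]
  simp [mul_comm]

theorem subst_X (M : (Fin 3 → K) →ₗ[K] (Fin 3 → K)) (i : Fin 3) :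
    subst M (X i) = ∑ j, C (M (Pi.single j 1) i) * X j := by simp [subst]

theorem eval_subst (M : (Fin 3 → K) →ₗ[K] (Fin 3 → K)) (G : MvPolynomial (Fin 3) K)
    (u : Fin 3 → K) : eval u (subst M G) = eval (M u) G := by
  induction G using MvPolynomial.induction_on with
  | C a => simp [subst]
  | add p q hp hq => simp [hp, hq]
  | mul_X p i hp => rw [map_mul, map_mul, hp, subst_X]; simp [eval_substVar]

theorem polar_subst (M : (Fin 3 → K) →ₗ[K] (Fin 3 → K)) (G : MvPolynomial (Fin 3) K)
    (u w : Fin 3 → K) : polar (subst M G) u w = polar G (M u) (M w) := by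
  induction G using MvPolynomial.induction_on with
  | C a => simp [subst, polar_C]
  | add p q hp hq => simp [polar_add, hp, hq]
  | mul_X p i hp =>
    rw [map_mul, polar_mul, polar_mul, hp, eval_subst, eval_subst, polar_X]
    congr 2
    rw [subst_X, ← eval_substVar M w, Fin.sum_univ_three, Fin.sum_univ_three]
    simp [polar_add, polar_C_mul, polar_X]

theorem subst_isHomogeneous (M : (Fin 3 → K) →ₗ[K] (Fin 3 → K)) {G : MvPolynomial (Fin 3) K}
    {d : ℕ} (hG : G.IsHomogeneous d) : (subst M G).IsHomogeneous d := by
  have := hG.aeval (fun i => ∑ j, C (M (Pi.single j 1) i) * X j) (n := 1) fun i =>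
    IsHomogeneous.sum _ _ _ fun j _ => by
      simpa using (isHomogeneous_C (Fin 3) (M (Pi.single j 1) i)).mul (isHomogeneous_X K j)
  simpa [subst] using this

theorem subst_subst [Infinite K] (M N : (Fin 3 → K) →ₗ[K] (Fin 3 → K))
    (G : MvPolynomial (Fin 3) K) : subst M (subst N G) = subst (N ∘ₗ M) G :=
  MvPolynomial.funext fun u => by simp [eval_subst]

theorem subst_id (G : MvPolynomial (Fin 3) K) : subst LinearMap.id G = G := by
  have : subst (K := K) LinearMap.id = AlgHom.id K _ := by
    ext i : 1
    rw [subst_X]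
    simp [Pi.single_apply, apply_ite]
  rw [this]; rfl

theorem subst_symm_subst [Infinite K] (M : (Fin 3 → K) ≃ₗ[K] (Fin 3 → K))
    (G : MvPolynomial (Fin 3) K) : subst M.symm.toLinearMap (subst M.toLinearMap G) = G := by
  rw [subst_subst]; simp [subst_id]

theorem subst_subst_symm [Infinite K] (M : (Fin 3 → K) ≃ₗ[K] (Fin 3 → K))
    (G : MvPolynomial (Fin 3) K) : subst M.toLinearMap (subst M.symm.toLinearMap G) = G := by
  rw [subst_subst]; simp [subst_id]

end Substitution

/-! ### Independence of the chosen representatives of projective points. -/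

section Points

theorem exists_rep_eq {v : Fin 3 → ℂ} (hv : v ≠ 0) :
    ∃ κ : ℂ, κ ≠ 0 ∧ (Projectivization.mk ℂ v hv).rep = κ • v := by
  obtain ⟨a, ha⟩ := Projectivization.exists_smul_eq_mk_rep ℂ v hv
  exact ⟨a, a.ne_zero, by rw [← ha]; rfl⟩

theorem mem_curve_mk {F : Forms} {d : ℕ} (hF : F.IsHomogeneous d) {v : Fin 3 → ℂ} (hv : v ≠ 0) :
    Projectivization.mk ℂ v hv ∈ curve F ↔ eval v F = 0 := by
  obtain ⟨κ, hκ, h⟩ := exists_rep_eq hv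
  simp [curve, h, eval_smul_of_isHomogeneous hF, hκ]

/-- Changing the representative only rescales the parameter t. All t are needed because G need not
be homogeneous. -/
theorem mem_pointIdeal {v : Fin 3 → ℂ} (hv : v ≠ 0) (G : Forms) :
    G ∈ pointIdeal (Projectivization.mk ℂ v hv) ↔ ∀ t : ℂ, eval (t • v) G = 0 := by
  obtain ⟨κ, hκ, h⟩ := exists_rep_eq hv
  have key : ∀ s : ℂ, Polynomial.eval s
      (aeval (fun i => Polynomial.C ((Projectivization.mk ℂ v hv).rep i) * Polynomial.X) G) =
      eval ((s * κ) • v) G := fun s => by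
    rw [← Polynomial.coe_aeval_eq_eval, ← AlgHom.comp_apply, comp_aeval, h, ← coe_aeval_eq_eval]
    simp [mul_comm, Pi.smul_def, mul_left_comm]
  rw [pointIdeal, RingHom.mem_ker]
  constructor
  · intro h0 t
    have := key (t * κ⁻¹)
    erw [h0] at this
    simpa [mul_assoc, hκ] using this.symm
  · intro h0
    refine Polynomial.funext fun s => ?_
    erw [key, h0]
    simp

theorem isAssociated_iff {F : Forms} (hF : F.IsHomogeneous 3) {u v : Fin 3 → ℂ} (hu : u ≠ 0)
    (hv : v ≠ 0) : eval (Projectivization.mk ℂ u hu).rep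
      (tangentForm F (Projectivization.mk ℂ v hv)) = 0 ↔ polar F v u = 0 := by
  obtain ⟨κ, hκ, h⟩ := exists_rep_eq hu
  obtain ⟨μ, hμ, h'⟩ := exists_rep_eq hv
  have : eval (Projectivization.mk ℂ u hu).rep (tangentForm F (Projectivization.mk ℂ v hv)) =
      polar F (Projectivization.mk ℂ v hv).rep (Projectivization.mk ℂ u hu).rep := by
    simp [tangentForm, polar]
  rw [this, h, h', polar_smul_right, polar_smul_left hF]
  simp [hκ, hμ]

end Points

end PlaneCubic

namespace PlaneCubic
open MvPolynomial

/-! ### Weierstrass forms and their affine curves. -/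

section Weierstrass

variable {K : Type*} [Field K]

/-- The ternary cubic form `Y²Z - (X³ + a₂X²Z + a₄XZ² + a₆Z³)`. -/
def wForm (a₂ a₄ a₆ : K) : MvPolynomial (Fin 3) K :=
  X 1 ^ 2 * X 2 - (X 0 ^ 3 + C a₂ * X 0 ^ 2 * X 2 + C a₄ * X 0 * X 2 ^ 2 + C a₆ * X 2 ^ 3)

/-- The affine Weierstrass curve `Y² = X³ + a₂X² + a₄X + a₆`. -/
def wCurve (a₂ a₄ a₆ : K) : WeierstrassCurve.Affine K := ⟨0, a₂, 0, a₄, a₆⟩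

variable (a₂ a₄ a₆ : K)

theorem wForm_isHomogeneous : (wForm a₂ a₄ a₆).IsHomogeneous 3 := by
  have hX : ∀ i : Fin 3, (X i : MvPolynomial (Fin 3) K).IsHomogeneous 1 := isHomogeneous_X K
  have hC : ∀ c : K, (C c : MvPolynomial (Fin 3) K).IsHomogeneous 0 := isHomogeneous_C _
  refine IsHomogeneous.sub (((hX 1).pow 2).mul (hX 2)) (IsHomogeneous.add (IsHomogeneous.add
    (IsHomogeneous.add ?_ ?_) ?_) ?_)
  · simpa using (hX 0).pow 3
  · simpa using ((hC a₂).mul ((hX 0).pow 2)).mul (hX 2)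
  · simpa using ((hC a₄).mul (hX 0)).mul ((hX 2).pow 2)
  · simpa using (hC a₆).mul ((hX 2).pow 3)

theorem eval_wForm (u : Fin 3 → K) : eval u (wForm a₂ a₄ a₆) =
    u 1 ^ 2 * u 2 - (u 0 ^ 3 + a₂ * u 0 ^ 2 * u 2 + a₄ * u 0 * u 2 ^ 2 + a₆ * u 2 ^ 3) := by
  simp [wForm]

theorem polar_wForm (u w : Fin 3 → K) : polar (wForm a₂ a₄ a₆) u w =
    -(3 * u 0 ^ 2 + 2 * a₂ * u 0 * u 2 + a₄ * u 2 ^ 2) * w 0 + 2 * u 1 * u 2 * w 1 +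
      (u 1 ^ 2 - (a₂ * u 0 ^ 2 + 2 * a₄ * u 0 * u 2 + 3 * a₆ * u 2 ^ 2)) * w 2 := by
  simp only [polar, wForm, Fin.sum_univ_three]
  simp [pderiv_X]
  ring

theorem wCurve_equation_iff (x y : K) : (wCurve a₂ a₄ a₆).Equation x y ↔
    y ^ 2 = x ^ 3 + a₂ * x ^ 2 + a₄ * x + a₆ := by
  rw [WeierstrassCurve.Affine.equation_iff]; simp [wCurve]

theorem wCurve_nonsingular_iff (x y : K) : (wCurve a₂ a₄ a₆).Nonsingular x y ↔
    y ^ 2 = x ^ 3 + a₂ * x ^ 2 + a₄ * x + a₆ ∧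
      (3 * x ^ 2 + 2 * a₂ * x + a₄ ≠ 0 ∨ 2 * y ≠ 0) := by
  rw [WeierstrassCurve.Affine.nonsingular_iff', wCurve_equation_iff]
  simp only [wCurve, zero_mul, zero_sub, add_zero]
  rw [neg_ne_zero]

end Weierstrass

/-! ### Passage between ternary forms and the affine coordinate ring. -/

section Dehomogenization

open Polynomial in
/-- Dehomogenization of ternary polynomials with respect to the last variable. -/
def dehomPoly : Forms →ₐ[ℂ] ℂ[X][X] :=
  MvPolynomial.aeval ![Polynomial.C Polynomial.X, Polynomial.X, 1]

theorem evalEval_dehomPoly (x y : ℂ) (G : Forms) :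
    Polynomial.evalEval x y (dehomPoly G) = eval ![x, y, 1] G := by
  induction G using MvPolynomial.induction_on with
  | C a =>
    rw [← MvPolynomial.algebraMap_eq, AlgHom.commutes]
    simp [Polynomial.evalEval, Polynomial.algebraMap_apply]
  | add p q hp hq => simp [hp, hq]
  | mul_X p i hp =>
    rw [map_mul, Polynomial.evalEval_mul, hp, map_mul]
    congr 1
    fin_cases i <;> simp [dehomPoly, Polynomial.evalEval]

/-- Summands of different degrees are padded with powers of `X 2`, which dehomogenizes to 1; no
control of n is needed. -/
theorem exists_isHomogeneous_dehomPoly (p : Polynomial (Polynomial ℂ)) :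
    ∃ (n : ℕ) (Q : Forms), Q.IsHomogeneous n ∧ dehomPoly Q = p := by
  have hX2 : dehomPoly (X 2) = 1 := by simp [dehomPoly]
  have hX : ∀ i : Fin 3, (X i : Forms).IsHomogeneous 1 := isHomogeneous_X ℂ
  have hadd : ∀ p q : Polynomial (Polynomial ℂ),
      (∃ (n : ℕ) (Q : Forms), Q.IsHomogeneous n ∧ dehomPoly Q = p) →
      (∃ (n : ℕ) (Q : Forms), Q.IsHomogeneous n ∧ dehomPoly Q = q) →
      ∃ (n : ℕ) (Q : Forms), Q.IsHomogeneous n ∧ dehomPoly Q = p + q := by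
    rintro p q ⟨n, P, hP, rfl⟩ ⟨m, Q, hQ, rfl⟩
    refine ⟨n + m, P * X 2 ^ m + Q * X 2 ^ n, IsHomogeneous.add ?_ ?_, by simp [hX2]⟩
    · simpa using hP.mul ((hX 2).pow m)
    · simpa [add_comm] using hQ.mul ((hX 2).pow n)
  have hmul : ∀ p q : Polynomial (Polynomial ℂ),
      (∃ (n : ℕ) (Q : Forms), Q.IsHomogeneous n ∧ dehomPoly Q = p) →
      (∃ (n : ℕ) (Q : Forms), Q.IsHomogeneous n ∧ dehomPoly Q = q) →
      ∃ (n : ℕ) (Q : Forms), Q.IsHomogeneous n ∧ dehomPoly Q = p * q := by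
    rintro p q ⟨n, P, hP, rfl⟩ ⟨m, Q, hQ, rfl⟩
    exact ⟨n + m, P * Q, hP.mul hQ, map_mul _ _ _⟩
  have hY : ∃ (n : ℕ) (Q : Forms), Q.IsHomogeneous n ∧ dehomPoly Q = Polynomial.X :=
    ⟨1, X 1, hX 1, by simp [dehomPoly]⟩
  have hC : ∀ q : Polynomial ℂ,
      ∃ (n : ℕ) (Q : Forms), Q.IsHomogeneous n ∧ dehomPoly Q = Polynomial.C q := by
    intro q
    induction q using Polynomial.induction_on with
    | C a => exact ⟨0, C a, isHomogeneous_C _ _, by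
        rw [← MvPolynomial.algebraMap_eq, AlgHom.commutes]; rfl⟩
    | add p q hp hq => simpa using hadd _ _ hp hq
    | monomial n a h =>
      rw [pow_succ, ← mul_assoc, Polynomial.C_mul]
      exact hmul _ _ h ⟨1, X 0, hX 0, by simp [dehomPoly]⟩
  induction p using Polynomial.induction_on with
  | C a => exact hC a
  | add p q hp hq => exact hadd _ _ hp hq
  | monomial n a h =>
    rw [pow_succ, ← mul_assoc]
    exact hmul _ _ h hY

theorem eq_zero_of_dehomPoly_eq_zero {G : Forms} {d : ℕ} (hG : G.IsHomogeneous d)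
    (h : dehomPoly G = 0) : G = 0 := by
  have h0 : X 2 * G = 0 := by
    refine MvPolynomial.funext fun u => ?_
    rcases eq_or_ne (u 2) 0 with hu | hu
    · simp [hu]
    · have h1 : u = u 2 • ![u 0 / u 2, u 1 / u 2, 1] := by
        ext i; fin_cases i <;> simp [hu, mul_div_cancel₀]
      rw [map_mul, h1, eval_smul_of_isHomogeneous hG, ← evalEval_dehomPoly, h]
      simp
  exact (mul_eq_zero.mp h0).resolve_left (X_ne_zero 2)

variable (a₂ a₄ a₆ : ℂ)

theorem dehomPoly_wForm : dehomPoly (wForm a₂ a₄ a₆) = (wCurve a₂ a₄ a₆).polynomial := by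
  have hC : ∀ c : ℂ, dehomPoly (C c) = Polynomial.C (Polynomial.C c) := fun c => by
    rw [← MvPolynomial.algebraMap_eq, AlgHom.commutes]; rfl
  simp only [wForm, map_sub, map_add, map_mul, map_pow, hC]
  simp [dehomPoly, wCurve, WeierstrassCurve.Affine.polynomial]

/-- Dehomogenization with values in the coordinate ring of the affine Weierstrass curve. -/
def dehom : Forms →+* (wCurve a₂ a₄ a₆).CoordinateRing :=
  (WeierstrassCurve.Affine.CoordinateRing.mk (wCurve a₂ a₄ a₆)).comp
    (dehomPoly : Forms →+* Polynomial (Polynomial ℂ))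

theorem dehom_apply (G : Forms) : dehom a₂ a₄ a₆ G =
    WeierstrassCurve.Affine.CoordinateRing.mk (wCurve a₂ a₄ a₆) (dehomPoly G) := rfl

theorem dehom_wForm : dehom a₂ a₄ a₆ (wForm a₂ a₄ a₆) = 0 := by
  rw [dehom_apply, dehomPoly_wForm]; exact AdjoinRoot.mk_self

theorem not_X_two_dvd_wForm : ¬ (X 2 : Forms) ∣ wForm a₂ a₄ a₆ := by
  rintro ⟨Q, hQ⟩
  have := congrArg (eval ![1, 0, 0]) hQ
  simp [eval_wForm] at this

/-- An affine multiple of the Weierstrass polynomial homogenizes up to powers of `X 2`. These cancel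
because `X 2` is prime and does not divide `wForm`. -/
theorem wForm_dvd_of_dehom_eq_zero {G : Forms} {d : ℕ} (hG : G.IsHomogeneous d)
    (h : dehom a₂ a₄ a₆ G = 0) : wForm a₂ a₄ a₆ ∣ G := by
  have hX2 : dehomPoly (X 2) = 1 := by simp [dehomPoly]
  have hX : (X 2 : Forms).IsHomogeneous 1 := isHomogeneous_X ℂ 2
  rw [dehom_apply] at h
  obtain ⟨q, hq⟩ := AdjoinRoot.mk_eq_zero.mp h
  obtain ⟨n, Q, hQ, rfl⟩ := exists_isHomogeneous_dehomPoly q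
  have hd : X 2 ^ (3 + n) * G = X 2 ^ d * (wForm a₂ a₄ a₆ * Q) := by
    rw [← sub_eq_zero]
    refine eq_zero_of_dehomPoly_eq_zero (d := 3 + n + d) (IsHomogeneous.sub ?_ ?_) ?_
    · simpa using (hX.pow (3 + n)).mul hG
    · simpa [add_comm] using (hX.pow d).mul ((wForm_isHomogeneous a₂ a₄ a₆).mul hQ)
    · simp [hX2, hq, dehomPoly_wForm]
  have hdvd : wForm a₂ a₄ a₆ ∣ X 2 ^ (3 + n) * G := ⟨X 2 ^ d * Q, by rw [hd]; ring⟩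
  have hp : Prime (X 2 : Forms) := X_prime
  obtain ⟨Q', hQ'⟩ := hdvd
  obtain ⟨Q'', rfl⟩ := hp.pow_dvd_of_dvd_mul_left (3 + n) (not_X_two_dvd_wForm a₂ a₄ a₆)
    ⟨G, hQ'.symm⟩
  refine ⟨Q'', mul_left_cancel₀ (pow_ne_zero (3 + n) hp.ne_zero) ?_⟩
  rw [hQ']; ring

end Dehomogenization
end PlaneCubic

namespace PlaneCubic

/-! ### Ideals of the affine coordinate ring as products of ideals of points. -/

section Factorization

open WeierstrassCurve.Affine

variable {F : Type*} [Field F] {W : WeierstrassCurve.Affine F}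

/-- The ideal of the coordinate ring that belongs to a point; the unit ideal for the point at
infinity. -/
def placeIdeal : W.Point → Ideal W.CoordinateRing
  | .zero => ⊤
  | .some x y _ => CoordinateRing.XYIdeal W x (Polynomial.C y)

/-- The invertible fractional ideal that belongs to a point. -/
def placeUnit : W.Point → (FractionalIdeal (nonZeroDivisors W.CoordinateRing) W.FunctionField)ˣ
  | .zero => 1
  | .some _ _ h => CoordinateRing.XYIdeal' h

theorem coe_placeUnit (P : W.Point) :
    (placeUnit P : FractionalIdeal (nonZeroDivisors W.CoordinateRing) W.FunctionField) =
      placeIdeal P := by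
  rcases P with _ | ⟨x, y, h⟩
  · simp [placeUnit, placeIdeal]
  · exact CoordinateRing.XYIdeal'_eq h

section Class

variable [DecidableEq F]

theorem toClass_eq_mk_placeUnit (P : W.Point) :
    Point.toClass P = Additive.ofMul (ClassGroup.mk W.FunctionField (placeUnit P)) := by
  rcases P with _ | ⟨x, y, h⟩
  · simp only [placeUnit, map_one]; rfl
  · rfl

theorem toClass_multiset_sum (s : Multiset W.Point) :
    Point.toClass s.sum =
      Additive.ofMul (ClassGroup.mk W.FunctionField (s.map placeUnit).prod) := by
  induction s using Multiset.induction_on with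
  | empty => simp
  | cons P s ih =>
    rw [Multiset.sum_cons, map_add, ih, toClass_eq_mk_placeUnit, Multiset.map_cons,
      Multiset.prod_cons, map_mul, ofMul_mul]

/-- The points of a principal divisor of the affine curve add up to zero. -/
theorem sum_eq_zero_of_prod_placeIdeal_eq {s : Multiset W.Point} {g : W.CoordinateRing}
    (hg : g ≠ 0) (h : (s.map placeIdeal).prod = Ideal.span {g}) : s.sum = 0 := by
  refine Point.toClass_injective ?_
  rw [toClass_multiset_sum, map_zero, ← ofMul_one]
  congr 1
  refine (ClassGroup.mk_eq_one_of_coe_ideal (I' := Ideal.span {g}) ?_).mpr ⟨g, hg, rfl⟩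
  rw [← h]
  clear h
  induction s using Multiset.induction_on with
  | empty => simp
  | cons P s ih => simp [ih, coe_placeUnit, FractionalIdeal.coeIdeal_mul]

end Class

theorem XYIdeal_isMaximal {x y : F} (h : W.Equation x y) :
    (CoordinateRing.XYIdeal W x (Polynomial.C y)).IsMaximal := by
  have e := (CoordinateRing.quotientXYIdealEquiv (W' := W) (x := x) (y := Polynomial.C y) h)
  exact Ideal.Quotient.maximal_of_isField _ (MulEquiv.isField (Field.toIsField F) e.toMulEquiv)

instance : IsNoetherianRing W.CoordinateRing :=
  isNoetherianRing_of_surjective (Polynomial (Polynomial F)) _ (CoordinateRing.mk W)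
    AdjoinRoot.mk_surjective

/-- The polynomial p - p(x, y) lies in (X - x, Y - y). An arbitrary ideal m is allowed since
`exists_eq_XYIdeal` uses this before m is known to be an `XYIdeal`. -/
theorem mk_eq_of_mem {x y : F} {m : Ideal W.CoordinateRing}
    (hx : CoordinateRing.XClass W x ∈ m)
    (hy : CoordinateRing.YClass W (Polynomial.C y) ∈ m) (p : Polynomial (Polynomial F)) :
    CoordinateRing.mk W p - algebraMap F _ (Polynomial.evalEval x y p) ∈ m := by
  have hC : ∀ c : F, algebraMap F W.CoordinateRing c =
    CoordinateRing.mk W (Polynomial.C (Polynomial.C c)) := fun _ => rfl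
  obtain ⟨a, b, hab⟩ := Ideal.mem_span_pair.mp
    ((Polynomial.mem_span_C_X_sub_C_X_sub_C_iff_eval_eval_eq_zero (R := F) (a := x)
      (b := Polynomial.C y)
      (P := p - Polynomial.C (Polynomial.C (Polynomial.evalEval x y p)))).mpr
        (by simp [Polynomial.evalEval]))
  rw [hC, ← map_sub, ← hab, map_add, map_mul, map_mul]
  exact m.add_mem (m.mul_mem_left _ hx) (m.mul_mem_left _ hy)

/-- Nullstellensatz: the residue field is of finite type, hence finite over F, hence equal to F; x
and y are the residues of the coordinates. -/
theorem exists_eq_XYIdeal [IsAlgClosed F] (m : Ideal W.CoordinateRing) [hm : m.IsMaximal] :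
    ∃ x y : F, W.Equation x y ∧ m = CoordinateRing.XYIdeal W x (Polynomial.C y) := by
  let := Ideal.Quotient.field m
  have hft : Algebra.FiniteType F W.CoordinateRing :=
    Algebra.FiniteType.of_surjective
      ({ CoordinateRing.mk W with commutes' := fun _ => rfl } :
        Polynomial (Polynomial F) →ₐ[F] W.CoordinateRing) AdjoinRoot.mk_surjective
  have : Algebra.FiniteType F (W.CoordinateRing ⧸ m) :=
    hft.of_surjective (Ideal.Quotient.mkₐ F m) Ideal.Quotient.mk_surjective
  have : Module.Finite F (W.CoordinateRing ⧸ m) := finite_of_finite_type_of_isJacobsonRing F _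
  have hbij := IsAlgClosed.algebraMap_bijective_of_isIntegral (k := F)
    (K := W.CoordinateRing ⧸ m)
  obtain ⟨x, hx⟩ := hbij.2 (Ideal.Quotient.mk m (CoordinateRing.mk W (Polynomial.C Polynomial.X)))
  obtain ⟨y, hy⟩ := hbij.2 (Ideal.Quotient.mk m (CoordinateRing.mk W Polynomial.X))
  have hxm : CoordinateRing.XClass W x ∈ m := by
    rw [CoordinateRing.XClass, Polynomial.C_sub, map_sub, ← Ideal.Quotient.mk_eq_mk_iff_sub_mem,
      ← hx]; rfl
  have hym : CoordinateRing.YClass W (Polynomial.C y) ∈ m := by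
    rw [CoordinateRing.YClass, map_sub, ← Ideal.Quotient.mk_eq_mk_iff_sub_mem, ← hy]; rfl
  have heq : W.Equation x y := by
    have h := mk_eq_of_mem hxm hym W.polynomial
    rw [show CoordinateRing.mk W W.polynomial = 0 from AdjoinRoot.mk_self, zero_sub,
      neg_mem_iff, ← Ideal.Quotient.eq_zero_iff_mem] at h
    refine hbij.1 ?_
    rw [map_zero, ← h]; rfl
  refine ⟨x, y, heq, ((XYIdeal_isMaximal heq).eq_of_le hm.ne_top ?_).symm⟩
  rw [CoordinateRing.XYIdeal, Ideal.span_le]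
  rintro _ (rfl | rfl)
  exacts [hxm, hym]

/-- On a smooth affine Weierstrass curve every nonzero ideal is a product of ideals of points. -/
theorem exists_prod_placeIdeal [IsAlgClosed F] (hW : ∀ x y, W.Equation x y → W.Nonsingular x y)
    (I : Ideal W.CoordinateRing) (hI : I ≠ ⊥) :
    ∃ s : Multiset W.Point, (s.map placeIdeal).prod = I := by
  induction I using WellFoundedGT.induction with
  | ind I ih =>
  by_cases htop : I = ⊤
  · exact ⟨0, by simp [htop]⟩
  obtain ⟨m, hm, hle⟩ := Ideal.exists_le_maximal I htop
  obtain ⟨x, y, heq, rfl⟩ := exists_eq_XYIdeal m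
  set m := CoordinateRing.XYIdeal W x (Polynomial.C y)
  set m' := CoordinateRing.XYIdeal W x (Polynomial.C (W.negY x y))
  set ξ := CoordinateRing.XClass W x
  -- The ideals of a point and of its negative multiply to a principal ideal, so m is invertible and
  -- I ≤ m can be divided by m.
  have hmm : m' * m = Ideal.span {ξ} := CoordinateRing.XYIdeal_neg_mul (hW x y heq)
  have hξ : ξ ≠ 0 := CoordinateRing.XClass_ne_zero x
  have hle' : m' * I ≤ Ideal.span {ξ} := hmm ▸ Ideal.mul_mono_right hle
  obtain ⟨J, hJ⟩ : ∃ J, m' * I = Ideal.span {ξ} * J := by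
    refine ⟨(m' * I).colon {ξ}, le_antisymm (fun z hz => ?_) ?_⟩
    · obtain ⟨w, rfl⟩ := Ideal.mem_span_singleton'.mp (hle' hz)
      rw [mul_comm w]
      exact Ideal.mul_mem_mul (Ideal.mem_span_singleton_self ξ)
        (Submodule.mem_colon_singleton.mpr (by simpa using hz))
    · rw [Ideal.span_singleton_mul_le_iff]
      intro z hz
      simpa [mul_comm] using Submodule.mem_colon_singleton.mp hz
  have hIJ : I = m * J := by
    rw [← Ideal.span_singleton_mul_right_inj hξ, mul_left_comm, ← hJ, ← hmm]
    ring
  have hIJle : I ≤ J := hIJ.trans_le Ideal.mul_le_right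
  -- If I = m * I, then I lies in every power of m and is zero by Krull.
  have hlt : I < J := by
    refine lt_of_le_of_ne hIJle fun h => hI ?_
    rw [← h] at hIJ
    have hpow : ∀ n, I ≤ m ^ n := fun n => by
      induction n with
      | zero => simp
      | succ n ihn =>
        rw [hIJ, pow_succ']
        exact Ideal.mul_mono_right ihn
    rw [eq_bot_iff, ← Ideal.iInf_pow_eq_bot_of_isDomain m hm.ne_top]
    exact le_iInf hpow
  obtain ⟨s, hs⟩ := ih J hlt (ne_bot_of_le_ne_bot hI hIJle)
  exact ⟨.some x y (hW x y heq) ::ₘ s, by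
    rw [Multiset.map_cons, Multiset.prod_cons, hs, hIJ]; rfl⟩

/-- Distinct points have comaximal ideals; in particular one is not contained in the other. -/
theorem placeIdeal_not_le {x y : F} (h : W.Nonsingular x y) {Q : W.Point}
    (hQ : Q ≠ .some x y h) : ¬ placeIdeal Q ≤ CoordinateRing.XYIdeal W x (Polynomial.C y) := by
  intro hle
  have hm := XYIdeal_isMaximal h.1
  rcases Q with _ | ⟨x', y', h'⟩
  · exact hm.ne_top (top_le_iff.mp hle)
  have heq : CoordinateRing.XYIdeal W x' (Polynomial.C y') =
      CoordinateRing.XYIdeal W x (Polynomial.C y) :=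
    (XYIdeal_isMaximal h'.1).eq_of_le hm.ne_top hle
  have hne : ∀ c : F, c ≠ 0 → algebraMap F W.CoordinateRing c ∉
      CoordinateRing.XYIdeal W x (Polynomial.C y) := fun c hc hmem =>
    hm.ne_top (Ideal.eq_top_of_isUnit_mem _ hmem ((IsUnit.mk0 c hc).map _))
  have hx : CoordinateRing.XClass W x ∈ CoordinateRing.XYIdeal W x (Polynomial.C y) :=
    Ideal.subset_span (by simp)
  have hy : CoordinateRing.YClass W (Polynomial.C y) ∈
      CoordinateRing.XYIdeal W x (Polynomial.C y) := Ideal.subset_span (by simp)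
  have hx' : CoordinateRing.XClass W x' ∈ CoordinateRing.XYIdeal W x (Polynomial.C y) :=
    heq ▸ Ideal.subset_span (by simp)
  have hy' : CoordinateRing.YClass W (Polynomial.C y') ∈
      CoordinateRing.XYIdeal W x (Polynomial.C y) := heq ▸ Ideal.subset_span (by simp)
  have h1 := mk_eq_of_mem hx hy (Polynomial.C (Polynomial.X - Polynomial.C x'))
  have h2 := mk_eq_of_mem hx hy (Polynomial.X - Polynomial.C (Polynomial.C y'))
  have h1' := (Submodule.sub_mem_iff_right _ hx').mp h1
  have h2' := (Submodule.sub_mem_iff_right _ hy').mp h2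
  have e1 : x = x' := by
    by_contra hc
    exact hne _ (sub_ne_zero.mpr hc) (by simpa [Polynomial.evalEval] using h1')
  have e2 : y = y' := by
    by_contra hc
    exact hne _ (sub_ne_zero.mpr hc) (by simpa [Polynomial.evalEval] using h2')
  subst e1 e2
  exact hQ rfl

/-- Splitting off the part of a product of ideals of points that belongs to one point. -/
theorem exists_prod_placeIdeal_eq_pow_mul [DecidableEq W.Point] (s : Multiset W.Point) {x y : F}
    (h : W.Nonsingular x y) : ∃ J : Ideal W.CoordinateRing,
      (s.map placeIdeal).prod =
        CoordinateRing.XYIdeal W x (Polynomial.C y) ^ s.count (.some x y h) * J ∧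
      ¬ J ≤ CoordinateRing.XYIdeal W x (Polynomial.C y) := by
  have hm := XYIdeal_isMaximal h.1
  induction s using Multiset.induction_on with
  | empty => exact ⟨⊤, by simp [Ideal.one_eq_top], fun hle => hm.ne_top (top_le_iff.mp hle)⟩
  | cons Q s ih =>
    obtain ⟨J, hJ, hJm⟩ := ih
    by_cases hQ : Q = .some x y h
    · refine ⟨J, ?_, hJm⟩
      rw [Multiset.map_cons, Multiset.prod_cons, hJ, hQ, Multiset.count_cons_self, pow_succ',
        mul_assoc]
      rfl
    · refine ⟨placeIdeal Q * J, ?_, fun hle => ?_⟩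
      · rw [Multiset.map_cons, Multiset.prod_cons, hJ, Multiset.count_cons_of_ne (Ne.symm hQ)]
        ring
      · rcases (hm.isPrime.mul_le).mp hle with h1 | h1
        exacts [placeIdeal_not_le h hQ h1, hJm h1]

end Factorization
end PlaneCubic

namespace PlaneCubic
open MvPolynomial

/-! ### Local parameters at affine points. -/

section LocalParameter

variable (a₂ a₄ a₆ : ℂ)

theorem dehom_C (c : ℂ) : dehom a₂ a₄ a₆ (C c) = algebraMap ℂ _ c := by
  rw [dehom_apply, ← MvPolynomial.algebraMap_eq, AlgHom.commutes]; rfl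

theorem dehom_X_two : dehom a₂ a₄ a₆ (X 2) = 1 := by
  simp [dehom_apply, dehomPoly]

theorem dehom_X_zero_sub (x : ℂ) : dehom a₂ a₄ a₆ (X 0 - C x * X 2) =
    WeierstrassCurve.Affine.CoordinateRing.XClass (wCurve a₂ a₄ a₆) x := by
  rw [map_sub, map_mul, dehom_X_two, mul_one, dehom_C]
  simp [dehom_apply, dehomPoly, WeierstrassCurve.Affine.CoordinateRing.XClass]
  rfl

theorem dehom_X_one_sub (y : ℂ) : dehom a₂ a₄ a₆ (X 1 - C y * X 2) =
    WeierstrassCurve.Affine.CoordinateRing.YClass (wCurve a₂ a₄ a₆) (Polynomial.C y) := by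
  rw [map_sub, map_mul, dehom_X_two, mul_one, dehom_C]
  simp [dehom_apply, dehomPoly, WeierstrassCurve.Affine.CoordinateRing.YClass]
  rfl

/-- A polynomial that vanishes on the line of multiples of `(x, y, 1)` lies in the ideal generated
by two linear forms. -/
theorem mem_span_linear_of_eval_smul {x y : ℂ} {G : Forms}
    (hG : ∀ t : ℂ, eval (t • ![x, y, 1]) G = 0) :
    G ∈ Ideal.span {X 0 - C x * X 2, X 1 - C y * X 2} := by
  set I : Ideal Forms := Ideal.span {X 0 - C x * X 2, X 1 - C y * X 2}
  -- φ restricts to the line through (x, y, 1), with `X 2` as coordinate, and is the identity modulo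
  -- I.
  set φ : Forms →ₐ[ℂ] Forms := aeval ![C x * X 2, C y * X 2, X 2] with hφ
  have h1 : ∀ H : Forms, H - φ H ∈ I := fun H => by
    induction H using MvPolynomial.induction_on with
    | C c => simp [hφ, MvPolynomial.algebraMap_eq]
    | add p q hp hq => simpa [add_sub_add_comm] using I.add_mem hp hq
    | mul_X p i hp =>
      have hi : X i - φ (X i) ∈ I := by
        fin_cases i
        · simpa [hφ] using Ideal.subset_span (by simp)
        · simpa [hφ] using Ideal.subset_span (by simp)
        · simp [hφ]
      have : p * X i - φ (p * X i) = (p - φ p) * X i + φ p * (X i - φ (X i)) := by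
        rw [map_mul]; ring
      rw [this]
      exact I.add_mem (I.mul_mem_right _ hp) (I.mul_mem_left _ hi)
  have h2 : φ G = 0 := by
    refine MvPolynomial.funext fun v => ?_
    have : eval v (φ G) = eval (v 2 • ![x, y, 1]) G := by
      rw [← coe_aeval_eq_eval, ← coe_aeval_eq_eval]
      change aeval v (φ G) = aeval _ G
      rw [hφ, ← AlgHom.comp_apply, comp_aeval]
      congr 2
      ext i; fin_cases i <;> simp [mul_comm]
    rw [this, hG, map_zero]
  simpa [h2] using h1 G

/-- At a nonsingular point `(x, y, 1)`, the curve has a linear local parameter `T`. -/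
theorem exists_localParameter {x y : ℂ} (h : (wCurve a₂ a₄ a₆).Nonsingular x y) :
    ∃ T s : Forms, T.IsHomogeneous 1 ∧ s.IsHomogeneous 2 ∧ eval ![x, y, 1] s ≠ 0 ∧
      T ∈ Ideal.span {X 0 - C x * X 2, X 1 - C y * X 2} ∧
      s * (X 0 - C x * X 2) ∈ Ideal.span {wForm a₂ a₄ a₆, T} ∧
      s * (X 1 - C y * X 2) ∈ Ideal.span {wForm a₂ a₄ a₆, T} ∧
      dehom a₂ a₄ a₆ T ≠ 0 := by
  obtain ⟨heq, hns⟩ := (wCurve_nonsingular_iff ..).mp h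
  have hX : ∀ i : Fin 3, (X i : Forms).IsHomogeneous 1 := isHomogeneous_X ℂ
  have hC : ∀ c : ℂ, (C c : Forms).IsHomogeneous 0 := isHomogeneous_C _
  have hCX : ∀ (c : ℂ) (i : Fin 3), (C c * X i : Forms).IsHomogeneous 1 := fun c i => by
    simpa using (hC c).mul (hX i)
  set q : Forms := X 0 ^ 2 + C x * X 2 * X 0 + (C x * X 2) ^ 2 +
    (C a₂ * X 2) * (X 0 + C x * X 2) + C a₄ * X 2 * X 2 with hq
  have hqh : q.IsHomogeneous 2 := by
    refine (((IsHomogeneous.add ?_ ?_).add ?_).add ?_).add ?_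
    · simpa using (hX 0).pow 2
    · simpa using (hCX x 2).mul (hX 0)
    · simpa using (hCX x 2).pow 2
    · simpa using (hCX a₂ 2).mul ((hX 0).add (hCX x 2))
    · simpa using (hCX a₄ 2).mul (hX 2)
  have hCeq : (C y : Forms) ^ 2 = C x ^ 3 + C a₂ * C x ^ 2 + C a₄ * C x + C a₆ := by
    rw [← C_pow, heq]; simp
  -- Modulo the curve, the two linear forms are proportional with factors of values 2y and f'(x) at
  -- the point, where f is the cubic polynomial. Whichever is nonzero serves as s, and the linear
  -- form not multiplied by it is the parameter T.
  have key : wForm a₂ a₄ a₆ = (X 1 + C y * X 2) * X 2 * (X 1 - C y * X 2) -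
      q * (X 0 - C x * X 2) := by
    rw [wForm, hq]
    linear_combination X 2 ^ 3 * hCeq
  by_cases hy : y = 0
  · refine ⟨X 1 - C y * X 2, q, (hX 1).sub (hCX y 2), hqh, ?_, Ideal.subset_span (by simp), ?_,
      Ideal.mul_mem_left _ _ (Ideal.subset_span (by simp)), ?_⟩
    · have := hns.resolve_right (by simp [hy])
      convert this using 1
      simp [hq]; ring
    · exact Ideal.mem_span_pair.mpr ⟨-1, (X 1 + C y * X 2) * X 2, by rw [key]; ring⟩
    · rw [dehom_X_one_sub]
      exact WeierstrassCurve.Affine.CoordinateRing.YClass_ne_zero _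
  · refine ⟨X 0 - C x * X 2, (X 1 + C y * X 2) * X 2, (hX 0).sub (hCX x 2),
      ((hX 1).add (hCX y 2)).mul (hX 2), ?_, Ideal.subset_span (by simp),
      Ideal.mul_mem_left _ _ (Ideal.subset_span (by simp)), ?_, ?_⟩
    · simp [hy]
    · exact Ideal.mem_span_pair.mpr ⟨1, q, by rw [key]; ring⟩
    · rw [dehom_X_zero_sub]
      exact WeierstrassCurve.Affine.CoordinateRing.XClass_ne_zero _

variable {a₂ a₄ a₆}

theorem dehom_sub_eval_mem (x y : ℂ) (G : Forms) : dehom a₂ a₄ a₆ G -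
    algebraMap ℂ _ (eval ![x, y, 1] G) ∈
      WeierstrassCurve.Affine.CoordinateRing.XYIdeal (wCurve a₂ a₄ a₆) x (Polynomial.C y) := by
  rw [← evalEval_dehomPoly]
  exact mk_eq_of_mem (Ideal.subset_span (by simp)) (Ideal.subset_span (by simp)) _

theorem dehom_mem_iff {x y : ℂ} (h : (wCurve a₂ a₄ a₆).Equation x y) (G : Forms) :
    dehom a₂ a₄ a₆ G ∈
      WeierstrassCurve.Affine.CoordinateRing.XYIdeal (wCurve a₂ a₄ a₆) x (Polynomial.C y) ↔
    eval ![x, y, 1] G = 0 := by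
  have h1 := dehom_sub_eval_mem (a₂ := a₂) (a₄ := a₄) (a₆ := a₆) x y G
  constructor
  · intro h2
    by_contra hc
    exact (XYIdeal_isMaximal h).ne_top (Ideal.eq_top_of_isUnit_mem _
      ((Submodule.sub_mem_iff_right _ h2).mp h1) ((IsUnit.mk0 _ hc).map _))
  · intro h2
    simpa [h2] using h1

theorem dehom_mem_span_of_mem {T G : Forms} (h : G ∈ Ideal.span {wForm a₂ a₄ a₆, T}) :
    dehom a₂ a₄ a₆ G ∈ Ideal.span {dehom a₂ a₄ a₆ T} := by
  obtain ⟨p, q, rfl⟩ := Ideal.mem_span_pair.mp h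
  rw [map_add, map_mul, map_mul, dehom_wForm, mul_zero, zero_add]
  exact Ideal.mul_mem_left _ _ (Ideal.mem_span_singleton_self _)

/-- Local principality: if `σ 𝔪 ⊆ (τ)` with `σ ∉ 𝔪` and `(g) = 𝔪 ^ e * J` with `J` prime to `𝔪`,
then `g` is locally `τ ^ e`, up to a unit. -/
theorem exists_notMem_mul_pow_eq {R : Type*} [CommRing R] [IsDomain R] {m J : Ideal R}
    (hm : m.IsPrime) {σ τ g : R} {e : ℕ} (hσ : Ideal.span {σ} * m ≤ Ideal.span {τ}) (hσm : σ ∉ m)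
    (hτ : τ ≠ 0) (hτm : τ ∈ m) (hg : Ideal.span {g} = m ^ e * J) (hJ : ¬ J ≤ m) :
    ∃ η ∉ m, σ ^ e * g = η * τ ^ e := by
  have hσ' : Ideal.span {σ ^ e} * m ^ e ≤ Ideal.span {τ ^ e} := by
    rw [← Ideal.span_singleton_pow, ← Ideal.span_singleton_pow, ← mul_pow]
    exact Ideal.pow_right_mono hσ e
  have hgm : g ∈ m ^ e := by
    have h : Ideal.span {g} ≤ m ^ e := hg.trans_le Ideal.mul_le_left
    exact h (Ideal.mem_span_singleton_self g)
  have hmem : σ ^ e * g ∈ Ideal.span {σ ^ e} * m ^ e :=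
    Ideal.mul_mem_mul (Ideal.mem_span_singleton_self (σ ^ e)) hgm
  obtain ⟨η, hη⟩ := Ideal.mem_span_singleton'.mp (hσ' hmem)
  obtain ⟨j, hj, hjm⟩ := Set.not_subset.mp hJ
  -- Cancelling τ ^ e from the two relations gives k * η = σ ^ e * j. The right side is outside the
  -- prime m, hence so is η.
  obtain ⟨k, hk⟩ : ∃ k, k * g = τ ^ e * j := by
    rw [← Ideal.mem_span_singleton', hg]
    exact Ideal.mul_mem_mul (Ideal.pow_mem_pow hτm e) hj
  refine ⟨η, fun hη' => ?_, hη.symm⟩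
  have h1 : k * η = σ ^ e * j := by
    refine mul_right_cancel₀ (pow_ne_zero e hτ) ?_
    linear_combination k * hη + σ ^ e * hk
  have h2 : σ ^ e * j ∈ m := h1 ▸ m.mul_mem_left _ hη'
  rcases hm.mem_or_mem h2 with h3 | h3
  · exact hσm (hm.mem_of_pow_mem _ h3)
  · exact hjm h3

/-- If the ideal of `G` on the affine curve is `𝔪 ^ e * J` with `J` prime to `𝔪`, then `G` is
locally `T ^ e`, up to a unit. -/
theorem exists_mul_sub_mul_pow_mem {x y : ℂ} (h : (wCurve a₂ a₄ a₆).Nonsingular x y)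
    {T s : Forms} (hT : T.IsHomogeneous 1) (hs : s.IsHomogeneous 2)
    (hsu : eval ![x, y, 1] s ≠ 0)
    (hTm : T ∈ Ideal.span {X 0 - C x * X 2, X 1 - C y * X 2})
    (hsx : s * (X 0 - C x * X 2) ∈ Ideal.span {wForm a₂ a₄ a₆, T})
    (hsy : s * (X 1 - C y * X 2) ∈ Ideal.span {wForm a₂ a₄ a₆, T})
    (hT0 : dehom a₂ a₄ a₆ T ≠ 0) {G : Forms} {d : ℕ} (hG : G.IsHomogeneous d) {e : ℕ}
    {J : Ideal (wCurve a₂ a₄ a₆).CoordinateRing}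
    (hGJ : Ideal.span {dehom a₂ a₄ a₆ G} = WeierstrassCurve.Affine.CoordinateRing.XYIdeal
      (wCurve a₂ a₄ a₆) x (Polynomial.C y) ^ e * J)
    (hJ : ¬ J ≤ WeierstrassCurve.Affine.CoordinateRing.XYIdeal
      (wCurve a₂ a₄ a₆) x (Polynomial.C y)) :
    ∃ p q : Forms, eval ![x, y, 1] p ≠ 0 ∧ eval ![x, y, 1] q ≠ 0 ∧
      p * G - q * T ^ e ∈ Ideal.span {wForm a₂ a₄ a₆} := by
  have hmmax := XYIdeal_isMaximal h.1
  have hX : (X 2 : Forms).IsHomogeneous 1 := isHomogeneous_X ℂ 2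
  obtain ⟨η, hηm, hη⟩ : ∃ η ∉ WeierstrassCurve.Affine.CoordinateRing.XYIdeal
      (wCurve a₂ a₄ a₆) x (Polynomial.C y),
      dehom a₂ a₄ a₆ s ^ e * dehom a₂ a₄ a₆ G = η * dehom a₂ a₄ a₆ T ^ e := by
    refine exists_notMem_mul_pow_eq hmmax.isPrime ?_ (fun hc => hsu ((dehom_mem_iff h.1 s).mp hc))
      hT0 ?_ hGJ hJ
    · rw [Ideal.span_singleton_mul_le_iff]
      intro z hz
      obtain ⟨z₁, z₂, rfl⟩ := Ideal.mem_span_pair.mp hz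
      rw [← dehom_X_zero_sub, ← dehom_X_one_sub]
      have h1 := dehom_mem_span_of_mem hsx
      have h2 := dehom_mem_span_of_mem hsy
      rw [map_mul] at h1 h2
      rw [mul_add, mul_left_comm, mul_left_comm _ z₂]
      exact Ideal.add_mem _ (Ideal.mul_mem_left _ z₁ h1) (Ideal.mul_mem_left _ z₂ h2)
    · obtain ⟨p, q, rfl⟩ := Ideal.mem_span_pair.mp hTm
      rw [map_add, map_mul, map_mul, dehom_X_zero_sub, dehom_X_one_sub]
      exact Ideal.add_mem _ (Ideal.mul_mem_left _ _ (Ideal.subset_span (by simp)))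
        (Ideal.mul_mem_left _ _ (Ideal.subset_span (by simp)))
  obtain ⟨p, hp⟩ := AdjoinRoot.mk_surjective η
  obtain ⟨n, H, hH, rfl⟩ := exists_isHomogeneous_dehomPoly p
  have hHη : dehom a₂ a₄ a₆ H = η := hp
  have hmem : wForm a₂ a₄ a₆ ∣ s ^ e * X 2 ^ (n + e) * G - H * X 2 ^ (2 * e + d) * T ^ e := by
    refine wForm_dvd_of_dehom_eq_zero a₂ a₄ a₆ (d := 2 * e + (n + e) + d)
      (IsHomogeneous.sub ?_ ?_) ?_
    · simpa using ((hs.pow e).mul (hX.pow (n + e))).mul hG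
    · rw [show 2 * e + (n + e) + d = n + 1 * (2 * e + d) + 1 * e by ring]
      exact (hH.mul (hX.pow (2 * e + d))).mul (hT.pow e)
    · simp only [map_sub, map_mul, map_pow, dehom_X_two, hHη, one_pow, mul_one]
      rw [hη, sub_self]
  refine ⟨s ^ e * X 2 ^ (n + e), H * X 2 ^ (2 * e + d), by simpa using fun h0 => (hsu h0).elim,
    ?_, Ideal.mem_span_singleton.mpr hmem⟩
  have : eval ![x, y, 1] H ≠ 0 := fun h0 => hηm (hHη ▸ (dehom_mem_iff h.1 H).mpr h0)
  simpa using this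

/-- A multiple of a power of the local parameter lies in the ideal of the curve only if the factor
vanishes at the point. -/
theorem eval_smul_eq_zero_of_mul_pow_mem {x y : ℂ} (h : (wCurve a₂ a₄ a₆).Equation x y)
    {T s : Forms} (hT : T.IsHomogeneous 1) (hT0 : dehom a₂ a₄ a₆ T ≠ 0) (n : ℕ)
    (hs : s * T ^ n ∈ Ideal.span {wForm a₂ a₄ a₆}) (t : ℂ) : eval (t • ![x, y, 1]) s = 0 := by
  set R := (wCurve a₂ a₄ a₆).CoordinateRing
  set ρ : Fin 3 → R := fun i => dehom a₂ a₄ a₆ (X i) with hρ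
  -- The extra variable records the degree, so θ can be applied to s, which need not be homogeneous.
  -- It kills the curve but not T, and its target is a domain; hence θ s = 0, and specializing the
  -- coordinate ring at the point gives the claim.
  set θ : Forms →ₐ[ℂ] Polynomial R := aeval fun i => Polynomial.C (ρ i) * Polynomial.X with hθ
  have hρa : ∀ G : Forms, aeval (fun i => Polynomial.C (ρ i)) G =
      Polynomial.C (dehom a₂ a₄ a₆ G) := fun G => by
    induction G using MvPolynomial.induction_on with
    | C c => rw [dehom_C, ← MvPolynomial.algebraMap_eq, AlgHom.commutes]; rfl
    | add p q hp hq => simp [hp, hq]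
    | mul_X p i hp => rw [map_mul, hp]; simp [hρ]
  have hθh : ∀ {G : Forms} {d : ℕ}, G.IsHomogeneous d →
      θ G = Polynomial.C (dehom a₂ a₄ a₆ G) * Polynomial.X ^ d := fun hG => by
    rw [hθ, aeval_mul_of_isHomogeneous hG, hρa]
  have h1 : θ s = 0 := by
    obtain ⟨p, hp⟩ := Ideal.mem_span_singleton.mp hs
    have h2 := congrArg θ hp
    rw [map_mul, map_mul, map_pow, hθh (wForm_isHomogeneous ..), dehom_wForm, hθh hT, map_zero,
      zero_mul, zero_mul] at h2
    refine (mul_eq_zero.mp h2).resolve_right (pow_ne_zero _ (mul_ne_zero ?_ ?_))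
    · simpa using hT0
    · simp
  obtain ⟨ev, hev⟩ : ∃ ev : R →+* ℂ, ∀ p : Polynomial (Polynomial ℂ),
      ev (AdjoinRoot.mk _ p) = Polynomial.evalEval x y p := by
    refine ⟨AdjoinRoot.lift (Polynomial.evalRingHom x) y ?_, fun p => ?_⟩
    · rw [Polynomial.eval₂_evalRingHom]; exact h
    · rw [AdjoinRoot.lift_mk, Polynomial.eval₂_evalRingHom]
  have h2 : ∀ G : Forms, Polynomial.eval₂ ev t (θ G) = eval (t • ![x, y, 1]) G := fun G => by
    induction G using MvPolynomial.induction_on with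
    | C c =>
      rw [← MvPolynomial.algebraMap_eq, AlgHom.commutes, MvPolynomial.algebraMap_eq, eval_C,
        Polynomial.algebraMap_apply, Polynomial.eval₂_C]
      change ev (AdjoinRoot.mk _ (Polynomial.C (Polynomial.C c))) = c
      rw [hev]
      simp [Polynomial.evalEval]
    | add p q hp hq => rw [map_add, Polynomial.eval₂_add, hp, hq, map_add]
    | mul_X p i hp =>
      rw [map_mul, Polynomial.eval₂_mul, hp, map_mul, eval_X]
      congr 1
      have hi : ev (ρ i) = ![x, y, 1] i := by
        change ev (AdjoinRoot.mk _ (dehomPoly (X i))) = _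
        rw [hev, evalEval_dehomPoly, eval_X]
      rw [hθ, aeval_X, Polynomial.eval₂_mul, Polynomial.eval₂_C, Polynomial.eval₂_X, hi, mul_comm]
      rfl
  rw [← h2, h1, Polynomial.eval₂_zero]

end LocalParameter
end PlaneCubic

namespace PlaneCubic
open MvPolynomial

/-! ### Intersection multiplicity as an exponent in the affine coordinate ring. -/

section Intersection

theorem affineVector_ne_zero (M : (Fin 3 → ℂ) ≃ₗ[ℂ] (Fin 3 → ℂ)) (x y : ℂ) :
    M ![x, y, 1] ≠ 0 := by
  rw [Ne, LinearEquiv.map_eq_zero_iff]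
  intro h
  simpa using congrFun h 2

variable {a₂ a₄ a₆ c : ℂ} {F : Forms} {M : (Fin 3 → ℂ) ≃ₗ[ℂ] (Fin 3 → ℂ)}

theorem eval_apply_of_subst_eq (hFM : subst M.toLinearMap F = C c * wForm a₂ a₄ a₆)
    (u : Fin 3 → ℂ) : eval (M u) F = c * eval u (wForm a₂ a₄ a₆) := by
  have := congrArg (eval u) hFM
  rwa [eval_subst, map_mul, eval_C] at this

theorem polar_apply_of_subst_eq (hFM : subst M.toLinearMap F = C c * wForm a₂ a₄ a₆)
    (u w : Fin 3 → ℂ) : polar F (M u) (M w) = c * polar (wForm a₂ a₄ a₆) u w := by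
  have := congrArg (fun G => polar G u w) hFM
  simpa [polar_subst, polar_C_mul] using this

/-- Smoothness is tested on all three partial derivatives; on the curve, Euler's relation recovers
the third from the two affine ones. -/
theorem wCurve_nonsingular_of_isSmooth (hsmooth : IsSmooth F)
    (hFM : subst M.toLinearMap F = C c * wForm a₂ a₄ a₆) {x y : ℂ}
    (h : (wCurve a₂ a₄ a₆).Equation x y) : (wCurve a₂ a₄ a₆).Nonsingular x y := by
  rw [wCurve_nonsingular_iff]
  have heq := (wCurve_equation_iff ..).mp h
  refine ⟨heq, ?_⟩
  by_contra! hc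
  obtain ⟨i, hi⟩ := hsmooth _ (affineVector_ne_zero M x y) (by
    rw [eval_apply_of_subst_eq hFM, eval_wForm]
    simp [heq])
  have h1 : eval (M ![x, y, 1]) (pderiv i F) = polar F (M ![x, y, 1]) (Pi.single i 1) := by
    simp [polar, Pi.single_apply]
  rw [h1, ← M.apply_symm_apply (Pi.single i 1), polar_apply_of_subst_eq hFM, polar_wForm] at hi
  obtain ⟨hc1, hc2⟩ := hc
  apply hi
  simp only [Matrix.cons_val_zero, Matrix.cons_val_one, Matrix.cons_val]
  linear_combination c * (-M.symm (Pi.single i 1) 0 * hc1 + M.symm (Pi.single i 1) 1 * hc2 +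
    M.symm (Pi.single i 1) 2 * (3 * heq + x * hc1 - y * hc2))

/-- Computation of the intersection multiplicity at an affine point from the ideal that the form
defines in the affine coordinate ring. -/
theorem interMult_eq (hc : c ≠ 0) (hFM : subst M.toLinearMap F = C c * wForm a₂ a₄ a₆)
    {x y : ℂ} (h : (wCurve a₂ a₄ a₆).Nonsingular x y) {G : Forms} {d : ℕ}
    (hG : G.IsHomogeneous d) {e : ℕ} {J : Ideal (wCurve a₂ a₄ a₆).CoordinateRing}
    (hGJ : Ideal.span {dehom a₂ a₄ a₆ (subst M.toLinearMap G)} =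
      WeierstrassCurve.Affine.CoordinateRing.XYIdeal (wCurve a₂ a₄ a₆) x (Polynomial.C y) ^ e * J)
    (hJ : ¬ J ≤ WeierstrassCurve.Affine.CoordinateRing.XYIdeal
      (wCurve a₂ a₄ a₆) x (Polynomial.C y)) :
    interMult F G (Projectivization.mk ℂ (M ![x, y, 1]) (affineVector_ne_zero M x y)) = e := by
  obtain ⟨T, s, hT, hs, hsu, hTm, hsx, hsy, hT0⟩ := exists_localParameter a₂ a₄ a₆ h
  obtain ⟨p, q, hp, hq, hpq⟩ := exists_mul_sub_mul_pow_mem h hT hs hsu hTm hsx hsy hT0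
    (subst_isHomogeneous M.toLinearMap hG) hGJ hJ
  set P := Projectivization.mk ℂ (M ![x, y, 1]) (affineVector_ne_zero M x y) with hP
  set A := Localization.AtPrime (pointIdeal P) with hA
  set N := subst M.symm.toLinearMap with hN
  set ι : Forms →+* A := algebraMap Forms A with hι
  have hmem : ∀ H : Forms, N H ∈ pointIdeal P ↔ ∀ t : ℂ, eval (t • ![x, y, 1]) H = 0 :=
    fun H => by
      rw [hP, mem_pointIdeal]
      simp [hN, eval_subst]
  -- Polynomials that do not vanish at the point become units. Hence s can be cancelled to give the
  -- maximal ideal (F, T), and p, q to replace G by T ^ e modulo F.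
  have hunit : ∀ H : Forms, eval ![x, y, 1] H ≠ 0 → IsUnit (ι (N H)) := fun H hH =>
    IsLocalization.map_units (M := (pointIdeal P).primeCompl) A
      ⟨N H, fun hc => hH (by simpa using (hmem H).mp hc 1)⟩
  have hNF : F = C c * N (wForm a₂ a₄ a₆) := by
    rw [← subst_symm_subst M F, hFM, map_mul, ← MvPolynomial.algebraMap_eq,
      AlgHom.commutes]
  have hCc : IsUnit (ι (C c)) := ((IsUnit.mk0 c hc).map C).map ι
  have hspanF : Ideal.span {ι F} = Ideal.span {ι (N (wForm a₂ a₄ a₆))} := by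
    rw [hNF, map_mul, Ideal.span_singleton_mul_left_unit hCc]
  have hW : ∀ z : A, Ideal.span {ι F, z} = Ideal.span {ι (N (wForm a₂ a₄ a₆)), z} := fun z => by
    rw [Ideal.span_insert, hspanF, ← Ideal.span_insert]
  have htr : ∀ {H T' : Forms}, H ∈ Ideal.span {wForm a₂ a₄ a₆, T'} →
      ι (N H) ∈ Ideal.span {ι F, ι (N T')} := fun {H T'} hH => by
    obtain ⟨k₁, k₂, rfl⟩ := Ideal.mem_span_pair.mp hH
    rw [hW]
    exact Ideal.mem_span_pair.mpr ⟨ι (N k₁), ι (N k₂), by simp⟩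
  have hXin : ∀ i ∈ ({X 0 - C x * X 2, X 1 - C y * X 2} : Set Forms),
      ι (N i) ∈ Ideal.span {ι F, ι (N T)} := by
    rintro i (rfl | rfl)
    · have := htr hsx
      rwa [map_mul, map_mul, Ideal.unit_mul_mem_iff_mem _ (hunit s hsu)] at this
    · have := htr hsy
      rwa [map_mul, map_mul, Ideal.unit_mul_mem_iff_mem _ (hunit s hsu)] at this
  have hmax : IsLocalRing.maximalIdeal A = Ideal.span {ι F, ι (N T)} := by
    refine le_antisymm ?_ ?_
    · rw [← Localization.AtPrime.map_eq_maximalIdeal, Ideal.map_le_iff_le_comap]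
      intro H hH
      have h1 := mem_span_linear_of_eval_smul ((hmem (subst M.toLinearMap H)).mp
        (by rwa [hN, subst_symm_subst]))
      obtain ⟨k₁, k₂, hk⟩ := Ideal.mem_span_pair.mp h1
      have h2 : H = N k₁ * N (X 0 - C x * X 2) + N k₂ * N (X 1 - C y * X 2) := by
        rw [← map_mul, ← map_mul, ← map_add, hk, hN, subst_symm_subst]
      rw [Ideal.mem_comap, h2, map_add, map_mul, map_mul]
      exact Ideal.add_mem _ (Ideal.mul_mem_left _ _ (hXin _ (by simp)))
        (Ideal.mul_mem_left _ _ (hXin _ (by simp)))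
    · rw [Ideal.span_le, ← Localization.AtPrime.map_eq_maximalIdeal]
      have hu : ∀ t : ℂ, eval (t • ![x, y, 1]) (wForm a₂ a₄ a₆) = 0 := fun t => by
        rw [eval_smul_of_isHomogeneous (wForm_isHomogeneous ..), eval_wForm]
        simp [(wCurve_equation_iff ..).mp h.1]
      rintro _ (rfl | rfl)
      · refine Ideal.mem_map_of_mem _ ?_
        rw [hNF]
        exact Ideal.mul_mem_left _ _ ((hmem _).mpr hu)
      · refine Ideal.mem_map_of_mem _ ((hmem _).mpr fun t => ?_)
        obtain ⟨k₁, k₂, rfl⟩ := Ideal.mem_span_pair.mp hTm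
        simp [mul_comm]
  have hpow : ∀ n, ι (N T) ^ n ∉ Ideal.span {ι F} := fun n hn => by
    rw [hspanF, ← map_pow, ← Set.image_singleton, ← Ideal.map_span,
      IsLocalization.algebraMap_mem_map_algebraMap_iff (pointIdeal P).primeCompl] at hn
    obtain ⟨k, hk, hkn⟩ := hn
    refine hk ?_
    obtain ⟨l, hl⟩ := Ideal.mem_span_singleton.mp hkn
    have h3 : subst M.toLinearMap k * T ^ n ∈ Ideal.span {wForm a₂ a₄ a₆} := by
      have := congrArg (subst M.toLinearMap) hl
      rw [map_mul, map_mul, map_pow, hN, subst_subst_symm, subst_subst_symm] at this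
      rw [this]
      exact Ideal.mul_mem_right _ _ (Ideal.mem_span_singleton_self _)
    have := (hmem (subst M.toLinearMap k)).mpr (eval_smul_eq_zero_of_mul_pow_mem h.1 hT hT0 n h3)
    rwa [hN, subst_symm_subst] at this
  have hI : (Ideal.span {F, G}).map ι = Ideal.span {ι F, ι (N T) ^ e} := by
    obtain ⟨l, hl⟩ := Ideal.mem_span_singleton.mp hpq
    have h4 : ι (N p) * ι G = ι (N l) * ι (N (wForm a₂ a₄ a₆)) + ι (N q) * ι (N T) ^ e := by
      have := congrArg (fun H => ι (N H)) hl
      simp only [map_sub, map_mul, map_pow] at this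
      rw [hN, subst_symm_subst, ← hN] at this
      linear_combination this
    rw [Ideal.map_span, Set.image_pair, hW, hW]
    refine le_antisymm (Ideal.span_le.mpr ?_) (Ideal.span_le.mpr ?_)
    · rintro _ (rfl | rfl)
      · exact Ideal.subset_span (by simp)
      · refine (Ideal.unit_mul_mem_iff_mem _ (hunit p hp)).mp ?_
        rw [h4]
        exact Ideal.mem_span_pair.mpr ⟨_, _, rfl⟩
    · rintro _ (rfl | rfl)
      · exact Ideal.subset_span (by simp)
      · refine (Ideal.unit_mul_mem_iff_mem _ (hunit q hq)).mp ?_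
        exact Ideal.mem_span_pair.mpr ⟨-ι (N l), ι (N p), by linear_combination h4⟩
  rw [interMult, ← hι, hI]
  exact length_quotient_span_pair_pow _ _ hmax hpow e

end Intersection
end PlaneCubic

namespace PlaneCubic
open MvPolynomial

/-! ### Principal divisors add up to zero in the Weierstrass group. -/

section Summation

variable {a₂ a₄ a₆ c : ℂ} {F : Forms} {M : (Fin 3 → ℂ) ≃ₗ[ℂ] (Fin 3 → ℂ)}

theorem mk_ext {v w : Fin 3 → ℂ} (hv : v ≠ 0) (hw : w ≠ 0) {κ : ℂ} (h : κ • w = v) :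
    Projectivization.mk ℂ v hv = Projectivization.mk ℂ w hw :=
  (Projectivization.mk_eq_mk_iff' ℂ v w hv hw).mpr ⟨κ, h⟩

/-- Every point of the curve is the image of the point at infinity or of an affine point. -/
theorem eq_infinity_or_affine (hc : c ≠ 0)
    (hFM : subst M.toLinearMap F = C c * wForm a₂ a₄ a₆) (P : curve F) :
    (∃ h : M ![0, 1, 0] ≠ 0, (P : Plane) = Projectivization.mk ℂ (M ![0, 1, 0]) h) ∨
      ∃ x y : ℂ, (wCurve a₂ a₄ a₆).Equation x y ∧
        (P : Plane) = Projectivization.mk ℂ (M ![x, y, 1]) (affineVector_ne_zero M x y) := by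
  set u := M.symm (P : Plane).rep with hu
  have hMu : M u = (P : Plane).rep := M.apply_symm_apply _
  have hu0 : u ≠ 0 := by
    intro h0
    exact (P : Plane).rep_nonzero (by rw [← hMu, h0, map_zero])
  have hP : (P : Plane) = Projectivization.mk ℂ (M u) (by
      rw [hMu]; exact (P : Plane).rep_nonzero) := by
    simp_rw [hMu]; exact (Projectivization.mk_rep _).symm
  have hW : eval u (wForm a₂ a₄ a₆) = 0 := by
    have h0 : eval (P : Plane).rep F = 0 := P.2
    rw [← hMu, eval_apply_of_subst_eq hFM] at h0
    exact (mul_eq_zero.mp h0).resolve_left hc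
  rw [eval_wForm] at hW
  by_cases h2 : u 2 = 0
  · have h00 : u 0 = 0 := by simpa [h2] using hW
    have hu1 : u = u 1 • ![0, 1, 0] := by
      ext i; fin_cases i <;> simp [h2, h00]
    have hne : (M ![0, 1, 0]) ≠ 0 := by
      rw [Ne, LinearEquiv.map_eq_zero_iff]
      intro h; simpa using congrFun h 1
    refine Or.inl ⟨hne, hP.trans (mk_ext _ _ (κ := u 1) ?_)⟩
    rw [← map_smul, ← hu1]
  · refine Or.inr ⟨u 0 / u 2, u 1 / u 2, ?_, hP.trans (mk_ext _ _ (κ := u 2) ?_)⟩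
    · rw [wCurve_equation_iff]
      field_simp
      linear_combination hW
    · rw [← map_smul]
      congr 1
      ext i; fin_cases i <;> simp [mul_div_cancel₀, h2]

open Classical in
/-- The group element of a point of the curve. -/
def toPoint (a₂ a₄ a₆ : ℂ) (M : (Fin 3 → ℂ) ≃ₗ[ℂ] (Fin 3 → ℂ)) (P : Plane) :
    (wCurve a₂ a₄ a₆).Point :=
  -- The default value `.zero` is the right one at infinity; it is also taken at plane points off
  -- the curve.
  if h : ∃ xy : ℂ × ℂ, (wCurve a₂ a₄ a₆).Nonsingular xy.1 xy.2 ∧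
      P = Projectivization.mk ℂ (M ![xy.1, xy.2, 1]) (affineVector_ne_zero M xy.1 xy.2)
  then .some _ _ h.choose_spec.1 else .zero

theorem affine_mk_injective {x y x' y' : ℂ}
    (h : Projectivization.mk ℂ (M ![x, y, 1]) (affineVector_ne_zero M x y) =
      Projectivization.mk ℂ (M ![x', y', 1]) (affineVector_ne_zero M x' y')) :
    x = x' ∧ y = y' := by
  obtain ⟨κ, hκ⟩ := (Projectivization.mk_eq_mk_iff' ℂ _ _ _ _).mp h
  rw [← map_smul, M.injective.eq_iff] at hκ
  have h2 : κ = 1 := by simpa using congrFun hκ 2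
  subst h2
  exact ⟨by simpa using (congrFun hκ 0).symm, by simpa using (congrFun hκ 1).symm⟩

theorem infinity_ne_affine {x y : ℂ} (h : M ![0, 1, 0] ≠ 0) :
    Projectivization.mk ℂ (M ![0, 1, 0]) h ≠
      Projectivization.mk ℂ (M ![x, y, 1]) (affineVector_ne_zero M x y) := by
  intro he
  obtain ⟨κ, hκ⟩ := (Projectivization.mk_eq_mk_iff' ℂ _ _ _ _).mp he
  rw [← map_smul, M.injective.eq_iff] at hκ
  have h2 : κ = 0 := by simpa using congrFun hκ 2
  subst h2
  simpa using congrFun hκ 1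

theorem toPoint_affine {x y : ℂ} (h : (wCurve a₂ a₄ a₆).Nonsingular x y) :
    toPoint a₂ a₄ a₆ M (Projectivization.mk ℂ (M ![x, y, 1]) (affineVector_ne_zero M x y)) =
      .some x y h := by
  have hex : ∃ xy : ℂ × ℂ, (wCurve a₂ a₄ a₆).Nonsingular xy.1 xy.2 ∧
      Projectivization.mk ℂ (M ![x, y, 1]) (affineVector_ne_zero M x y) =
        Projectivization.mk ℂ (M ![xy.1, xy.2, 1]) (affineVector_ne_zero M xy.1 xy.2) :=
    ⟨(x, y), h, rfl⟩
  obtain ⟨h1, h2⟩ := affine_mk_injective hex.choose_spec.2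
  rw [toPoint, dif_pos hex, WeierstrassCurve.Affine.Point.some.injEq]
  exact ⟨h1.symm, h2.symm⟩

theorem toPoint_infinity (h : M ![0, 1, 0] ≠ 0) :
    toPoint a₂ a₄ a₆ M (Projectivization.mk ℂ (M ![0, 1, 0]) h) = 0 :=
  dif_neg fun ⟨_, _, hxy⟩ => infinity_ne_affine h hxy

theorem toPoint_injective (hc : c ≠ 0) (hsmooth : IsSmooth F)
    (hFM : subst M.toLinearMap F = C c * wForm a₂ a₄ a₆) :
    Function.Injective fun P : curve F => toPoint a₂ a₄ a₆ M P := by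
  intro P Q hPQ
  have hPQ' : toPoint a₂ a₄ a₆ M P = toPoint a₂ a₄ a₆ M Q := hPQ
  ext1
  rcases eq_infinity_or_affine hc hFM P with ⟨h, hP⟩ | ⟨x, y, h, hP⟩ <;>
  rcases eq_infinity_or_affine hc hFM Q with ⟨h', hQ⟩ | ⟨x', y', h', hQ⟩
  · rw [hP, hQ]
  · rw [hP, hQ, toPoint_infinity,
      toPoint_affine (wCurve_nonsingular_of_isSmooth hsmooth hFM h')] at hPQ'
    exact absurd hPQ'.symm (WeierstrassCurve.Affine.Point.some_ne_zero _)
  · rw [hP, hQ, toPoint_infinity,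
      toPoint_affine (wCurve_nonsingular_of_isSmooth hsmooth hFM h)] at hPQ'
    exact absurd hPQ' (WeierstrassCurve.Affine.Point.some_ne_zero _)
  · rw [hP, hQ, toPoint_affine (wCurve_nonsingular_of_isSmooth hsmooth hFM h),
      toPoint_affine (wCurve_nonsingular_of_isSmooth hsmooth hFM h'),
      WeierstrassCurve.Affine.Point.some.injEq] at hPQ'
    obtain ⟨rfl, rfl⟩ := hPQ'
    rw [hP, hQ]

theorem dehom_subst_ne_zero (hc : c ≠ 0)
    (hFM : subst M.toLinearMap F = C c * wForm a₂ a₄ a₆) {G : Forms} {d : ℕ}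
    (hG : G.IsHomogeneous d) (hFG : ¬ F ∣ G) :
    dehom a₂ a₄ a₆ (subst M.toLinearMap G) ≠ 0 := by
  intro h0
  obtain ⟨Q, hQ⟩ := wForm_dvd_of_dehom_eq_zero a₂ a₄ a₆ (subst_isHomogeneous M.toLinearMap hG) h0
  refine hFG ⟨subst M.symm.toLinearMap (C c⁻¹ * Q), ?_⟩
  rw [← subst_symm_subst M G, ← subst_symm_subst M (F * _), map_mul (subst M.toLinearMap), hFM,
    subst_subst_symm, hQ]
  congr 1
  have : (C c * C c⁻¹ : Forms) = 1 := by rw [← C_mul, mul_inv_cancel₀ hc, C_1]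
  linear_combination (-wForm a₂ a₄ a₆ * Q) * this

theorem toPoint_surjective
    (hFM : subst M.toLinearMap F = C c * wForm a₂ a₄ a₆) :
    Function.Surjective fun P : curve F => toPoint a₂ a₄ a₆ M P := by
  have hF : F.IsHomogeneous 3 := by
    rw [← subst_symm_subst M F, hFM]
    refine subst_isHomogeneous _ ?_
    simpa using (isHomogeneous_C _ c).mul (wForm_isHomogeneous a₂ a₄ a₆)
  rintro (_ | ⟨x, y, h⟩)
  · have hne : (M ![0, 1, 0]) ≠ 0 := by
      rw [Ne, LinearEquiv.map_eq_zero_iff]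
      intro h; simpa using congrFun h 1
    refine ⟨⟨Projectivization.mk ℂ _ hne, ?_⟩, toPoint_infinity hne⟩
    rw [mem_curve_mk hF, eval_apply_of_subst_eq hFM, eval_wForm]
    simp
  · refine ⟨⟨Projectivization.mk ℂ _ (affineVector_ne_zero M x y), ?_⟩, toPoint_affine h⟩
    rw [mem_curve_mk hF, eval_apply_of_subst_eq hFM, eval_wForm]
    simp [(wCurve_equation_iff ..).mp h.1]

open Classical in
/-- A divisor that is the difference of two multisets away from the zero of a group has the
difference of their sums as its sum. -/
theorem sum_zsmul_eq_sub_of_count {α A : Type*} [AddCommGroup A] {f : α → A}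
    (hf : Function.Injective f) (hf' : Function.Surjective f) (D : α →₀ ℤ) (s t : Multiset A)
    (h : ∀ P, f P ≠ 0 → D P = s.count (f P) - t.count (f P)) :
    Finsupp.liftAddHom (fun P => (smulAddHom ℤ A).flip (f P)) D = s.sum - t.sum := by
  set Λ : (A →₀ ℤ) →+ A := Finsupp.liftAddHom fun Q => (smulAddHom ℤ A).flip Q with hΛ
  have hΛ1 : ∀ Q n, Λ (Finsupp.single Q n) = n • Q := fun Q n => by simp [hΛ]
  set E : Multiset A → (A →₀ ℤ) := fun s => (s.map fun Q => Finsupp.single Q 1).sum with hE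
  have hΛE : ∀ s, Λ (E s) = s.sum := fun s => by
    rw [hE, map_multiset_sum, Multiset.map_map]
    simp [hΛ1]
  have hEc : ∀ s Q, E s Q = s.count Q := fun s Q => by
    induction s using Multiset.induction_on with
    | empty => simp [hE]
    | cons a s ih =>
      simp only [hE, Multiset.map_cons, Multiset.sum_cons, Finsupp.add_apply] at ih ⊢
      rw [ih, Multiset.count_cons, Finsupp.single_apply]
      simp [add_comm, eq_comm]
  have hsum : Λ (Finsupp.mapDomain f D) =
      Finsupp.liftAddHom (fun P => (smulAddHom ℤ A).flip (f P)) D := by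
    have : Λ.comp (Finsupp.mapDomain.addMonoidHom f) =
        Finsupp.liftAddHom (fun P => (smulAddHom ℤ A).flip (f P)) := by
      ext P; simp [hΛ1]
    exact DFunLike.congr_fun this D
  -- The discrepancy Z is supported at the zero of the group and contributes nothing to the sum.
  -- This is why multiplicities at infinity are never computed.
  set Z := Finsupp.mapDomain f D - E s + E t with hZ
  have hZ0 : Z = Finsupp.single 0 (Z 0) := by
    ext Q
    by_cases hQ : Q = 0
    · subst hQ; simp
    · rw [Finsupp.single_eq_of_ne hQ]
      obtain ⟨P, rfl⟩ := hf' Q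
      rw [hZ, Finsupp.add_apply, Finsupp.sub_apply, Finsupp.mapDomain_apply hf, hEc, hEc, h P hQ]
      simp
  have h0 : Λ Z = 0 := by rw [hZ0, hΛ1, smul_zero]
  rw [hZ, map_add, map_sub, hΛE, hΛE, hsum] at h0
  rw [← sub_eq_zero, ← h0]
  abel

open Classical in
/-- The intersection divisor of a form with the curve: its affine part adds up to zero. -/
theorem exists_multiset_interMult (hc : c ≠ 0) (hsmooth : IsSmooth F)
    (hFM : subst M.toLinearMap F = C c * wForm a₂ a₄ a₆) {G : Forms} {d : ℕ}
    (hG : G.IsHomogeneous d) (hFG : ¬ F ∣ G) :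
    ∃ s : Multiset (wCurve a₂ a₄ a₆).Point, s.sum = 0 ∧
      ∀ P : curve F, toPoint a₂ a₄ a₆ M P ≠ 0 →
        interMult F G P = s.count (toPoint a₂ a₄ a₆ M P) := by
  have hns := fun x y h => wCurve_nonsingular_of_isSmooth (x := x) (y := y) hsmooth hFM h
  have h0 := dehom_subst_ne_zero hc hFM hG hFG
  obtain ⟨s, hs⟩ := exists_prod_placeIdeal hns
    (Ideal.span {dehom a₂ a₄ a₆ (subst M.toLinearMap G)}) (by simpa using h0)
  refine ⟨s, sum_eq_zero_of_prod_placeIdeal_eq h0 hs, fun P hP => ?_⟩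
  rcases eq_infinity_or_affine hc hFM P with ⟨h, hP'⟩ | ⟨x, y, h, hP'⟩
  · exact absurd (by rw [hP', toPoint_infinity]) hP
  · obtain ⟨J, hJ, hJm⟩ := exists_prod_placeIdeal_eq_pow_mul s (hns x y h)
    rw [hP', toPoint_affine (hns x y h)]
    exact interMult_eq hc hFM (hns x y h) hG (hs ▸ hJ) hJm

open Classical in
/-- The sum of a divisor in the group of the curve. -/
def divisorSum (a₂ a₄ a₆ : ℂ) (F : Forms) (M : (Fin 3 → ℂ) ≃ₗ[ℂ] (Fin 3 → ℂ)) :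
    Divisor F →+ (wCurve a₂ a₄ a₆).Point :=
  Finsupp.liftAddHom fun P => (smulAddHom ℤ _).flip (toPoint a₂ a₄ a₆ M P)

open Classical in
theorem divisorSum_single (P : curve F) (n : ℤ) :
    divisorSum a₂ a₄ a₆ F M (Finsupp.single P n) = n • toPoint a₂ a₄ a₆ M P := by
  simp [divisorSum]

open Classical in
/-- Principal divisors add up to zero in the group of the curve. -/
theorem divisorSum_eq_zero (hc : c ≠ 0) (hsmooth : IsSmooth F)
    (hFM : subst M.toLinearMap F = C c * wForm a₂ a₄ a₆) {D : Divisor F}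
    (hD : D ∈ principal F) : divisorSum a₂ a₄ a₆ F M D = 0 := by
  induction hD using AddSubgroup.closure_induction with
  | zero => simp
  | add x y _ _ hx hy => simp [hx, hy]
  | neg x _ hx => simp [hx]
  | mem D hD =>
    obtain ⟨d, G, H, hG, hH, hFG, hFH, hD⟩ := hD
    obtain ⟨s, hs0, hs⟩ := exists_multiset_interMult hc hsmooth hFM hG hFG
    obtain ⟨t, ht0, ht⟩ := exists_multiset_interMult hc hsmooth hFM hH hFH
    have := sum_zsmul_eq_sub_of_count (toPoint_injective hc hsmooth hFM)
      (toPoint_surjective hFM) D s t fun P hP => by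
        rw [hD, hs P hP, ht P hP, ENat.toNat_natCast, ENat.toNat_natCast]
        congr!
    rwa [hs0, ht0, sub_zero] at this

end Summation
end PlaneCubic

namespace PlaneCubic
open WeierstrassCurve.Affine

/-! ### The invariant differential evaluated on a derivation is additive. -/

section LogDerivative

variable {a₂ a₄ a₆ : ℂ} (δ : Derivation ℤ ℂ ℂ)

theorem deriv_cube (h₂ : δ a₂ = 0) (h₄ : δ a₄ = 0) (h₆ : δ a₆ = 0) {x y : ℂ}
    (h : y ^ 2 = x ^ 3 + a₂ * x ^ 2 + a₄ * x + a₆) :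
    2 * y * δ y = (3 * x ^ 2 + 2 * a₂ * x + a₄) * δ x := by
  have h1 := congrArg δ h
  simp only [map_add, Derivation.leibniz, Derivation.leibniz_pow, h₂, h₄, h₆, smul_eq_mul,
    nsmul_eq_mul] at h1
  push_cast at h1
  linear_combination h1

/-- `u` is the value at the point `(x, y)` of the invariant differential `dx / y` on the
derivation `δ`. -/
def IsLogDeriv (a₂ a₄ x y u : ℂ) : Prop :=
  δ x = u * y ∧ δ y = u * (3 * x ^ 2 + 2 * a₂ * x + a₄) / 2

/-- At a point with y = 0 the quotient is 0 by convention. This is the correct value: there f'(x) ≠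
0, so differentiating the equation gives δ x = 0 (and δ y = 0). -/
theorem isLogDeriv_div (h₂ : δ a₂ = 0) (h₄ : δ a₄ = 0) (h₆ : δ a₆ = 0) {x y : ℂ}
    (h : (wCurve a₂ a₄ a₆).Nonsingular x y) : IsLogDeriv δ a₂ a₄ x y (δ x / y) := by
  obtain ⟨heq, hns⟩ := (wCurve_nonsingular_iff ..).mp h
  have h1 := deriv_cube δ h₂ h₄ h₆ heq
  by_cases hy : y = 0
  · subst hy
    have hx : δ x = 0 := by
      have := hns.resolve_right (by simp)
      simpa [this, eq_comm] using h1
    simp [IsLogDeriv, hx]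
  · refine ⟨by field_simp, ?_⟩
    field_simp
    linear_combination h1

theorem IsLogDeriv.eq_div {x y u : ℂ} (hns : 3 * x ^ 2 + 2 * a₂ * x + a₄ ≠ 0 ∨ 2 * y ≠ 0)
    (h : IsLogDeriv δ a₂ a₄ x y u) : u = δ x / y := by
  by_cases hy : y = 0
  · subst hy
    have h1 := h.2
    rw [map_zero, eq_comm, div_eq_zero_iff] at h1
    have := hns.resolve_right (by simp)
    simpa [this] using h1
  · rw [h.1]; field_simp

/-- The algebra shared by chords and tangents: `hℓ` gives the derivative of the slope, while `hx₃`
and `hS` are Vieta's relations for the abscissas in which the line meets the cubic. -/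
theorem IsLogDeriv.add (h₂ : δ a₂ = 0) {x₁ y₁ u₁ x₂ y₂ u₂ x₃ ℓ : ℂ}
    (h₁' : IsLogDeriv δ a₂ a₄ x₁ y₁ u₁) (h₂' : IsLogDeriv δ a₂ a₄ x₂ y₂ u₂)
    (hℓ : 2 * δ ℓ = u₁ * (x₁ - x₃) + u₂ * (x₂ - x₃)) (hl : y₂ - y₁ = ℓ * (x₂ - x₁))
    (hx₃ : x₃ = ℓ ^ 2 - a₂ - x₁ - x₂)
    (hS : x₁ * x₂ + x₁ * x₃ + x₂ * x₃ = a₄ - 2 * ℓ * (y₁ - ℓ * x₁)) :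
    IsLogDeriv δ a₂ a₄ x₃ (-(ℓ * (x₃ - x₁) + y₁)) (u₁ + u₂) := by
  have hδx : δ x₃ = 2 * ℓ * δ ℓ - u₁ * y₁ - u₂ * y₂ := by
    rw [hx₃]
    simp only [map_sub, Derivation.leibniz_pow, h₂, h₁'.1, h₂'.1, smul_eq_mul, nsmul_eq_mul]
    push_cast
    ring
  have hδx' : δ x₃ = (u₁ + u₂) * -(ℓ * (x₃ - x₁) + y₁) := by
    rw [hδx]
    linear_combination ℓ * hℓ - u₂ * hl
  refine ⟨hδx', ?_⟩
  have hδy : δ (-(ℓ * (x₃ - x₁) + y₁)) = -(δ ℓ * (x₃ - x₁) + ℓ * (δ x₃ - u₁ * y₁) +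
      u₁ * (3 * x₁ ^ 2 + 2 * a₂ * x₁ + a₄) / 2) := by
    simp only [map_neg, map_add, Derivation.leibniz, map_sub, h₁'.1, h₁'.2, smul_eq_mul]
    ring
  have e2 : a₂ = ℓ ^ 2 - x₁ - x₂ - x₃ := by rw [hx₃]; ring
  have e4 : a₄ = x₁ * x₂ + x₁ * x₃ + x₂ * x₃ + 2 * ℓ * (y₁ - ℓ * x₁) := by rw [hS]; ring
  rw [hδy, hδx', e4, e2]
  linear_combination (-(x₃ - x₁) / 2) * hℓ

/-- The logarithmic derivative of a point along a derivation that kills the coefficients. -/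
def logDeriv : (wCurve a₂ a₄ a₆).Point → ℂ
  | .zero => 0
  | .some x y _ => δ x / y

theorem logDeriv_some {x y : ℂ} (h : (wCurve a₂ a₄ a₆).Nonsingular x y) :
    logDeriv δ (.some x y h) = δ x / y := rfl

open Classical in
/-- The logarithmic derivative is a homomorphism. -/
theorem logDeriv_add (h₂ : δ a₂ = 0) (h₄ : δ a₄ = 0) (h₆ : δ a₆ = 0)
    (P Q : (wCurve a₂ a₄ a₆).Point) : logDeriv δ (P + Q) = logDeriv δ P + logDeriv δ Q := by
  rcases P with _ | ⟨x₁, y₁, h₁⟩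
  · rw [← Point.zero_def, zero_add]; simp [logDeriv]
  rcases Q with _ | ⟨x₂, y₂, h₂'⟩
  · rw [← Point.zero_def, add_zero]; simp [logDeriv]
  have hneg : ∀ x y, (wCurve a₂ a₄ a₆).negY x y = -y := fun x y => by
    simp [negY, wCurve]
  by_cases hxy : x₁ = x₂ ∧ y₁ = (wCurve a₂ a₄ a₆).negY x₂ y₂
  · rw [Point.add_of_Y_eq hxy.1 hxy.2, logDeriv_some, logDeriv_some]
    obtain ⟨rfl, hy⟩ := hxy
    rw [hy, hneg, div_neg, neg_add_cancel]
    rfl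
  · obtain ⟨q₁, n₁⟩ := (wCurve_nonsingular_iff ..).mp h₁
    obtain ⟨q₂, n₂⟩ := (wCurve_nonsingular_iff ..).mp h₂'
    have l₁ := isLogDeriv_div δ h₂ h₄ h₆ h₁
    have l₂ := isLogDeriv_div δ h₂ h₄ h₆ h₂'
    rw [Point.add_some hxy, logDeriv_some, logDeriv_some, logDeriv_some]
    -- The quotients are abstracted next; `hu` keeps the fact that they agree when the points
    -- coincide.
    have hu : x₁ = x₂ → y₁ = y₂ → δ x₁ / y₁ = δ x₂ / y₂ := by rintro rfl rfl; rfl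
    generalize δ x₁ / y₁ = u₁ at l₁ hu ⊢
    generalize δ x₂ / y₂ = u₂ at l₂ hu ⊢
    have h₃ := nonsingular_add h₁ h₂' hxy
    set ℓ := (wCurve a₂ a₄ a₆).slope x₁ x₂ y₁ y₂ with hℓ
    have hX : (wCurve a₂ a₄ a₆).addX x₁ x₂ ℓ = ℓ ^ 2 - a₂ - x₁ - x₂ := by
      simp [addX, wCurve]
    have hY : (wCurve a₂ a₄ a₆).addY x₁ x₂ y₁ ℓ =
        -(ℓ * (ℓ ^ 2 - a₂ - x₁ - x₂ - x₁) + y₁) := by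
      rw [addY, hneg, negAddY, hX]
    rw [hX, hY] at h₃ ⊢
    obtain ⟨-, n₃⟩ := (wCurve_nonsingular_iff ..).mp h₃
    refine (IsLogDeriv.eq_div δ n₃ ?_).symm
    by_cases hx : x₁ = x₂
    · subst hx
      have hyne : y₁ ≠ -y₂ := fun hc => hxy ⟨rfl, by rw [hneg, hc]⟩
      obtain rfl : y₁ = y₂ := by
        have : (y₁ - y₂) * (y₁ + y₂) = 0 := by linear_combination q₁ - q₂
        rcases mul_eq_zero.mp this with h | h
        · exact sub_eq_zero.mp h
        · exact absurd (eq_neg_of_add_eq_zero_left h) hyne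
      have hy0 : y₁ ≠ 0 := fun hc => hyne (by simp [hc])
      have hsl : 2 * y₁ * ℓ = 3 * x₁ ^ 2 + 2 * a₂ * x₁ + a₄ := by
        rw [hℓ, slope_of_Y_ne rfl (by rwa [hneg]), hneg]
        simp only [wCurve, zero_mul, sub_zero, sub_neg_eq_add]
        field_simp
        ring
      obtain rfl := hu rfl rfl
      refine l₁.add δ h₂ l₁ ?_ (by ring) rfl (by linear_combination hsl)
      have hd := congrArg δ hsl
      have hδ2 : δ (2 : ℂ) = 0 := by
        have := δ.map_natCast 2
        simpa using this
      have hδ3 : δ (3 : ℂ) = 0 := by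
        have := δ.map_natCast 3
        simpa using this
      simp only [map_add, Derivation.leibniz, Derivation.leibniz_pow, h₂, h₄, smul_eq_mul,
        nsmul_eq_mul, l₁.1, l₁.2, hδ2, hδ3] at hd
      push_cast at hd
      refine mul_left_cancel₀ hy0 ?_
      linear_combination hd + u₁ * ℓ * hsl
    · have hx' : x₂ - x₁ ≠ 0 := sub_ne_zero.mpr (Ne.symm hx)
      have hsl : y₂ - y₁ = ℓ * (x₂ - x₁) := by
        rw [hℓ, slope_of_X_ne hx]
        have : x₁ - x₂ ≠ 0 := sub_ne_zero.mpr hx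
        field_simp
        ring
      have hS : x₁ * x₂ + x₁ * (ℓ ^ 2 - a₂ - x₁ - x₂) + x₂ * (ℓ ^ 2 - a₂ - x₁ - x₂) =
          a₄ - 2 * ℓ * (y₁ - ℓ * x₁) := by
        refine mul_left_cancel₀ hx' ?_
        linear_combination q₂ - q₁ - (y₂ + y₁) * hsl - ℓ * (x₂ - x₁) * hsl
      refine l₁.add δ h₂ l₂ ?_ hsl rfl hS
      have hd := congrArg δ hsl
      simp only [map_sub, Derivation.leibniz, smul_eq_mul, l₁.1, l₁.2, l₂.1, l₂.2] at hd
      refine mul_left_cancel₀ hx' ?_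
      -- The cubic minus the square of the line is (x - x₁)(x - x₂)(x - x₃); `f₁` and `f₂` are its
      -- derivatives at x₁ and x₂.
      have f₁ : 3 * x₁ ^ 2 + 2 * a₂ * x₁ + a₄ =
          2 * ℓ * y₁ + (x₁ - x₂) * (x₁ - (ℓ ^ 2 - a₂ - x₁ - x₂)) := by
        linear_combination -hS
      have f₂ : 3 * x₂ ^ 2 + 2 * a₂ * x₂ + a₄ =
          2 * ℓ * y₂ + (x₂ - x₁) * (x₂ - (ℓ ^ 2 - a₂ - x₁ - x₂)) := by
        linear_combination -hS - 2 * ℓ * hsl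
      linear_combination -2 * hd + u₂ * f₂ - u₁ * f₁

end LogDerivative
end PlaneCubic

namespace PlaneCubic

/-! ### Transcendental real numbers and derivations of ℂ. -/

section Derivations

/-- Over the field generated by a transcendence basis, L is algebraic and, in characteristic zero,
separable. -/
theorem formallySmooth_of_charZero (E L : Type*) [Field E] [Field L] [Algebra E L] [CharZero E] :
    Algebra.FormallySmooth E L := by
  obtain ⟨s, hs⟩ := exists_isTranscendenceBasis E L
  have : Algebra.IsAlgebraic (IntermediateField.adjoin E (Set.range ((↑) : s → L))) L :=
    hs.isAlgebraic_field
  exact Algebra.FormallySmooth.of_algebraicIndependent_of_isSeparable hs.1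

/-- A transcendental element of a field extension in characteristic zero is moved by some
derivation. -/
theorem exists_derivation_eq_one {K L : Type*} [Field K] [Field L] [Algebra K L] [CharZero K]
    {x : L} (hx : Transcendental K x) : ∃ δ : Derivation K L L, δ x = 1 := by
  let algX : Algebra (Polynomial K) L := (Polynomial.aeval x).toRingHom.toAlgebra
  have hmap : ∀ p : Polynomial K, algebraMap (Polynomial K) L p = Polynomial.aeval x p :=
    fun _ => rfl
  have hinj : Function.Injective (algebraMap (Polynomial K) L) :=
    transcendental_iff_injective.mp hx
  have : FaithfulSMul (Polynomial K) L := (faithfulSMul_iff_algebraMap_injective _ _).mpr hinj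
  let : Algebra (FractionRing (Polynomial K)) L := FractionRing.liftAlgebra (Polynomial K) L
  have : IsScalarTower (Polynomial K) (FractionRing (Polynomial K)) L :=
    FractionRing.isScalarTower_liftAlgebra (Polynomial K) L
  have : CharZero (FractionRing (Polynomial K)) :=
    charZero_of_injective_algebraMap (IsFractionRing.injective (Polynomial K) _)
  have := formallySmooth_of_charZero (FractionRing (Polynomial K)) L
  have : Algebra.FormallySmooth (Polynomial K) (FractionRing (Polynomial K)) :=
    Algebra.FormallySmooth.of_isLocalization (nonZeroDivisors (Polynomial K))
  have : Algebra.FormallySmooth (Polynomial K) L :=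
    Algebra.FormallySmooth.comp _ (FractionRing (Polynomial K)) L
  -- The dual numbers over L become a `Polynomial K`-algebra through X ↦ x + ε. Formal smoothness of
  -- L lifts the identity to a section, whose ε-part is a derivation with value 1 at x.
  let φ : Polynomial K →ₐ[K] TrivSqZeroExt L L :=
    Polynomial.aeval (TrivSqZeroExt.inl x + TrivSqZeroExt.inr 1)
  let algB : Algebra (Polynomial K) (TrivSqZeroExt L L) := φ.toRingHom.toAlgebra
  have hφ : ∀ p, algebraMap (Polynomial K) (TrivSqZeroExt L L) p = φ p := fun _ => rfl
  let g : TrivSqZeroExt L L →ₐ[Polynomial K] L :=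
    { (TrivSqZeroExt.fstHom K L L).toRingHom with
      commutes' := fun p => by
        change TrivSqZeroExt.fstHom K L L (φ p) = Polynomial.aeval x p
        rw [← AlgHom.comp_apply]
        congr 1
        ext
        simp [φ] }
  have hg : Function.Surjective g := fun a => ⟨TrivSqZeroExt.inl a, by simp [g]⟩
  have hker : IsNilpotent (RingHom.ker (g : TrivSqZeroExt L L →+* L)) := by
    refine ⟨2, ?_⟩
    refine (sq (RingHom.ker (g : TrivSqZeroExt L L →+* L))).trans ?_
    rw [Ideal.zero_eq_bot, eq_bot_iff, Ideal.mul_le]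
    intro a ha b hb
    have ha' : a.fst = 0 := ha
    have hb' : b.fst = 0 := hb
    rw [Ideal.mem_bot]
    ext <;> simp [ha', hb']
  let s := Algebra.FormallySmooth.liftOfSurjective (AlgHom.id (Polynomial K) L) g hg hker
  have hs : ∀ a, (s a).fst = a := fun a =>
    Algebra.FormallySmooth.liftOfSurjective_apply (AlgHom.id (Polynomial K) L) g hg hker a
  have hsX : ∀ p : Polynomial K, s (Polynomial.aeval x p) = φ p := fun p => by
    rw [← hmap, ← hφ, AlgHom.commutes]
  have hsC : ∀ k : K, s (algebraMap K L k) = TrivSqZeroExt.inl (algebraMap K L k) := fun k => by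
    have := hsX (Polynomial.C k)
    rw [Polynomial.aeval_C] at this
    rw [this]
    change Polynomial.aeval _ (Polynomial.C k) = _
    rw [Polynomial.aeval_C]
    rfl
  let δ₀ : L →ₗ[K] L :=
    { toFun := fun a => (s a).snd
      map_add' := fun a b => by simp
      map_smul' := fun k a => by
        rw [Algebra.smul_def, map_mul, hsC]
        simp [Algebra.smul_def] }
  refine ⟨Derivation.mk' δ₀ fun a b => ?_, ?_⟩
  · change (s (a * b)).snd = a • (s b).snd + b • (s a).snd
    rw [map_mul, TrivSqZeroExt.snd_mul, hs, hs]
    simp [mul_comm]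
  · change (s x).snd = 1
    have := hsX Polynomial.X
    rw [Polynomial.aeval_X] at this
    rw [this]
    simp [φ]

/-- Avoiding a countable subfield: every nonempty open half-line contains a real number that is
transcendental over a given countable field of complex numbers. -/
theorem exists_gt_transcendental (K : Subfield ℂ) [Countable K] (e : ℝ) :
    ∃ X : ℝ, e < X ∧ Transcendental K (X : ℂ) := by
  by_contra! h
  have hsub : Set.Ioi e ⊆ (fun X : ℝ => (X : ℂ)) ⁻¹' {z : ℂ | IsAlgebraic K z} := fun X hX => by
    by_contra hc
    exact h X hX hc
  have hcount := ((Algebraic.countable K ℂ).preimage Complex.ofReal_injective).mono hsub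
  have := hcount.le_aleph0
  rw [Cardinal.mk_Ioi_real] at this
  exact absurd this Cardinal.aleph0_lt_continuum.not_ge

/-- Apply δ to the minimal polynomial: by separability its derivative does not vanish at z. -/
theorem Derivation.eq_zero_of_isAlgebraic {K L : Type*} [Field K] [Field L] [Algebra K L]
    [CharZero K] (δ : Derivation K L L) {z : L} (hz : IsAlgebraic K z) : δ z = 0 := by
  have h1 : δ (Polynomial.aeval z (minpoly K z)) = 0 := by rw [minpoly.aeval, map_zero]
  rw [Derivation.map_aeval, smul_eq_mul] at h1
  exact (mul_eq_zero.mp h1).resolve_left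
    ((minpoly.irreducible hz.isIntegral).separable.aeval_derivative_ne_zero (minpoly.aeval K z))

theorem isAlgebraic_of_subfield_le {L : Type*} [Field L] {K K' : Subfield L} (h : K ≤ K') {z : L}
    (hz : IsAlgebraic K z) : IsAlgebraic K' z := by
  let : Algebra K K' := (Subfield.inclusion h).toAlgebra
  have : IsScalarTower K K' L := IsScalarTower.of_algebraMap_eq fun _ => rfl
  exact hz.tower_top K'

/-- Real numbers on a half-line and derivations of `ℂ` dual to them up to a triangular matrix. -/
theorem exists_reals_derivations (S : Set ℂ) (hS : S.Countable) (e : ℝ) (r : ℕ) :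
    ∃ (X : Fin r → ℝ) (δ : Fin r → Derivation ℤ ℂ ℂ), (∀ i, e < X i) ∧
      (∀ i, ∀ z : ℂ, IsAlgebraic (Subfield.closure S) z → δ i z = 0) ∧
      (∀ i, δ i (X i) = 1) ∧ ∀ i j, j < i → δ i (X j) = 0 := by
  induction r with
  | zero => exact ⟨Fin.elim0, Fin.elim0, fun i => i.elim0, fun i => i.elim0, fun i => i.elim0,
      fun i => i.elim0⟩
  | succ r ih =>
    obtain ⟨X, δ, h1, h2, h3, h4⟩ := ih
    set T : Set ℂ := S ∪ Set.range fun i => (X i : ℂ) with hT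
    set K := Subfield.closure T with hK
    have hTc : T.Countable := hS.union (Set.countable_range _)
    have : Countable K := by
      rw [← Cardinal.mk_le_aleph0_iff]
      exact (Subfield.cardinalMk_closure_le_max T).trans (max_le hTc.le_aleph0 le_rfl)
    -- K contains the earlier X i, so the new derivation kills them; the earlier derivations are
    -- unconstrained at x, whence only a triangular matrix. Since K grows at each step, ℤ is the
    -- common base ring.
    obtain ⟨x, hx, hxK⟩ := exists_gt_transcendental K e
    obtain ⟨d, hd⟩ := exists_derivation_eq_one hxK
    have hle : Subfield.closure S ≤ K := Subfield.closure_mono Set.subset_union_left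
    have halg : ∀ z : ℂ, IsAlgebraic (Subfield.closure S) z → d z = 0 := fun z hz =>
      Derivation.eq_zero_of_isAlgebraic d (isAlgebraic_of_subfield_le hle hz)
    refine ⟨Fin.snoc X x, Fin.snoc δ (d.restrictScalars ℤ), ?_, ?_, ?_, ?_⟩
    · intro i
      refine Fin.lastCases ?_ (fun i => ?_) i <;> simp [hx, h1]
    · intro i
      refine Fin.lastCases ?_ (fun i => ?_) i
      · intro z hz; simpa using halg z hz
      · intro z hz; simpa using h2 i z hz
    · intro i
      refine Fin.lastCases ?_ (fun i => ?_) i <;> simp [hd, h3]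
    · intro i j
      refine Fin.lastCases ?_ (fun i => ?_) i <;> refine Fin.lastCases ?_ (fun j => ?_) j
      · simp
      · intro _
        have hm : (X j : ℂ) ∈ K := Subfield.subset_closure (Or.inr ⟨j, rfl⟩)
        have := d.map_algebraMap ⟨(X j : ℂ), hm⟩
        simp only [Fin.snoc_last, Fin.snoc_castSucc]
        exact this
      · intro h; exact absurd h (by simp [Fin.le_last])
      · intro h; simpa using h4 i j (by simpa using h)

end Derivations
end PlaneCubic

namespace PlaneCubic
open MvPolynomial

/-! ### Flexes and the three-division polynomial. -/

section Inflection

variable {a₂ a₄ a₆ c : ℂ} {F : Forms} {M : (Fin 3 → ℂ) ≃ₗ[ℂ] (Fin 3 → ℂ)}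

/-- The second order expansion of a curve along a parametrized arc. -/
theorem arc_expansion {B : Type*} [CommRing B] {x y α β b₂ b₄ b₆ f : B} (s : B)
    (hf : f = 3 * x ^ 2 + 2 * b₂ * x + b₄) (h : y ^ 2 = x ^ 3 + b₂ * x ^ 2 + b₄ * x + b₆)
    (h2 : 2 * y * β - f * α = 4 * y ^ 2 * (3 * x + b₂) - f ^ 2) :
    (y + f * s + β * s ^ 2) ^ 2 - ((x + 2 * y * s + α * s ^ 2) ^ 3 +
      b₂ * (x + 2 * y * s + α * s ^ 2) ^ 2 + b₄ * (x + 2 * y * s + α * s ^ 2) + b₆) =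
    s ^ 3 * (2 * f * β - (3 * x + b₂) * 4 * y * α - (2 * y + α * s) ^ 3 +
      s * (β ^ 2 - (3 * x + b₂) * α ^ 2)) := by
  linear_combination h + s ^ 2 * h2 + (2 * y * s + α * s ^ 2) * hf

/-- An arc with velocity (2y, f) and acceleration terms (α, β) satisfies the curve equation modulo
s³, so it maps the coordinate ring to ℂ[s]/(s³) and kills the cube of the ideal of the point. The
tangent form pulls back to (2yβ - fα)s², and this coefficient must vanish. -/
theorem tangent_mem_cube {x y : ℂ} (h : (wCurve a₂ a₄ a₆).Nonsingular x y)
    (hL : WeierstrassCurve.Affine.CoordinateRing.mk (wCurve a₂ a₄ a₆)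
      (Polynomial.C (Polynomial.C (-(3 * x ^ 2 + 2 * a₂ * x + a₄)) *
        (Polynomial.X - Polynomial.C x)) + Polynomial.C (Polynomial.C (2 * y)) *
        (Polynomial.X - Polynomial.C (Polynomial.C y))) ∈
      WeierstrassCurve.Affine.CoordinateRing.XYIdeal (wCurve a₂ a₄ a₆) x (Polynomial.C y) ^ 3) :
    (3 * x ^ 2 + 2 * a₂ * x + a₄) ^ 2 = 4 * y ^ 2 * (3 * x + a₂) := by
  obtain ⟨heq, hns⟩ := (wCurve_nonsingular_iff ..).mp h
  set f := 3 * x ^ 2 + 2 * a₂ * x + a₄ with hf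
  obtain ⟨α, β, hαβ⟩ : ∃ α β : ℂ, 2 * y * β - f * α = 4 * y ^ 2 * (3 * x + a₂) - f ^ 2 := by
    rcases hns with h0 | h0
    · exact ⟨-(4 * y ^ 2 * (3 * x + a₂) - f ^ 2) / f, 0, by field_simp; ring⟩
    · exact ⟨0, (4 * y ^ 2 * (3 * x + a₂) - f ^ 2) / (2 * y), by rw [mul_div_cancel₀ _ h0]; ring⟩
  set I : Ideal (Polynomial ℂ) := Ideal.span {Polynomial.X ^ 3} with hI
  set ξ : Polynomial ℂ := Polynomial.C x + 2 * Polynomial.C y * Polynomial.X +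
    Polynomial.C α * Polynomial.X ^ 2 with hξ
  set η : Polynomial ℂ := Polynomial.C y + Polynomial.C f * Polynomial.X +
    Polynomial.C β * Polynomial.X ^ 2 with hη
  set π := Ideal.Quotient.mk I with hπ
  set i : Polynomial ℂ →+* Polynomial ℂ ⧸ I :=
    π.comp (Polynomial.aeval ξ : Polynomial ℂ →ₐ[ℂ] Polynomial ℂ).toRingHom with hi
  have hiC : ∀ c : ℂ, i (Polynomial.C c) = π (Polynomial.C c) := fun c => by simp [hi]
  have hiX : i Polynomial.X = π ξ := by simp [hi]
  have hW : Polynomial.eval₂ i (π η) (wCurve a₂ a₄ a₆).polynomial = 0 := by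
    have harc := arc_expansion (B := Polynomial ℂ) (x := Polynomial.C x) (y := Polynomial.C y)
      (α := Polynomial.C α) (β := Polynomial.C β) (b₂ := Polynomial.C a₂) (b₄ := Polynomial.C a₄)
      (b₆ := Polynomial.C a₆) (f := Polynomial.C f) Polynomial.X
      (by rw [hf]; simp only [map_add, map_mul, map_pow, map_ofNat]) (by rw [← Polynomial.C_pow, heq]; simp)
      (by
        have := congrArg (Polynomial.C : ℂ → Polynomial ℂ) hαβ
        simpa only [map_add, map_mul, map_pow, map_sub, map_ofNat] using this)
    have h0 : π (η ^ 2 - (ξ ^ 3 + Polynomial.C a₂ * ξ ^ 2 + Polynomial.C a₄ * ξ +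
        Polynomial.C a₆)) = 0 := by
      rw [hπ, Ideal.Quotient.eq_zero_iff_mem, hI, Ideal.mem_span_singleton, hξ, hη, harc]
      exact Dvd.intro _ rfl
    rw [← h0]
    simp only [WeierstrassCurve.Affine.polynomial, wCurve, Polynomial.eval₂_sub,
      Polynomial.eval₂_add, Polynomial.eval₂_mul, Polynomial.eval₂_pow, Polynomial.eval₂_C,
      Polynomial.eval₂_X, Polynomial.eval₂_zero, map_add, map_sub, map_mul, map_pow, hiX, hiC,
      map_zero]
    ring
  set ψ : (wCurve a₂ a₄ a₆).CoordinateRing →+* Polynomial ℂ ⧸ I := AdjoinRoot.lift i (π η) hW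
    with hψ
  have hψmk : ∀ p : Polynomial (Polynomial ℂ),
      ψ (WeierstrassCurve.Affine.CoordinateRing.mk _ p) = Polynomial.eval₂ i (π η) p :=
    fun p => AdjoinRoot.lift_mk hW p
  have hm : (WeierstrassCurve.Affine.CoordinateRing.XYIdeal (wCurve a₂ a₄ a₆) x
      (Polynomial.C y)).map ψ ≤ Ideal.span {π Polynomial.X} := by
    rw [Ideal.map_le_iff_le_comap, WeierstrassCurve.Affine.CoordinateRing.XYIdeal, Ideal.span_le]
    rintro _ (rfl | rfl)
    · refine Ideal.mem_span_singleton.mpr ⟨π (2 * Polynomial.C y + Polynomial.C α * Polynomial.X),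
        ?_⟩
      rw [WeierstrassCurve.Affine.CoordinateRing.XClass, hψmk, ← map_mul]
      rw [Polynomial.eval₂_C, map_sub i, hiX, hiC, ← map_sub, hξ]
      congr 1
      ring
    · refine Ideal.mem_span_singleton.mpr ⟨π (Polynomial.C f + Polynomial.C β * Polynomial.X), ?_⟩
      rw [WeierstrassCurve.Affine.CoordinateRing.YClass, hψmk, ← map_mul]
      simp only [Polynomial.eval₂_C, Polynomial.eval₂_X, Polynomial.eval₂_sub, hiC]
      rw [← map_sub, hη]
      congr 1
      ring
  have h3 := (Ideal.map_pow ψ _ 3).trans_le (Ideal.pow_right_mono hm 3) (Ideal.mem_map_of_mem ψ hL)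
  have hX3 : π Polynomial.X ^ 3 = 0 := by
    rw [← map_pow, hπ, Ideal.Quotient.eq_zero_iff_mem]
    exact Ideal.mem_span_singleton_self _
  rw [Ideal.span_singleton_pow, hX3, Ideal.mem_span_singleton, zero_dvd_iff, hψmk] at h3
  simp only [Polynomial.eval₂_add, Polynomial.eval₂_mul, Polynomial.eval₂_sub, Polynomial.eval₂_C,
    Polynomial.eval₂_X, hiC, hiX, map_mul i, map_sub i, ← map_mul π, ← map_sub π, ← map_add π] at h3
  rw [hπ, Ideal.Quotient.eq_zero_iff_mem, hI, Ideal.mem_span_singleton,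
    Polynomial.X_pow_dvd_iff] at h3
  have h4 : Polynomial.C (-f) * (ξ - Polynomial.C x) + Polynomial.C (2 * y) * (η - Polynomial.C y) =
      Polynomial.C (2 * y * β - f * α) * Polynomial.X ^ 2 := by
    rw [hξ, hη]
    simp only [Polynomial.C_neg, Polynomial.C_mul, Polynomial.C_sub, map_ofNat]
    ring
  have h5 := h3 2 (by norm_num)
  rw [h4, Polynomial.coeff_C_mul_X_pow] at h5
  rw [if_pos rfl, hαβ] at h5
  linear_combination -h5

/-- At an affine inflection point the three-division polynomial vanishes. -/
theorem inflection_relation (hc : c ≠ 0) (hsmooth : IsSmooth F) (hF : F.IsHomogeneous 3)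
    (hFM : subst M.toLinearMap F = C c * wForm a₂ a₄ a₆) {P : curve F} (hP : IsInflection F P)
    {x y : ℂ} (h : (wCurve a₂ a₄ a₆).Equation x y)
    (hPxy : (P : Plane) = Projectivization.mk ℂ (M ![x, y, 1]) (affineVector_ne_zero M x y)) :
    (3 * x ^ 2 + 2 * a₂ * x + a₄) ^ 2 = 4 * y ^ 2 * (3 * x + a₂) := by
  classical
  have hns := wCurve_nonsingular_of_isSmooth hsmooth hFM h
  set G := tangentForm F P with hG
  have hG1 : G.IsHomogeneous 1 := by
    refine IsHomogeneous.sum _ _ _ fun i _ => ?_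
    simpa using (isHomogeneous_C (Fin 3) (eval (P : Plane).rep (pderiv i F))).mul
      (isHomogeneous_X ℂ i)
  obtain ⟨κ, hκ, hrep⟩ := exists_rep_eq (affineVector_ne_zero M x y)
  rw [← hPxy] at hrep
  have heval : ∀ w, eval w (subst M.toLinearMap G) =
      κ ^ 2 * (c * polar (wForm a₂ a₄ a₆) ![x, y, 1] w) := fun w => by
    rw [eval_subst]
    have : eval (M w) G = polar F (P : Plane).rep (M w) := by simp [hG, tangentForm, polar]
    change eval (M w) G = _
    rw [this, hrep, polar_smul_left hF, polar_apply_of_subst_eq hFM]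
  have hmem : dehom a₂ a₄ a₆ (subst M.toLinearMap G) ∈
      WeierstrassCurve.Affine.CoordinateRing.XYIdeal (wCurve a₂ a₄ a₆) x (Polynomial.C y) ^ 3 := by
    -- Zero lies in the cube trivially, so it need not be shown that the curve does not divide its
    -- tangent form.
    by_cases h0 : dehom a₂ a₄ a₆ (subst M.toLinearMap G) = 0
    · rw [h0]; exact Ideal.zero_mem _
    obtain ⟨s, hs⟩ := exists_prod_placeIdeal
      (fun x y h => wCurve_nonsingular_of_isSmooth (x := x) (y := y) hsmooth hFM h)
      (Ideal.span {dehom a₂ a₄ a₆ (subst M.toLinearMap G)}) (by simpa using h0)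
    obtain ⟨J, hJ, hJm⟩ := exists_prod_placeIdeal_eq_pow_mul s hns
    rw [hs] at hJ
    have hmult := interMult_eq hc hFM hns hG1 hJ hJm
    rw [← hPxy] at hmult
    have h3 : 3 ≤ interMult F G P := hP
    rw [hmult] at h3
    have h3' : 3 ≤ s.count (.some x y hns) := by exact_mod_cast h3
    exact Ideal.pow_le_pow_right h3' ((hJ.trans_le Ideal.mul_le_left)
      (Ideal.mem_span_singleton_self _))
  refine tangent_mem_cube hns ?_
  set ℓ : Forms := C (-(3 * x ^ 2 + 2 * a₂ * x + a₄)) * (X 0 - C x * X 2) +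
    C (2 * y) * (X 1 - C y * X 2) with hℓ
  have hsub : subst M.toLinearMap G = C (κ ^ 2 * c) * ℓ := by
    refine MvPolynomial.funext fun w => ?_
    rw [heval, polar_wForm, hℓ]
    have heq := (wCurve_equation_iff ..).mp h
    simp
    linear_combination κ ^ 2 * c * w 2 * 3 * heq
  have hu : IsUnit (algebraMap ℂ (wCurve a₂ a₄ a₆).CoordinateRing (κ ^ 2 * c)) :=
    (IsUnit.mk0 _ (mul_ne_zero (pow_ne_zero 2 hκ) hc)).map _
  rw [hsub, map_mul, dehom_C, Ideal.unit_mul_mem_iff_mem _ hu] at hmem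
  have hd : dehom a₂ a₄ a₆ ℓ =
      algebraMap ℂ _ (-(3 * x ^ 2 + 2 * a₂ * x + a₄)) *
        WeierstrassCurve.Affine.CoordinateRing.XClass (wCurve a₂ a₄ a₆) x +
      algebraMap ℂ _ (2 * y) *
        WeierstrassCurve.Affine.CoordinateRing.YClass (wCurve a₂ a₄ a₆) (Polynomial.C y) := by
    rw [hℓ, map_add, map_mul, map_mul, dehom_X_zero_sub, dehom_X_one_sub, dehom_C, dehom_C]
  rw [hd] at hmem
  convert hmem using 1
  rw [WeierstrassCurve.Affine.CoordinateRing.XClass, WeierstrassCurve.Affine.CoordinateRing.YClass,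
    map_add, Polynomial.C_mul, map_mul, map_mul]
  rfl

end Inflection
end PlaneCubic

namespace PlaneCubic
open MvPolynomial

/-! ### From derivations to independence in the Picard group. -/

section Independence

variable {a₂ a₄ a₆ c : ℂ} {F : Forms} {M : (Fin 3 → ℂ) ≃ₗ[ℂ] (Fin 3 → ℂ)}

/-- The roots of the three-division polynomial are algebraic over the coefficients. -/
theorem isAlgebraic_of_inflection_relation {x : ℂ} {k : Subfield ℂ} (h₂ : a₂ ∈ k) (h₄ : a₄ ∈ k)
    (h₆ : a₆ ∈ k) (hrel : (3 * x ^ 2 + 2 * a₂ * x + a₄) ^ 2 =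
      4 * (x ^ 3 + a₂ * x ^ 2 + a₄ * x + a₆) * (3 * x + a₂)) : IsAlgebraic k x := by
  -- This is the relation expanded in powers of x; the leading coefficient is 9 - 12.
  set p : Polynomial k := Polynomial.C (-3) * Polynomial.X ^ 4 +
    Polynomial.C (-4 * ⟨a₂, h₂⟩) * Polynomial.X ^ 3 +
    Polynomial.C (-6 * ⟨a₄, h₄⟩) * Polynomial.X ^ 2 +
    Polynomial.C (-12 * ⟨a₆, h₆⟩) * Polynomial.X +
    Polynomial.C (⟨a₄, h₄⟩ ^ 2 - 4 * ⟨a₂, h₂⟩ * ⟨a₆, h₆⟩) with hp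
  have hp4 : p.natDegree = 4 := by
    rw [hp]
    compute_degree!
  refine ⟨p, fun h0 => ?_, ?_⟩
  · rw [h0] at hp4; simp at hp4
  · have e2 : algebraMap k ℂ ⟨a₂, h₂⟩ = a₂ := rfl
    have e4 : algebraMap k ℂ ⟨a₄, h₄⟩ = a₄ := rfl
    have e6 : algebraMap k ℂ ⟨a₆, h₆⟩ = a₆ := rfl
    simp only [hp, map_add, map_sub, map_mul, map_pow, map_ofNat, Polynomial.aeval_X,
      Polynomial.aeval_C, map_neg, e2, e4, e6]
    linear_combination hrel

/-- The abscissa of an affine inflection point is algebraic over the coefficients. -/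
theorem inflection_isAlgebraic (hc : c ≠ 0) (hsmooth : IsSmooth F) (hF : F.IsHomogeneous 3)
    (hFM : subst M.toLinearMap F = C c * wForm a₂ a₄ a₆) {P : curve F} (hP : IsInflection F P)
    {x y : ℂ} (h : (wCurve a₂ a₄ a₆).Equation x y)
    (hPxy : (P : Plane) = Projectivization.mk ℂ (M ![x, y, 1]) (affineVector_ne_zero M x y))
    {k : Subfield ℂ} (h₂ : a₂ ∈ k) (h₄ : a₄ ∈ k) (h₆ : a₆ ∈ k) : IsAlgebraic k x := by
  have hrel := inflection_relation hc hsmooth hF hFM hP h hPxy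
  rw [wCurve_equation_iff] at h
  rw [h] at hrel
  exact isAlgebraic_of_inflection_relation h₂ h₄ h₆ hrel

/-- The homomorphism on the Picard group that a derivation defines. -/
theorem exists_picHom (hc : c ≠ 0) (hsmooth : IsSmooth F)
    (hFM : subst M.toLinearMap F = C c * wForm a₂ a₄ a₆) (δ : Derivation ℤ ℂ ℂ)
    (h₂ : δ a₂ = 0) (h₄ : δ a₄ = 0) (h₆ : δ a₆ = 0) :
    ∃ Ψ : Pic F →+ ℂ, ∀ P₀ P : curve F, Ψ (diffClass F P₀ P) =
      logDeriv δ (toPoint a₂ a₄ a₆ M P) - logDeriv δ (toPoint a₂ a₄ a₆ M P₀) := by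
  classical
  set ℓ : (wCurve a₂ a₄ a₆).Point →+ ℂ :=
    { toFun := logDeriv δ
      map_zero' := rfl
      map_add' := by convert logDeriv_add δ h₂ h₄ h₆ } with hℓ
  refine ⟨QuotientAddGroup.lift (principal F) (ℓ.comp (divisorSum a₂ a₄ a₆ F M)) fun D hD => ?_,
    fun P₀ P => ?_⟩
  · rw [AddMonoidHom.mem_ker, AddMonoidHom.comp_apply, divisorSum_eq_zero hc hsmooth hFM hD, map_zero]
  · change ℓ (divisorSum a₂ a₄ a₆ F M (Finsupp.single P 1 - Finsupp.single P₀ 1)) = _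
    rw [map_sub, divisorSum_single, divisorSum_single, one_zsmul, one_zsmul, map_sub]
    rfl

/-- In a nontrivial relation take the largest index i with nonzero coefficient; Ψ i leaves only the
diagonal term. -/
theorem linearIndependent_of_triangular {A : Type*} [AddCommGroup A] {r : ℕ} (v : Fin r → A)
    (Ψ : Fin r → A →+ ℂ) (hdiag : ∀ i, Ψ i (v i) ≠ 0) (hlow : ∀ i j, j < i → Ψ i (v j) = 0) :
    LinearIndependent ℤ v := by
  rw [Fintype.linearIndependent_iff]
  intro g hg
  by_contra! hne
  obtain ⟨i, hi, hmax⟩ : ∃ i, g i ≠ 0 ∧ ∀ j, i < j → g j = 0 := by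
    obtain ⟨i, hi⟩ := (Set.toFinite {i | g i ≠ 0}).exists_maximal hne
    exact ⟨i, hi.prop, fun j hj => by_contra fun h => (hi.not_gt h hj)⟩
  have h := congrArg (Ψ i) hg
  rw [map_sum, map_zero, Finset.sum_eq_single i] at h
  · rw [map_zsmul, zsmul_eq_mul] at h
    rcases mul_eq_zero.mp h with h | h
    · exact hi (by exact_mod_cast h)
    · exact hdiag i h
  · intro j _ hji
    rcases lt_or_gt_of_ne hji with h' | h'
    · rw [map_zsmul, hlow i j h', smul_zero]
    · rw [hmax j h', zero_smul, map_zero]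
  · simp

/-- Points whose abscissas are separated by derivations are independent. -/
theorem independent_of_derivations (hc : c ≠ 0) (hsmooth : IsSmooth F) (hF : F.IsHomogeneous 3)
    (hFM : subst M.toLinearMap F = C c * wForm a₂ a₄ a₆) {r : ℕ} {p : Fin r → curve F}
    {x y : Fin r → ℂ} (h : ∀ i, (wCurve a₂ a₄ a₆).Equation (x i) (y i)) (hy : ∀ i, y i ≠ 0)
    (hp : ∀ i, (p i : Plane) =
      Projectivization.mk ℂ (M ![x i, y i, 1]) (affineVector_ne_zero M (x i) (y i)))
    {δ : Fin r → Derivation ℤ ℂ ℂ} {k : Subfield ℂ} (h₂ : a₂ ∈ k) (h₄ : a₄ ∈ k) (h₆ : a₆ ∈ k)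
    (hδ : ∀ i z, IsAlgebraic k z → δ i z = 0) (hdiag : ∀ i, δ i (x i) = 1)
    (hlow : ∀ i j, j < i → δ i (x j) = 0) {p₀ : curve F} (hp₀ : IsInflection F p₀) :
    Independent F p₀ p := by
  have halg : ∀ i z, z ∈ k → δ i z = 0 := fun i z hz =>
    hδ i z (isAlgebraic_algebraMap (⟨z, hz⟩ : k))
  have h0 : ∀ i, logDeriv (δ i) (toPoint a₂ a₄ a₆ M p₀) = 0 := fun i => by
    rcases eq_infinity_or_affine hc hFM p₀ with ⟨hne, he⟩ | ⟨x₀, y₀, hxy, he⟩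
    · rw [he, toPoint_infinity]; rfl
    · rw [he, toPoint_affine (wCurve_nonsingular_of_isSmooth hsmooth hFM hxy), logDeriv_some,
        hδ i _ (inflection_isAlgebraic hc hsmooth hF hFM hp₀ hxy he h₂ h₄ h₆), zero_div]
  choose Ψ hΨ using fun i => exists_picHom hc hsmooth hFM (δ i) (halg i _ h₂) (halg i _ h₄)
    (halg i _ h₆)
  have hval : ∀ i j, Ψ i (diffClass F p₀ (p j)) = δ i (x j) / y j := fun i j => by
    rw [hΨ, h0, sub_zero, hp, toPoint_affine (wCurve_nonsingular_of_isSmooth hsmooth hFM (h j)),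
      logDeriv_some]
  refine linearIndependent_of_triangular _ (fun i => (Ψ i).comp (Pic0 F).subtype) (fun i => ?_)
    fun i j hij => ?_
  · change Ψ i (diffClass F p₀ (p i)) ≠ 0
    rw [hval, hdiag]
    exact one_div_ne_zero (hy i)
  · change Ψ i (diffClass F p₀ (p j)) = 0
    rw [hval, hlow i j hij, zero_div]

end Independence
end PlaneCubic

namespace PlaneCubic
open MvPolynomial

/-! ### Coordinates for ternary cubics and linear automorphisms. -/

section TernaryCubic

variable {K : Type*} [Field K]

/-- The ternary cubic form with given coefficients. -/
def ternaryCubic (k : Fin 10 → K) : MvPolynomial (Fin 3) K :=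
  C (k 0) * X 0 ^ 3 + C (k 1) * (X 0 ^ 2 * X 1) + C (k 2) * (X 0 ^ 2 * X 2) +
    C (k 3) * (X 0 * X 1 ^ 2) + C (k 4) * (X 0 * X 1 * X 2) + C (k 5) * (X 0 * X 2 ^ 2) +
    C (k 6) * X 1 ^ 3 + C (k 7) * (X 1 ^ 2 * X 2) + C (k 8) * (X 1 * X 2 ^ 2) + C (k 9) * X 2 ^ 3

theorem eval_ternaryCubic (k : Fin 10 → K) (u : Fin 3 → K) : eval u (ternaryCubic k) =
    k 0 * u 0 ^ 3 + k 1 * (u 0 ^ 2 * u 1) + k 2 * (u 0 ^ 2 * u 2) + k 3 * (u 0 * u 1 ^ 2) +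
      k 4 * (u 0 * u 1 * u 2) + k 5 * (u 0 * u 2 ^ 2) + k 6 * u 1 ^ 3 + k 7 * (u 1 ^ 2 * u 2) +
      k 8 * (u 1 * u 2 ^ 2) + k 9 * u 2 ^ 3 := by
  simp [ternaryCubic]

theorem polar_ternaryCubic (k : Fin 10 → K) (u w : Fin 3 → K) : polar (ternaryCubic k) u w =
    (3 * k 0 * u 0 ^ 2 + 2 * k 1 * u 0 * u 1 + 2 * k 2 * u 0 * u 2 + k 3 * u 1 ^ 2 +
      k 4 * u 1 * u 2 + k 5 * u 2 ^ 2) * w 0 +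
    (k 1 * u 0 ^ 2 + 2 * k 3 * u 0 * u 1 + k 4 * u 0 * u 2 + 3 * k 6 * u 1 ^ 2 +
      2 * k 7 * u 1 * u 2 + k 8 * u 2 ^ 2) * w 1 +
    (k 2 * u 0 ^ 2 + k 4 * u 0 * u 1 + 2 * k 5 * u 0 * u 2 + k 7 * u 1 ^ 2 +
      2 * k 8 * u 1 * u 2 + 3 * k 9 * u 2 ^ 2) * w 2 := by
  simp only [ternaryCubic, polar_add, polar_C, polar_mul, polar_X, pow_succ, pow_zero, one_mul,
    map_mul, eval_X, eval_C]
  ring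

theorem map_ternaryCubic {L : Type*} [Field L] (φ : K →+* L) (k : Fin 10 → K) :
    MvPolynomial.map φ (ternaryCubic k) = ternaryCubic (φ ∘ k) := by
  simp [ternaryCubic]

/-- Every ternary cubic form is given by ten coefficients. -/
theorem exists_eq_ternaryCubic [CharZero K] {f : MvPolynomial (Fin 3) K}
    (hf : f.IsHomogeneous 3) : ∃ k, f = ternaryCubic k := by
  -- Three uses of Euler's identity express f through its constant third derivatives. They are not
  -- symmetrized, so each coefficient is a sum over orderings divided by 3!.
  have euler : ∀ (d : ℕ) (g : MvPolynomial (Fin 3) K), g.IsHomogeneous d → ∀ u : Fin 3 → K,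
      (d : K) * eval u g = u 0 * eval u (pderiv 0 g) + u 1 * eval u (pderiv 1 g) +
        u 2 * eval u (pderiv 2 g) := fun d g hg u => by
    have := congrArg (eval u) hg.sum_X_mul_pderiv
    simpa [Fin.sum_univ_three] using this.symm
  have h3 : ∀ i j k u, eval u (pderiv i (pderiv j (pderiv k f))) =
      coeff 0 (pderiv i (pderiv j (pderiv k f))) := fun i j k u => by
    have h : (pderiv i (pderiv j (pderiv k f))).IsHomogeneous 0 :=
      ((hf.pderiv (i := k)).pderiv (i := j)).pderiv (i := i)
    rw [totalDegree_eq_zero_iff_eq_C.mp (Nat.le_zero.mp h.totalDegree_le)]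
    simp
  set t : Fin 3 → Fin 3 → Fin 3 → K := fun i j k => coeff 0 (pderiv i (pderiv j (pderiv k f)))
    with ht
  have h1 := fun j k u => euler 1 _ ((hf.pderiv (i := k)).pderiv (i := j)) u
  have h2 := fun k u => euler 2 _ (hf.pderiv (i := k)) u
  have h0 := fun u => euler 3 f hf u
  simp only [h3] at h1
  refine ⟨![t 0 0 0 / 6, (t 0 0 1 + t 0 1 0 + t 1 0 0) / 6, (t 0 0 2 + t 0 2 0 + t 2 0 0) / 6,
    (t 0 1 1 + t 1 0 1 + t 1 1 0) / 6,
    (t 0 1 2 + t 0 2 1 + t 1 0 2 + t 1 2 0 + t 2 0 1 + t 2 1 0) / 6,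
    (t 0 2 2 + t 2 0 2 + t 2 2 0) / 6, t 1 1 1 / 6, (t 1 1 2 + t 1 2 1 + t 2 1 1) / 6,
    (t 1 2 2 + t 2 1 2 + t 2 2 1) / 6, t 2 2 2 / 6], MvPolynomial.funext fun u => ?_⟩
  rw [eval_ternaryCubic]
  simp only [Matrix.cons_val]
  have e0 := h0 u
  have e2 := fun k => h2 k u
  have e1 := fun j k => h1 j k u
  push_cast at e0 e1 e2
  simp only [one_mul] at e1
  simp only [e1] at e2
  have six : (6 : K) ≠ 0 := by norm_num
  refine mul_left_cancel₀ six ?_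
  field_simp
  linear_combination 2 * e0 + u 0 * e2 0 + u 1 * e2 1 + u 2 * e2 2

theorem polar_single (f : MvPolynomial (Fin 3) K) (v : Fin 3 → K) (i : Fin 3) :
    polar f v (Pi.single i 1) = eval v (pderiv i f) := by
  simp [polar, Pi.single_apply]

/-- The linear automorphism with columns `w`, `v`, `v ⨯₃ w`. -/
theorem exists_frame {v w : Fin 3 → ℝ} (h : LinearIndependent ℝ ![v, w]) :
    ∃ M : (Fin 3 → ℝ) ≃ₗ[ℝ] (Fin 3 → ℝ), M ![1, 0, 0] = w ∧ M ![0, 1, 0] = v := by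
  have hne := crossProduct_ne_zero_iff_linearIndependent.mpr h
  set A : Matrix (Fin 3) (Fin 3) ℝ := (Matrix.of ![w, v, crossProduct v w]).transpose with hA
  have hdet : A.det ≠ 0 := by
    have : A.det = -(crossProduct v w 0 ^ 2 + crossProduct v w 1 ^ 2 + crossProduct v w 2 ^ 2) := by
      rw [hA, Matrix.det_transpose, Matrix.det_fin_three]
      simp [cross_apply]
      ring
    rw [this, neg_ne_zero]
    intro h0
    refine hne ?_
    have a0 : crossProduct v w 0 = 0 := by
      nlinarith [sq_nonneg (crossProduct v w 0), sq_nonneg (crossProduct v w 1),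
        sq_nonneg (crossProduct v w 2)]
    have a1 : crossProduct v w 1 = 0 := by
      nlinarith [sq_nonneg (crossProduct v w 0), sq_nonneg (crossProduct v w 1),
        sq_nonneg (crossProduct v w 2)]
    have a2 : crossProduct v w 2 = 0 := by
      nlinarith [sq_nonneg (crossProduct v w 0), sq_nonneg (crossProduct v w 1),
        sq_nonneg (crossProduct v w 2)]
    ext i
    fin_cases i <;> assumption
  refine ⟨A.toLinearEquiv' (A.invertibleOfIsUnitDet (isUnit_iff_ne_zero.mpr hdet)), ?_, ?_⟩ <;>
  · ext i
    fin_cases i <;> simp [Matrix.toLinearEquiv', hA]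

/-- A triangular linear automorphism of three-space. -/
def triangular (β γ r s t : K) (hβ : β ≠ 0) (hγ : γ ≠ 0) : (Fin 3 → K) ≃ₗ[K] (Fin 3 → K) where
  toFun u := ![u 0 + r * u 2, β * (u 1 + s * u 0 + t * u 2), γ * u 2]
  map_add' u v := by ext i; fin_cases i <;> simp <;> ring
  map_smul' a u := by ext i; fin_cases i <;> simp <;> ring
  invFun u := ![u 0 - r * (u 2 / γ), u 1 / β - s * (u 0 - r * (u 2 / γ)) - t * (u 2 / γ), u 2 / γ]
  left_inv u := by
    ext i
    fin_cases i <;> simp [hβ, hγ]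
    ring
  right_inv u := by
    ext i
    fin_cases i <;> simp
    all_goals field_simp
    ring

theorem triangular_apply (β γ r s t : K) (hβ : β ≠ 0) (hγ : γ ≠ 0) (u : Fin 3 → K) :
    triangular β γ r s t hβ hγ u = ![u 0 + r * u 2, β * (u 1 + s * u 0 + t * u 2), γ * u 2] := rfl

end TernaryCubic

/-! ### Real cubics in tangent coordinates, and Weierstrass form at a flex. -/

section RealForms

variable {f : MvPolynomial (Fin 3) ℝ}

/-- At a smooth real zero `v` of `f` there is a vector that spans the tangent line together with
`v`. -/
theorem exists_tangent_vector (hf : f.IsHomogeneous 3) {v : Fin 3 → ℝ} (hv : v ≠ 0)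
    (hfv : eval v f = 0) (hs : ∃ i, eval v (pderiv i f) ≠ 0) :
    ∃ w, LinearIndependent ℝ ![v, w] ∧ polar f v w = 0 := by
  set g : Fin 3 → ℝ := fun i => eval v (pderiv i f) with hg
  have hgv : g 0 * v 0 + g 1 * v 1 + g 2 * v 2 = 0 := by
    have := congrArg (eval v) hf.sum_X_mul_pderiv
    simp [Fin.sum_univ_three, hfv] at this
    simp only [hg]
    linear_combination this
  have hg0 : g ≠ 0 := fun h0 => by
    obtain ⟨i, hi⟩ := hs
    exact hi (congrFun h0 i)
  -- By Euler the gradient g is orthogonal to v, so v × (v × g) is -|v|² g, which is nonzero.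
  refine ⟨crossProduct v g, ?_, ?_⟩
  · rw [← crossProduct_ne_zero_iff_linearIndependent, cross_cross_eq_smul_sub_smul']
    have hd : v ⬝ᵥ g = 0 := by
      simp [dotProduct, Fin.sum_univ_three]
      linear_combination hgv
    rw [hd, zero_smul, zero_sub, neg_ne_zero]
    refine smul_ne_zero ?_ hg0
    rwa [Ne, dotProduct_self_eq_zero]
  · have : polar f v (crossProduct v g) = g ⬝ᵥ crossProduct v g := by
      simp [polar, dotProduct, hg]
    rw [this, dot_cross_self]

/-- In a frame whose second vector is a smooth zero `v` and whose first vector lies on the tangent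
line, the coefficients of `y³` and `xy²` vanish and that of `y²z` does not. -/
theorem exists_tangent_form (hf : f.IsHomogeneous 3)
    (hs : ∀ v ≠ 0, eval v f = 0 → ∃ i, eval v (pderiv i f) ≠ 0) {v w : Fin 3 → ℝ}
    (hvw : LinearIndependent ℝ ![v, w]) (hfv : eval v f = 0) (hpol : polar f v w = 0) :
    ∃ (M : (Fin 3 → ℝ) ≃ₗ[ℝ] (Fin 3 → ℝ)) (k : Fin 10 → ℝ), M ![1, 0, 0] = w ∧ M ![0, 1, 0] = v ∧
      subst M.toLinearMap f = ternaryCubic k ∧ k 6 = 0 ∧ k 3 = 0 ∧ k 7 ≠ 0 := by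
  obtain ⟨M, hMw, hMv⟩ := exists_frame hvw
  obtain ⟨k, hk⟩ := exists_eq_ternaryCubic (subst_isHomogeneous M.toLinearMap hf)
  have hpolk : ∀ u, polar f v (M u) = polar (ternaryCubic k) ![0, 1, 0] u := fun u => by
    rw [← hk, polar_subst]
    change _ = polar f (M _) (M _)
    rw [hMv]
  have h6 : k 6 = 0 := by
    have : eval ![0, 1, 0] (ternaryCubic k) = 0 := by
      rw [← hk, eval_subst]
      change eval (M _) f = 0
      rw [hMv, hfv]
    simpa [eval_ternaryCubic] using this
  have h3 : k 3 = 0 := by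
    have := hpolk ![1, 0, 0]
    rw [hMw, hpol] at this
    simpa [polar_ternaryCubic] using this.symm
  refine ⟨M, k, hMw, hMv, hk, h6, h3, fun h7 => ?_⟩
  obtain ⟨i, hi⟩ := hs v (hvw.ne_zero 0) hfv
  refine hi ?_
  have := hpolk (M.symm (Pi.single i 1))
  rw [LinearEquiv.apply_symm_apply, polar_single] at this
  simpa [polar_ternaryCubic, h6, h3, h7] using this

/-- The complexification of a real linear automorphism. -/
def complexify (M : (Fin 3 → ℝ) ≃ₗ[ℝ] (Fin 3 → ℝ)) : (Fin 3 → ℂ) ≃ₗ[ℂ] (Fin 3 → ℂ) :=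
  LinearEquiv.ofLinearMap
    (Matrix.toLin' ((LinearMap.toMatrix' M.toLinearMap).map (algebraMap ℝ ℂ)))
    (Matrix.toLin' ((LinearMap.toMatrix' M.symm.toLinearMap).map (algebraMap ℝ ℂ)))
    (by rw [← Matrix.toLin'_mul, ← Matrix.map_mul, ← LinearMap.toMatrix'_comp]; simp)
    (by rw [← Matrix.toLin'_mul, ← Matrix.map_mul, ← LinearMap.toMatrix'_comp]; simp)

theorem complexify_single (M : (Fin 3 → ℝ) ≃ₗ[ℝ] (Fin 3 → ℝ)) (i j : Fin 3) :
    complexify M (Pi.single j 1) i = (M (Pi.single j 1) i : ℝ) := by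
  simp [complexify, LinearMap.toMatrix'_apply]

theorem complexify_ofReal (M : (Fin 3 → ℝ) ≃ₗ[ℝ] (Fin 3 → ℝ)) (v : Fin 3 → ℝ) :
    complexify M (fun i => (v i : ℂ)) = fun i => ((M v i : ℝ) : ℂ) := by
  ext i
  change _ = ((M.toLinearMap v i : ℝ) : ℂ)
  rw [← eval_substVar M.toLinearMap v i]
  change (complexify M).toLinearMap _ _ = _
  rw [← eval_substVar (complexify M).toLinearMap _ i]
  push_cast
  exact Finset.sum_congr rfl fun j _ => congrArg (· * _) (complexify_single M i j)

theorem subst_complexify (M : (Fin 3 → ℝ) ≃ₗ[ℝ] (Fin 3 → ℝ)) (f : MvPolynomial (Fin 3) ℝ) :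
    subst (complexify M).toLinearMap (map (algebraMap ℝ ℂ) f) =
      map (algebraMap ℝ ℂ) (subst M.toLinearMap f) := by
  induction f using MvPolynomial.induction_on with
  | C a => simp [subst]
  | add p q hp hq => simp only [map_add, hp, hq]
  | mul_X p i hp =>
    rw [map_mul, map_mul, map_mul, map_mul, hp, map_X, subst_X, subst_X, map_sum]
    congr 1
    refine Finset.sum_congr rfl fun j _ => ?_
    rw [map_mul, map_C, map_X]
    congr 2
    exact complexify_single M i j

theorem eval_ofReal (f : MvPolynomial (Fin 3) ℝ) (v : Fin 3 → ℝ) :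
    eval (fun i => (v i : ℂ)) (map (algebraMap ℝ ℂ) f) = ((eval v f : ℝ) : ℂ) := by
  induction f using MvPolynomial.induction_on with
  | C a => simp
  | add p q hp hq => simp [hp, hq]
  | mul_X p i hp => simp [hp]

/-- A real form that is smooth over the complex numbers is smooth at its real zeros. -/
theorem smooth_of_isSmooth (hsm : IsSmooth (map (algebraMap ℝ ℂ) f)) (v : Fin 3 → ℝ) (hv : v ≠ 0)
    (hfv : eval v f = 0) : ∃ i, eval v (pderiv i f) ≠ 0 := by
  have hv' : (fun i => (v i : ℂ)) ≠ 0 := fun h => hv (by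
    ext i
    simpa using congrFun h i)
  obtain ⟨i, hi⟩ := hsm _ hv' (by rw [eval_ofReal, hfv, Complex.ofReal_zero])
  rw [pderiv_map, eval_ofReal] at hi
  exact ⟨i, by exact_mod_cast hi⟩

/-- A smooth real cubic form with a real inflection point has a Weierstrass form. -/
theorem exists_weierstrass_form (hf : f.IsHomogeneous 3)
    (hsm : IsSmooth (map (algebraMap ℝ ℂ) f)) {v w : Fin 3 → ℝ}
    (hvw : LinearIndependent ℝ ![v, w]) (hfv : eval v f = 0) (hvw0 : polar f v w = 0)
    (hwv0 : polar f w v = 0) :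
    ∃ (M : (Fin 3 → ℝ) ≃ₗ[ℝ] (Fin 3 → ℝ)) (c a₂ a₄ a₆ : ℝ), c ≠ 0 ∧
      subst M.toLinearMap f = C c * wForm a₂ a₄ a₆ := by
  obtain ⟨M, k, hMw, hMv, hk, h6, h3, h7⟩ :=
    exists_tangent_form hf (smooth_of_isSmooth hsm) hvw hfv hvw0
  have h1 : k 1 = 0 := by
    have : polar (ternaryCubic k) ![1, 0, 0] ![0, 1, 0] = 0 := by
      rw [← hk, polar_subst]
      change polar f (M _) (M _) = 0
      rw [hMw, hMv, hwv0]
    simpa [polar_ternaryCubic] using this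
  -- Otherwise the flex tangent is a component, and a possibly non-real point where it meets the
  -- residual conic is singular; this is where smoothness over ℂ is needed.
  have h0 : k 0 ≠ 0 := by
    intro h0
    have h7' : (k 7 : ℂ) ≠ 0 := by exact_mod_cast h7
    obtain ⟨z, hz'⟩ : ∃ z : ℂ, k 2 + k 4 * z + k 7 * z ^ 2 = 0 := by
      obtain ⟨z, hz⟩ := IsAlgClosed.exists_pow_nat_eq
        (((k 4 : ℂ) ^ 2 - 4 * k 2 * k 7) / (4 * k 7 ^ 2)) (n := 2) two_pos
      refine ⟨z - k 4 / (2 * k 7), ?_⟩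
      rw [sub_sq, hz]
      field_simp
      ring
    have hkC := subst_complexify M f
    rw [hk, map_ternaryCubic] at hkC
    obtain ⟨i, hi⟩ := hsm (complexify M ![1, z, 0])
      (by
        rw [Ne, LinearEquiv.map_eq_zero_iff]
        intro h
        simpa using congrFun h 0)
      (by
        have := eval_subst (complexify M).toLinearMap (map (algebraMap ℝ ℂ) f) ![1, z, 0]
        refine this.symm.trans ?_
        rw [hkC, eval_ternaryCubic]
        simp [h0, h1, h3, h6])
    refine hi ?_
    have := polar_subst (complexify M).toLinearMap (map (algebraMap ℝ ℂ) f) ![1, z, 0]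
      ((complexify M).symm (Pi.single i 1))
    rw [hkC, LinearEquiv.coe_coe, LinearEquiv.apply_symm_apply, polar_single] at this
    rw [← this, polar_ternaryCubic]
    simp [h0, h1, h3, h6]
    exact Or.inl hz'
  have hγ : -(k 0 / k 7) ≠ 0 := neg_ne_zero.mpr (div_ne_zero h0 h7)
  set γ := -(k 0 / k 7) with hγd
  -- N completes the square in y; γ makes the coefficients of x³ and y²z opposite.
  set N := triangular 1 γ 0 (-(k 4 / (2 * k 7))) (-(k 8 / (2 * k 7)) * γ) one_ne_zero hγ with hN
  refine ⟨N.trans M, -k 0, -(k 2 - k 4 ^ 2 / (4 * k 7)) / k 7,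
    (k 5 - k 4 * k 8 / (2 * k 7)) * k 0 / k 7 ^ 2, -(k 9 - k 8 ^ 2 / (4 * k 7)) * k 0 ^ 2 / k 7 ^ 3,
    neg_ne_zero.mpr h0, MvPolynomial.funext fun u => ?_⟩
  have : subst (N.trans M).toLinearMap f = subst N.toLinearMap (ternaryCubic k) := by
    rw [← hk, subst_subst]; rfl
  rw [this, eval_subst, map_mul, eval_C, eval_wForm, LinearEquiv.coe_coe, hN, triangular_apply,
    eval_ternaryCubic, hγd]
  simp only [h6, h3, h1, Matrix.cons_val]
  field_simp
  ring

end RealForms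
end PlaneCubic

namespace PlaneCubic
open MvPolynomial

/-! ### Existence of a real flex through the Hessian. -/

section RealInflection

/-- A real function that is negative somewhere and nonnegative somewhere, and that is nonnegative
wherever `Δ` is nonpositive, has a zero at which `Δ` is nonnegative. -/
theorem exists_zero_of_nonneg_of_nonpos {R Δ : ℝ → ℝ} (hR : Continuous R) (hΔ : Continuous Δ)
    (h : ∀ x, Δ x ≤ 0 → 0 ≤ R x) {a b : ℝ} (ha : R a < 0) (hb : 0 ≤ R b) :
    ∃ x, R x = 0 ∧ 0 ≤ Δ x := by
  obtain ⟨ℓ, hℓ⟩ : ∃ ℓ : ℝ → ℝ, ℓ = fun t => a + t * (b - a) := ⟨_, rfl⟩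
  have hℓc : Continuous ℓ := by rw [hℓ]; fun_prop
  -- Let m be the first time at which R ≥ 0 on the way from a to b. Before it R < 0, so Δ > 0; both
  -- pass to the limit.
  set S := Set.Icc (0 : ℝ) 1 ∩ {t | 0 ≤ R (ℓ t)} with hS
  have hSc : IsCompact S :=
    isCompact_Icc.inter_right (isClosed_le continuous_const (hR.comp hℓc))
  have h1 : (1 : ℝ) ∈ S := ⟨by simp, by simpa [hℓ] using hb⟩
  obtain ⟨m, hm⟩ := hSc.exists_isLeast ⟨1, h1⟩
  have hm0 : 0 < m := by
    refine lt_of_le_of_ne hm.1.1.1 fun h0 => ?_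
    have := hm.1.2
    rw [← h0] at this
    simp only [hℓ, Set.mem_ofPred_eq, zero_mul, add_zero] at this
    linarith
  have hneg : ∀ t ∈ Set.Ioo 0 m, R (ℓ t) < 0 := fun t ht => by
    by_contra! hc
    exact absurd (hm.2 ⟨⟨ht.1.le, ht.2.le.trans hm.1.1.2⟩, hc⟩) (not_le.mpr ht.2)
  have hcl : m ∈ closure (Set.Ioo 0 m) := by
    rw [closure_Ioo hm0.ne]
    exact ⟨hm0.le, le_rfl⟩
  refine ⟨ℓ m, le_antisymm ?_ hm.1.2, ?_⟩
  · exact closure_minimal (fun t ht => (hneg t ht).le)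
      (isClosed_le (hR.comp hℓc) continuous_const) hcl
  · refine closure_minimal (fun t ht => ?_) (isClosed_le continuous_const (hΔ.comp hℓc)) hcl
    by_contra! hc
    exact absurd (h _ (not_le.mp hc).le) (not_le.mpr (hneg t ht))

theorem exists_neg_and_pos_of_odd {p : Polynomial ℝ} (hp : Odd p.natDegree) :
    (∃ x, p.eval x < 0) ∧ ∃ x, 0 < p.eval x := by
  have key : ∀ q : Polynomial ℝ, 0 < q.natDegree → 0 ≤ q.leadingCoeff → ∃ x, 0 < q.eval x :=
    fun q hq hl => ((q.tendsto_atTop_of_leadingCoeff_nonneg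
      (Polynomial.natDegree_pos_iff_degree_pos.mp hq) hl).eventually_gt_atTop 0).exists
  have hdeg : (p.comp (-Polynomial.X)).natDegree = p.natDegree := by
    rw [Polynomial.natDegree_comp]; simp
  have hlead : (p.comp (-Polynomial.X)).leadingCoeff = -p.leadingCoeff := by
    rw [Polynomial.leadingCoeff_comp (by simp)]; simp [hp.neg_one_pow]
  rcases le_total 0 p.leadingCoeff with h | h
  · refine ⟨?_, key p hp.pos h⟩
    obtain ⟨x, hx⟩ := key (-p.comp (-Polynomial.X)) (by rw [Polynomial.natDegree_neg, hdeg]; exact hp.pos)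
      (by rw [Polynomial.leadingCoeff_neg, hlead]; simpa using h)
    exact ⟨-x, by simpa using hx⟩
  · constructor
    · obtain ⟨x, hx⟩ := key (-p) (by rw [Polynomial.natDegree_neg]; exact hp.pos)
        (by rw [Polynomial.leadingCoeff_neg]; simpa using h)
      exact ⟨x, by simpa using hx⟩
    · obtain ⟨x, hx⟩ := key (p.comp (-Polynomial.X)) (by rw [hdeg]; exact hp.pos)
        (by rw [hlead]; simpa using h)
      exact ⟨-x, by simpa using hx⟩

/-- The real cubic `y² z + x² y + k y z² + c x z² + d z³` has a real point at which its Hessian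
matrix is degenerate. -/
theorem exists_hessian_kernel (k c d : ℝ) : ∃ u w : Fin 3 → ℝ, u ≠ 0 ∧ w ≠ 0 ∧
    eval u (ternaryCubic ![0, 1, 0, 0, 0, c, 0, 1, k, d]) = 0 ∧
    u 1 * w 0 + u 0 * w 1 + c * u 2 * w 2 = 0 ∧
    u 0 * w 0 + u 2 * w 1 + (u 1 + k * u 2) * w 2 = 0 ∧
    c * u 2 * w 0 + (u 1 + k * u 2) * w 1 + (k * u 1 + c * u 0 + 3 * d * u 2) * w 2 = 0 := by
  suffices h : ∃ u : Fin 3 → ℝ, u ≠ 0 ∧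
      eval u (ternaryCubic ![0, 1, 0, 0, 0, c, 0, 1, k, d]) = 0 ∧
      (!![u 1, u 0, c * u 2; u 0, u 2, u 1 + k * u 2;
        c * u 2, u 1 + k * u 2, k * u 1 + c * u 0 + 3 * d * u 2] : Matrix _ _ ℝ).det = 0 by
    obtain ⟨u, hu, hG, hdet⟩ := h
    obtain ⟨w, hw, hmul⟩ := Matrix.exists_mulVec_eq_zero_iff.mpr hdet
    refine ⟨u, w, hu, hw, hG, ?_, ?_, ?_⟩
    · simpa [Matrix.mulVec, dotProduct, Fin.sum_univ_three] using congrFun hmul 0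
    · simpa [Matrix.mulVec, dotProduct, Fin.sum_univ_three] using congrFun hmul 1
    · simpa [Matrix.mulVec, dotProduct, Fin.sum_univ_three] using congrFun hmul 2
  -- For c = 0 the point [1 : 0 : 0] already works.
  by_cases hc : c = 0
  · refine ⟨![1, 0, 0], fun h => by simpa using congrFun h 0, ?_, ?_⟩
    · simp [eval_ternaryCubic]
    · rw [Matrix.det_fin_three]; simp [hc]
  set D : Polynomial ℝ := .C c * .X + .C d with hD
  set B : Polynomial ℝ := .X ^ 2 + .C k with hB
  -- On z = 1 the curve is y² + By + D = 0 with discriminant Δ, and the determinant reduces modulo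
  -- it to α - Δy. R is the product of α - Δy over the two roots y; its degree is 9, the number of
  -- complex flexes. A real zero of R with Δ ≥ 0 yields a real y.
  set Δ : Polynomial ℝ := B ^ 2 - 4 * D with hΔ
  set α : Polynomial ℝ := -(.C (2 * c) * .X ^ 3 + .C (4 * d) * .X ^ 2 - .C (2 * c * k) * .X +
    .C (c ^ 2)) with hα
  set R : Polynomial ℝ := α ^ 2 + B * α * Δ + D * Δ ^ 2 with hR
  have hdeg : R.natDegree = 9 := by
    rw [hR, hΔ, hα, hB, hD]
    compute_degree!
    rw [← Polynomial.C_pow, ← Polynomial.C_mul, ← Polynomial.C_mul, Polynomial.coeff_C,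
      Polynomial.coeff_C_mul_X_pow, Polynomial.coeff_C_mul_X_pow]
    norm_num
    intro h
    exact hc (by linarith)
  obtain ⟨⟨a, ha⟩, b, hb⟩ := exists_neg_and_pos_of_odd (p := R) (by rw [hdeg]; decide)
  obtain ⟨x, hRx, hΔx⟩ := exists_zero_of_nonneg_of_nonpos (R := fun x => R.eval x)
    (Δ := fun x => Δ.eval x) R.continuous Δ.continuous (fun x hx => by
      have : R.eval x = (α.eval x + B.eval x * Δ.eval x / 2) ^ 2 + (-Δ.eval x) ^ 3 / 4 := by
        rw [hR, hΔ]
        simp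
        ring
      change 0 ≤ R.eval x
      rw [this]
      have h1 : 0 ≤ -Δ.eval x := neg_nonneg.mpr hx
      positivity) ha hb.le
  obtain ⟨s, hs⟩ : ∃ s, s ^ 2 = Δ.eval x := ⟨_, Real.sq_sqrt hΔx⟩
  have hΔv : Δ.eval x = (x ^ 2 + k) ^ 2 - 4 * (c * x + d) := by simp [hΔ, hB, hD]
  have hprod : (α.eval x - Δ.eval x * ((-(x ^ 2 + k) + s) / 2)) *
      (α.eval x - Δ.eval x * ((-(x ^ 2 + k) + -s) / 2)) = 0 := by
    rw [← hRx, hR]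
    simp
    rw [hΔv] at hs
    simp [hB, hD, hΔv]
    linear_combination (-(((x ^ 2 + k) ^ 2 - 4 * (c * x + d)) ^ 2) / 4) * hs
  obtain ⟨y, hy, hyH⟩ : ∃ y, y ^ 2 + (x ^ 2 + k) * y + (c * x + d) = 0 ∧
      α.eval x - Δ.eval x * y = 0 := by
    rw [hΔv] at hs
    rcases mul_eq_zero.mp hprod with h | h
    · exact ⟨_, by linear_combination hs / 4, h⟩
    · exact ⟨_, by linear_combination hs / 4, h⟩
  refine ⟨![x, y, 1], fun h => by simpa using congrFun h 2, ?_, ?_⟩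
  · simp [eval_ternaryCubic]
    linear_combination hy
  · rw [Matrix.det_fin_three]
    simp [hα, hΔv] at hyH ⊢
    linear_combination hyH + (x ^ 2 - y) * hy

/-- A real cubic form in tangent coordinates that is not flat is equivalent to one in which only
two parameters and a linear coefficient are left. -/
theorem exists_triangular_normal_form {k : Fin 10 → ℝ} (h6 : k 6 = 0) (h3 : k 3 = 0) (h7 : k 7 ≠ 0)
    (h1 : k 1 ≠ 0) : ∃ (N : (Fin 3 → ℝ) ≃ₗ[ℝ] (Fin 3 → ℝ)) (e c d : ℝ),
      subst N.toLinearMap (ternaryCubic k) =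
        C (k 7) * ternaryCubic ![0, 1, 0, 0, 0, c, 0, 1, e, d] := by
  obtain ⟨b, hb⟩ : ∃ b, k 1 = k 7 * b := ⟨k 1 / k 7, by field_simp⟩
  have hb0 : b ≠ 0 := fun h => h1 (by rw [hb, h, mul_zero])
  obtain ⟨m0, hm0⟩ : ∃ m, k 0 = k 7 * m := ⟨k 0 / k 7, by field_simp⟩
  obtain ⟨m2, hm2⟩ : ∃ m, k 2 = k 7 * m / b ^ 2 := ⟨k 2 / k 7 * b ^ 2, by field_simp⟩
  obtain ⟨m4, hm4⟩ : ∃ m, k 4 = k 7 * m / b := ⟨k 4 / k 7 * b, by field_simp⟩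
  obtain ⟨m5, hm5⟩ : ∃ m, k 5 = k 7 * m / b ^ 4 := ⟨k 5 / k 7 * b ^ 4, by field_simp⟩
  obtain ⟨m8, hm8⟩ : ∃ m, k 8 = k 7 * m / b ^ 3 := ⟨k 8 / k 7 * b ^ 3, by field_simp⟩
  obtain ⟨m9, hm9⟩ : ∃ m, k 9 = k 7 * m / b ^ 6 := ⟨k 9 / k 7 * b ^ 6, by field_simp⟩
  -- The powers of b reduce to the case b = 1. The shear by -m0 removes x³, then r removes xyz and t
  -- removes x²z.
  obtain ⟨r, hr⟩ : ∃ r, r = m0 - m4 / 2 := ⟨_, rfl⟩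
  obtain ⟨t, ht⟩ : ∃ t, t = -(m0 ^ 2 - 2 * r * m0 - m4 * m0 + 3 * m0 * r + m2) := ⟨_, rfl⟩
  refine ⟨triangular b⁻¹ (b ^ 2) r (-m0) t (inv_ne_zero hb0) (pow_ne_zero 2 hb0),
    2 * t + r ^ 2 + m4 * r + m8,
    -2 * m0 * t + (-r ^ 2 * m0 + 2 * r * t) + m4 * (t - r * m0) - m8 * m0 + 3 * m0 * r ^ 2 +
      2 * m2 * r + m5,
    t ^ 2 + r ^ 2 * t + m4 * r * t + m8 * t + m0 * r ^ 3 + m2 * r ^ 2 + m5 * r + m9,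
    MvPolynomial.funext fun u => ?_⟩
  rw [eval_subst, map_mul, eval_C, LinearEquiv.coe_coe, triangular_apply, eval_ternaryCubic,
    eval_ternaryCubic]
  simp only [h6, h3, Matrix.cons_val, hb, hm0, hm2, hm4, hm5, hm8, hm9]
  field_simp
  rw [ht, hr]
  ring

variable {f : MvPolynomial (Fin 3) ℝ}

/-- A smooth real cubic with a real point has a real inflection point. -/
theorem exists_real_inflection (hf : f.IsHomogeneous 3)
    (hs : ∀ v ≠ 0, eval v f = 0 → ∃ i, eval v (pderiv i f) ≠ 0) {v₀ : Fin 3 → ℝ} (hv₀ : v₀ ≠ 0)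
    (hfv₀ : eval v₀ f = 0) :
    ∃ v w, LinearIndependent ℝ ![v, w] ∧ eval v f = 0 ∧ polar f v w = 0 ∧ polar f w v = 0 := by
  obtain ⟨w₀, hvw, hpol⟩ := exists_tangent_vector hf hv₀ hfv₀ (hs v₀ hv₀ hfv₀)
  obtain ⟨M, k, hMw, hMv, hk, h6, h3, h7⟩ := exists_tangent_form hf hs hvw hfv₀ hpol
  by_cases h1 : k 1 = 0
  · refine ⟨v₀, w₀, hvw, hfv₀, hpol, ?_⟩
    rw [← hMw, ← hMv]
    refine (polar_subst M.toLinearMap f _ _).symm.trans ?_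
    rw [hk, polar_ternaryCubic]
    simp [h1]
  obtain ⟨N, e, c, d, hN⟩ := exists_triangular_normal_form h6 h3 h7 h1
  rw [← hk, subst_subst] at hN
  set L := N.trans M with hL
  replace hN : subst L.toLinearMap f = C (k 7) * ternaryCubic ![0, 1, 0, 0, 0, c, 0, 1, e, d] := hN
  obtain ⟨u, w, hu, hw, hG, e0, e1, e2⟩ := exists_hessian_kernel e c d
  have heval : eval (L u) f = 0 := by
    refine (eval_subst L.toLinearMap f u).symm.trans ?_
    rw [hN, map_mul, hG, mul_zero]
  have hpolar : ∀ a b, polar f (L a) (L b) =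
      k 7 * polar (ternaryCubic ![0, 1, 0, 0, 0, c, 0, 1, e, d]) a b := fun a b => by
    refine (polar_subst L.toLinearMap f a b).symm.trans ?_
    rw [hN, polar_C_mul]
  refine ⟨L u, L w, ?_, heval, ?_, ?_⟩
  · have hLu : L u ≠ 0 := by simpa using hu
    rw [LinearIndependent.pair_iff' hLu]
    intro a ha
    rw [← map_smul] at ha
    -- If w were a multiple of u, the Hessian matrix would kill u, and by Euler the gradient at u
    -- would vanish.
    have haw : a • u = w := L.injective ha
    have ha0 : a ≠ 0 := fun h => hw (by rw [← haw, h, zero_smul])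
    rw [← haw] at e0 e1 e2
    simp only [Pi.smul_apply, smul_eq_mul] at e0 e1 e2
    obtain ⟨i, hi⟩ := hs _ hLu heval
    refine hi ?_
    rw [← polar_single, ← L.apply_symm_apply (Pi.single i 1), hpolar, polar_ternaryCubic]
    set b := L.symm (Pi.single i 1)
    simp only [Matrix.cons_val]
    refine mul_eq_zero_of_right _ (mul_left_cancel₀ ha0 ?_)
    linear_combination b 0 * e0 + b 1 * e1 + b 2 * e2
  -- Pairing the kernel equations with u gives tangency; pairing them with w, below, gives the flex
  -- condition.
  · rw [hpolar, polar_ternaryCubic]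
    simp only [Matrix.cons_val]
    refine mul_eq_zero_of_right _ ?_
    linear_combination u 0 * e0 + u 1 * e1 + u 2 * e2
  · rw [hpolar, polar_ternaryCubic]
    simp only [Matrix.cons_val]
    refine mul_eq_zero_of_right _ ?_
    linear_combination w 0 * e0 + w 1 * e1 + w 2 * e2

end RealInflection
end PlaneCubic

namespace PlaneCubic
open MvPolynomial

/-! ### Topology of the real locus. -/

section RealLocus

open Filter Topology

/-- The class of a varying nonzero vector depends continuously on the vector. -/
theorem tendsto_mk {ι : Type*} {l : Filter ι} {v : ι → Fin 3 → ℂ} (hv : ∀ i, v i ≠ 0)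
    {w : Fin 3 → ℂ} (hw : w ≠ 0) (h : Tendsto v l (𝓝 w)) :
    Tendsto (fun i => Projectivization.mk ℂ (v i) (hv i)) l (𝓝 (Projectivization.mk ℂ w hw)) := by
  have hc : Continuous (fun u : {u : Fin 3 → ℂ // u ≠ 0} => Projectivization.mk ℂ u.1 u.2) :=
    continuous_quotient_mk'
  exact (hc.tendsto ⟨w, hw⟩).comp (f := fun i => (⟨v i, hv i⟩ : {u : Fin 3 → ℂ // u ≠ 0}))
    (tendsto_subtype_rng.mpr h)

theorem continuous_mk {ι : Type*} [TopologicalSpace ι] {v : ι → Fin 3 → ℂ} (hv : ∀ i, v i ≠ 0)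
    (h : Continuous v) : Continuous fun i => Projectivization.mk ℂ (v i) (hv i) :=
  continuous_iff_continuousAt.mpr fun i => tendsto_mk hv (hv i) h.continuousAt

variable {a₂ a₄ a₆ c : ℝ} {F : Forms} {M : (Fin 3 → ℝ) ≃ₗ[ℝ] (Fin 3 → ℝ)}

theorem complexify_affine (M : (Fin 3 → ℝ) ≃ₗ[ℝ] (Fin 3 → ℝ)) (x y z : ℝ) :
    complexify M ![(x : ℂ), y, z] = fun i => ((M ![x, y, z] i : ℝ) : ℂ) := by
  rw [← complexify_ofReal]
  congr 1
  ext i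
  fin_cases i <;> rfl

theorem isReal_affine (M : (Fin 3 → ℝ) ≃ₗ[ℝ] (Fin 3 → ℝ)) (x y : ℝ) :
    IsReal (Projectivization.mk ℂ (complexify M ![(x : ℂ), y, 1])
      (affineVector_ne_zero (complexify M) x y)) := by
  have h := complexify_affine M x y 1
  rw [Complex.ofReal_one] at h
  exact ⟨M ![x, y, 1], by rw [← h]; exact affineVector_ne_zero _ _ _, by simp only [h]⟩

theorem infinityVector_ne_zero (M : (Fin 3 → ℂ) ≃ₗ[ℂ] (Fin 3 → ℂ)) : M ![0, 1, 0] ≠ 0 := by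
  rw [Ne, LinearEquiv.map_eq_zero_iff]
  intro h
  simpa using congrFun h 1

/-- The real points of a cubic in real Weierstrass form. -/
theorem eq_infinity_or_real_affine (hc : c ≠ 0)
    (hFM : subst (complexify M).toLinearMap F = C (c : ℂ) * wForm (a₂ : ℂ) a₄ a₆) {P : Plane}
    (hP : P ∈ realPoints F) :
    P = Projectivization.mk ℂ (complexify M ![0, 1, 0]) (infinityVector_ne_zero _) ∨
      ∃ x y : ℝ, y ^ 2 = x ^ 3 + a₂ * x ^ 2 + a₄ * x + a₆ ∧
        P = Projectivization.mk ℂ (complexify M ![(x : ℂ), y, 1])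
          (affineVector_ne_zero (complexify M) x y) := by
  obtain ⟨hPF, v, hv, rfl⟩ := hP
  rcases eq_infinity_or_affine (by exact_mod_cast hc) hFM ⟨_, hPF⟩ with ⟨h, he⟩ | ⟨x, y, hxy, he⟩
  · exact Or.inl he
  · refine Or.inr ?_
    obtain ⟨κ, hκ⟩ := (Projectivization.mk_eq_mk_iff' ℂ _ _ _ _).mp he
    obtain ⟨u, rfl⟩ := M.surjective v
    rw [← complexify_ofReal, ← map_smul] at hκ
    have hu := (complexify M).injective hκ
    have h0 := congrFun hu 0
    have h1 := congrFun hu 1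
    have h2 := congrFun hu 2
    simp at h0 h1 h2
    have hu2 : u 2 ≠ 0 := by
      intro h
      rw [h, Complex.ofReal_zero] at h2
      exact hv (by rw [← complexify_ofReal, ← hu, h2, zero_smul, map_zero])
    have hx : x = ((u 0 / u 2 : ℝ) : ℂ) := by
      rw [Complex.ofReal_div, ← h0, ← h2, mul_div_cancel_left₀ _ (by rw [h2]; exact_mod_cast hu2)]
    have hy : y = ((u 1 / u 2 : ℝ) : ℂ) := by
      rw [Complex.ofReal_div, ← h1, ← h2, mul_div_cancel_left₀ _ (by rw [h2]; exact_mod_cast hu2)]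
    subst hx hy
    refine ⟨_, _, ?_, he⟩
    rw [wCurve_equation_iff] at hxy
    exact_mod_cast hxy

/-- If the cubic polynomial has a single sign change, then the real locus is connected. -/
theorem realPoints_isPreconnected (hc : c ≠ 0) (hF : F.IsHomogeneous 3)
    (hFM : subst (complexify M).toLinearMap F = C (c : ℂ) * wForm (a₂ : ℂ) a₄ a₆) {e : ℝ}
    (hlt : ∀ x < e, x ^ 3 + a₂ * x ^ 2 + a₄ * x + a₆ < 0)
    (hgt : ∀ x, e ≤ x → 0 ≤ x ^ 3 + a₂ * x ^ 2 + a₄ * x + a₆) :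
    IsPreconnected (realPoints F) := by
  set q : ℝ → ℝ := fun x => x ^ 3 + a₂ * x ^ 2 + a₄ * x + a₆ with hq
  have hqc : Continuous q := by fun_prop
  set N := complexify M with hN
  have hNc : Continuous N := LinearMap.continuous_of_finiteDimensional N.toLinearMap
  set φ : ℝ → ℝ → Plane := fun x y => Projectivization.mk ℂ (N ![(x : ℂ), y, 1])
    (affineVector_ne_zero N x y) with hφ
  set O : Plane := Projectivization.mk ℂ (N ![0, 1, 0]) (infinityVector_ne_zero _) with hO
  have hφc : ∀ σ : ℝ, Continuous fun x => φ x (σ * √(q x)) := fun σ =>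
    continuous_mk _ (hNc.comp (by
      refine continuous_pi fun i => ?_
      fin_cases i <;> simp <;> fun_prop))
  have hmem : ∀ x y, y ^ 2 = q x → φ x y ∈ realPoints F := fun x y h => by
    refine ⟨(mem_curve_mk hF _).mpr ?_, isReal_affine M x y⟩
    have h1 := eval_subst N.toLinearMap F ![(x : ℂ), y, 1]
    refine h1.symm.trans ?_
    rw [hFM, map_mul, eval_wForm]
    simp only [Matrix.cons_val]
    have : (y : ℂ) ^ 2 = x ^ 3 + a₂ * x ^ 2 + a₄ * x + a₆ := by exact_mod_cast h
    rw [this]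
    ring
  have hOmem : O ∈ realPoints F := by
    refine ⟨(mem_curve_mk hF _).mpr ?_, M ![0, 1, 0], ?_, ?_⟩
    · refine (eval_subst N.toLinearMap F ![0, 1, 0]).symm.trans ?_
      rw [hFM, map_mul, eval_wForm]
      simp
    all_goals
      have h := complexify_affine M 0 1 0
      rw [Complex.ofReal_one, Complex.ofReal_zero] at h
    · rw [← h]; exact infinityVector_ne_zero _
    · simp only [hO, hN, h]
  have hlim : ∀ σ : ℝ, σ ^ 2 = 1 → Tendsto (fun x => φ x (σ * √(q x))) atTop (𝓝 O) := by
    intro σ hσ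
    set p : Polynomial ℝ := .X ^ 3 + .C a₂ * .X ^ 2 + .C a₄ * .X + .C a₆ with hp
    have hpd : p.natDegree = 3 := by rw [hp]; compute_degree!
    have hpl : p.leadingCoeff = 1 := by rw [Polynomial.leadingCoeff, hpd, hp]; simp
    have hpq : ∀ x, p.eval x = q x := fun x => by simp [hp, hq]
    have hpdeg : p.degree = 3 := by
      rw [Polynomial.degree_eq_natDegree (by rintro h; simp [h] at hpd), hpd]; rfl
    have hpos : ∀ᶠ x in atTop, 0 < q x := by
      have := (p.tendsto_atTop_of_leadingCoeff_nonneg (by rw [hpdeg]; norm_num)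
        (by rw [hpl]; norm_num)).eventually_gt_atTop 0
      simpa only [hpq] using this
    have h2 : Tendsto (fun x => σ * √(x ^ 2 / q x)) atTop (𝓝 0) := by
      have := Polynomial.div_tendsto_atTop_zero_of_degree_lt (.X ^ 2) p
        (by rw [hpdeg, Polynomial.degree_X_pow]; norm_num)
      simp only [hpq, Polynomial.eval_pow, Polynomial.eval_X] at this
      simpa using ((Real.continuous_sqrt.tendsto 0).comp this).const_mul σ
    have h0 : Tendsto (fun x => σ * √(1 / q x)) atTop (𝓝 0) := by
      have := Polynomial.div_tendsto_atTop_zero_of_degree_lt 1 p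
        (by rw [hpdeg, Polynomial.degree_one]; norm_num)
      simp only [hpq, Polynomial.eval_one] at this
      simpa using ((Real.continuous_sqrt.tendsto 0).comp this).const_mul σ
    -- The coordinates (x, σ√q, 1) are divided by σ√q, which equals multiplication by σ/√q as σ² =
    -- 1.
    set v : ℝ → Fin 3 → ℂ := fun x =>
      ![((σ * √(x ^ 2 / q x) : ℝ) : ℂ), 1, ((σ * √(1 / q x) : ℝ) : ℂ)] with hv
    have hvt : Tendsto v atTop (𝓝 ![0, 1, 0]) := by
      refine tendsto_pi_nhds.mpr fun i => ?_
      fin_cases i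
      · exact (Complex.continuous_ofReal.tendsto 0).comp h2
      · simp [hv]
      · exact (Complex.continuous_ofReal.tendsto 0).comp h0
    have hvne : ∀ x, N (v x) ≠ 0 := fun x => by
      rw [Ne, LinearEquiv.map_eq_zero_iff]
      intro h
      simpa [hv] using congrFun h 1
    refine (tendsto_mk hvne (infinityVector_ne_zero N) ((hNc.tendsto _).comp hvt)).congr' ?_
    filter_upwards [hpos, eventually_gt_atTop 0] with x hx hx0
    refine (mk_ext _ _ (κ := ((σ * √(q x) : ℝ) : ℂ)) ?_).symm
    have hs : √(q x) ≠ 0 := (Real.sqrt_pos.mpr hx).ne'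
    have e0 : σ * √(q x) * (σ * √(x ^ 2 / q x)) = x := by
      rw [Real.sqrt_div (sq_nonneg x), Real.sqrt_sq hx0.le]
      field_simp
      linear_combination hσ
    have e2 : σ * √(q x) * (σ * √(1 / q x)) = 1 := by
      rw [Real.sqrt_div zero_le_one, Real.sqrt_one]
      field_simp
      linear_combination hσ
    rw [← map_smul]
    congr 1
    ext i
    fin_cases i
    · change ((σ * √(q x) : ℝ) : ℂ) * ((σ * √(x ^ 2 / q x) : ℝ) : ℂ) = x
      exact_mod_cast e0
    · simp [hv]
    · change ((σ * √(q x) : ℝ) : ℂ) * ((σ * √(1 / q x) : ℝ) : ℂ) = 1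
      exact_mod_cast e2
  set B : ℝ → Set Plane := fun σ => (fun x => φ x (σ * √(q x))) '' Set.Ici e with hB
  -- Each half-branch stays connected when its limit O is added, and the two halves share O.
  have hBO : ∀ σ : ℝ, σ ^ 2 = 1 → IsPreconnected (insert O (B σ)) := fun σ hσ =>
    (isPreconnected_Ici.image _ (hφc σ).continuousOn).subset_closure (Set.subset_insert _ _)
      (Set.insert_subset (mem_closure_of_tendsto (hlim σ hσ)
        ((eventually_ge_atTop e).mono fun x hx => ⟨x, hx, rfl⟩)) subset_closure)
  have hunion : realPoints F = insert O (B 1) ∪ insert O (B (-1)) := by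
    refine Set.Subset.antisymm (fun P hP => ?_) ?_
    · rcases eq_infinity_or_real_affine hc hFM hP with h | ⟨x, y, hxy, h⟩
      · exact Or.inl (Or.inl h)
      · have hx : e ≤ x := by
          by_contra! hx
          have := hlt x hx
          nlinarith [sq_nonneg y]
        rcases le_total 0 y with hy | hy
        · refine Or.inl (Or.inr ⟨x, hx, ?_⟩)
          change φ x (1 * √(q x)) = P
          rw [← show y ^ 2 = q x from hxy, Real.sqrt_sq hy, one_mul, h]
        · refine Or.inr (Or.inr ⟨x, hx, ?_⟩)
          change φ x (-1 * √(q x)) = P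
          rw [← show y ^ 2 = q x from hxy, Real.sqrt_sq_eq_abs, abs_of_nonpos hy, neg_one_mul, neg_neg, h]
    · have hsub : ∀ σ : ℝ, σ ^ 2 = 1 → insert O (B σ) ⊆ realPoints F := fun σ hσ =>
        Set.insert_subset hOmem (by
          rintro _ ⟨x, hx, rfl⟩
          exact hmem _ _ (by rw [mul_pow, hσ, one_mul, Real.sq_sqrt (hgt x hx)]))
      exact Set.union_subset (hsub 1 (by norm_num)) (hsub (-1) (by norm_num))
  rw [hunion]
  exact (hBO 1 (by norm_num)).union O (Set.mem_insert _ _) (Set.mem_insert _ _)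
    (hBO (-1) (by norm_num))

theorem card_connectedComponents_of_isPreconnected {X : Type*} [TopologicalSpace X] {s : Set X}
    (h : IsPreconnected s) : Nat.card (ConnectedComponents s) ≠ 2 := by
  have := isPreconnected_iff_preconnectedSpace.mp h
  have : Subsingleton (ConnectedComponents s) := inferInstance
  have := Finite.card_le_one_iff_subsingleton.mpr this
  omega

end RealLocus
end PlaneCubic

namespace PlaneCubic
open MvPolynomial

/-! ### Explicit halving on y² = (x - e₁)(x - e₂)(x - e₃). -/

section Halving

/-- The explicit halves of a point on `y² = (x - e₁)(x - e₂)(x - e₃)`, where the differences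
`X - eᵢ` are squares: abscissas relative to `X`. -/
def halfX {K : Type*} [Field K] (p q r : K) : Fin 4 → K :=
  ![-p * q - p * r + q * r, -p * q + p * r - q * r, p * q - p * r - q * r, p * q + p * r + q * r]

/-- The ordinates of the halves. -/
def halfY {K : Type*} [Field K] (p q r : K) : Fin 4 → K :=
  ![-((p - q) * (p - r) * (-q - r)), -((-p + q) * (-p - r) * (q - r)),
    -((-p - q) * (-p + r) * (-q + r)), -((p + q) * (p + r) * (q + r))]

variable {K : Type*} [Field K]

/-- For index 3 the factors are (p+q)(p+r), (p+q)(q+r) and (p+r)(q+r). The other indices flip two of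
the signs of p, q, r, which preserves the ordinate pqr of the point being halved. -/
theorem halfY_sq (p q r : K) (i : Fin 4) : halfY p q r i ^ 2 =
    (halfX p q r i + p ^ 2) * (halfX p q r i + q ^ 2) * (halfX p q r i + r ^ 2) := by
  fin_cases i <;> simp [halfX, halfY] <;> ring

/-- This is the condition that the tangent at the i-th half passes through the point with relative
abscissa 0 and ordinate pqr. -/
theorem halfY_mul (p q r : K) (i : Fin 4) : 2 * halfY p q r i * (p * q * r) =
    -((halfX p q r i + p ^ 2) * (halfX p q r i + q ^ 2) +
      (halfX p q r i + p ^ 2) * (halfX p q r i + r ^ 2) +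
      (halfX p q r i + q ^ 2) * (halfX p q r i + r ^ 2)) * halfX p q r i +
      2 * halfY p q r i ^ 2 := by
  fin_cases i <;> simp [halfX, halfY] <;> ring

theorem eq_half [CharZero K] {p q r t y : K} (hpqr : p * q * r ≠ 0) (h : y ^ 2 = (t + p ^ 2) * (t + q ^ 2) * (t + r ^ 2))
    (hy : 2 * y * (p * q * r) = -((t + p ^ 2) * (t + q ^ 2) + (t + p ^ 2) * (t + r ^ 2) +
      (t + q ^ 2) * (t + r ^ 2)) * t + 2 * y ^ 2) :
    (t = 0 ∧ y = p * q * r) ∨ ∃ i, t = halfX p q r i ∧ y = halfY p q r i := by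
  -- Eliminating y gives degree six in t: a double root for the point itself, whose own tangent
  -- passes through it, and the four halves. The tangent condition then determines y.
  have hprod : t ^ 2 * ((t - halfX p q r 0) * (t - halfX p q r 1) * (t - halfX p q r 2) *
      (t - halfX p q r 3)) = 0 := by
    have h1 : (2 * y * (p * q * r)) ^ 2 = (-((t + p ^ 2) * (t + q ^ 2) + (t + p ^ 2) * (t + r ^ 2) +
      (t + q ^ 2) * (t + r ^ 2)) * t + 2 * ((t + p ^ 2) * (t + q ^ 2) * (t + r ^ 2))) ^ 2 := by
      rw [hy, h]
    simp only [halfX, Matrix.cons_val]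
    linear_combination -h1 + 4 * (p * q * r) ^ 2 * h
  have key : ∀ i, t = halfX p q r i →
      (t = 0 ∧ y = p * q * r) ∨ ∃ i, t = halfX p q r i ∧ y = halfY p q r i := fun i hi => by
    refine Or.inr ⟨i, hi, ?_⟩
    have h2 := halfY_mul p q r i
    rw [halfY_sq, ← hi] at h2
    rw [h] at hy
    refine mul_left_cancel₀ (mul_ne_zero two_ne_zero hpqr) ?_
    linear_combination hy - h2
  rcases mul_eq_zero.mp hprod with h0 | h0
  · have ht : t = 0 := by simpa using h0
    refine Or.inl ⟨ht, ?_⟩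
    subst ht
    have : y * (y - p * q * r) = 0 := by linear_combination -hy / 2
    rcases mul_eq_zero.mp this with h0 | h0
    · exfalso
      rw [h0] at h
      refine hpqr (pow_eq_zero_iff two_ne_zero |>.mp ?_)
      linear_combination -h
    · linear_combination h0
  · rcases mul_eq_zero.mp h0 with h0 | h0
    · rcases mul_eq_zero.mp h0 with h0 | h0
      · rcases mul_eq_zero.mp h0 with h0 | h0
        · exact key 0 (sub_eq_zero.mp h0)
        · exact key 1 (sub_eq_zero.mp h0)
      · exact key 2 (sub_eq_zero.mp h0)
    · exact key 3 (sub_eq_zero.mp h0)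

/-- With p², q², r² equal to X - eᵢ, the right side is f'(X)² - 4f(X)(3X + a₂), the three-division
relation at X. -/
theorem prod_halfX (p q r : K) :
    halfX p q r 0 * halfX p q r 1 * halfX p q r 2 * halfX p q r 3 =
      (p ^ 2 * q ^ 2 + p ^ 2 * r ^ 2 + q ^ 2 * r ^ 2) ^ 2 -
        4 * (p * q * r) ^ 2 * (p ^ 2 + q ^ 2 + r ^ 2) := by
  simp only [halfX, Matrix.cons_val]
  ring

theorem halfX_injective {p q r : ℝ} (hr : 0 < r) (hqr : r < q) (hpq : q < p) :
    Function.Injective (halfX p q r) := by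
  refine StrictMono.injective (Fin.strictMono_iff_lt_succ.mpr fun i => ?_)
  fin_cases i <;> simp [halfX] <;> nlinarith

theorem ofReal_halfX (p q r : ℝ) (i : Fin 4) :
    ((halfX p q r i : ℝ) : ℂ) = halfX (p : ℂ) q r i := by
  fin_cases i <;> simp [halfX]

theorem ofReal_halfY (p q r : ℝ) (i : Fin 4) :
    ((halfY p q r i : ℝ) : ℂ) = halfY (p : ℂ) q r i := by
  fin_cases i <;> simp [halfY]

end Halving

/-! ### Real roots of a separable cubic. -/

section CubicRoots

/-- A real monic cubic polynomial without double roots has either a single change of sign or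
three real roots. -/
theorem cubic_single_sign_change_or_three_roots {a₂ a₄ a₆ : ℝ}
    (hsq : ∀ x, x ^ 3 + a₂ * x ^ 2 + a₄ * x + a₆ = 0 → 3 * x ^ 2 + 2 * a₂ * x + a₄ ≠ 0) :
    (∃ e, (∀ x < e, x ^ 3 + a₂ * x ^ 2 + a₄ * x + a₆ < 0) ∧
      ∀ x, e ≤ x → 0 ≤ x ^ 3 + a₂ * x ^ 2 + a₄ * x + a₆) ∨
    ∃ e₁ e₂ e₃ : ℝ, e₁ < e₂ ∧ e₂ < e₃ ∧ a₂ = -(e₁ + e₂ + e₃) ∧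
      a₄ = e₁ * e₂ + e₁ * e₃ + e₂ * e₃ ∧ a₆ = -(e₁ * e₂ * e₃) := by
  obtain ⟨e, he⟩ : ∃ e, e ^ 3 + a₂ * e ^ 2 + a₄ * e + a₆ = 0 := by
    set p : Polynomial ℝ := .X ^ 3 + .C a₂ * .X ^ 2 + .C a₄ * .X + .C a₆ with hp
    have hpd : p.natDegree = 3 := by rw [hp]; compute_degree!
    obtain ⟨⟨a, ha⟩, b, hb⟩ := exists_neg_and_pos_of_odd (p := p) (by rw [hpd]; decide)
    obtain ⟨e, he⟩ := mem_range_of_exists_le_of_exists_ge p.continuous ⟨a, ha.le⟩ ⟨b, hb.le⟩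
    exact ⟨e, by simpa [hp] using he⟩
  obtain ⟨u, hu⟩ : ∃ u, a₂ = u - e := ⟨a₂ + e, by ring⟩
  obtain ⟨v, hv⟩ : ∃ v, a₄ = v - e * u := ⟨a₄ + e * u, by ring⟩
  have h6 : a₆ = -(e * v) := by rw [hu, hv] at he; linear_combination he
  subst hu hv h6
  have hfac : ∀ x, x ^ 3 + (u - e) * x ^ 2 + (v - e * u) * x + -(e * v) =
      (x - e) * (x ^ 2 + u * x + v) := fun x => by ring
  simp only [hfac] at hsq ⊢
  rcases lt_or_ge (u ^ 2 - 4 * v) 0 with hd | hd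
  · have hpos : ∀ x, 0 < x ^ 2 + u * x + v := fun x => by nlinarith [sq_nonneg (2 * x + u)]
    exact Or.inl ⟨e, fun x hx => mul_neg_of_neg_of_pos (sub_neg.mpr hx) (hpos x),
      fun x hx => mul_nonneg (sub_nonneg.mpr hx) (hpos x).le⟩
  · refine Or.inr ?_
    obtain ⟨s, hs, hs0⟩ : ∃ s, s ^ 2 = u ^ 2 - 4 * v ∧ 0 ≤ s :=
      ⟨_, Real.sq_sqrt hd, Real.sqrt_nonneg _⟩
    obtain ⟨m, hm⟩ : ∃ m, u = -(2 * m + s) := ⟨-(u + s) / 2, by ring⟩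
    have hv : v = m * (m + s) := by rw [hm] at hs; linear_combination hs / 4
    subst hm hv
    have hs1 : 0 < s := by
      refine lt_of_le_of_ne hs0 fun h => hsq m (by rw [← h]; ring) ?_
      rw [← h]; ring
    have h1 : e ≠ m := fun h => hsq e (by ring) (by rw [h]; ring)
    have h2 : e ≠ m + s := fun h => hsq e (by ring) (by rw [h]; ring)
    rcases lt_or_gt_of_ne h1 with h1 | h1
    · exact ⟨e, m, m + s, h1, by linarith, by ring, by ring, by ring⟩
    · rcases lt_or_gt_of_ne h2 with h2 | h2
      · exact ⟨m, e, m + s, h1, h2, by ring, by ring, by ring⟩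
      · exact ⟨m, m + s, e, by linarith, h2, by ring, by ring, by ring⟩

end CubicRoots
-- Equations for associated points.
section AssociatedPoints

variable {a₂ a₄ a₆ c : ℂ} {F : Forms} {M : (Fin 3 → ℂ) ≃ₗ[ℂ] (Fin 3 → ℂ)}

/-- The affine point `(x, y)` is associated with `(X, Y)`. -/
theorem isAssociated_affine_iff (hc : c ≠ 0) (hF : F.IsHomogeneous 3)
    (hFM : subst M.toLinearMap F = C c * wForm a₂ a₄ a₆) {P Q : curve F} {X Y x y : ℂ}
    (hP : (P : Plane) = Projectivization.mk ℂ (M ![X, Y, 1]) (affineVector_ne_zero M X Y))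
    (hQ : (Q : Plane) = Projectivization.mk ℂ (M ![x, y, 1]) (affineVector_ne_zero M x y))
    (h : y ^ 2 = x ^ 3 + a₂ * x ^ 2 + a₄ * x + a₆) :
    IsAssociated F P Q ↔ ¬(x = X ∧ y = Y) ∧
      2 * y * Y = (3 * x ^ 2 + 2 * a₂ * x + a₄) * (X - x) + 2 * y ^ 2 := by
  have h1 : Q = P ↔ x = X ∧ y = Y := by
    rw [← Subtype.coe_inj, hP, hQ]
    refine ⟨affine_mk_injective, ?_⟩
    rintro ⟨rfl, rfl⟩
    rfl
  rw [IsAssociated, hP, hQ, isAssociated_iff hF, polar_apply_of_subst_eq hFM, Ne, h1,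
    mul_eq_zero_iff_left hc, polar_wForm]
  simp only [Matrix.cons_val]
  refine and_congr_right fun _ => ⟨fun h' => ?_, fun h' => ?_⟩
  · linear_combination h' - 3 * h
  · linear_combination h' + 3 * h

/-- The tangent at the point at infinity is the line at infinity, which contains no affine point. -/
theorem not_isAssociated_infinity (hc : c ≠ 0) (hF : F.IsHomogeneous 3)
    (hFM : subst M.toLinearMap F = C c * wForm a₂ a₄ a₆) {P Q : curve F} {X Y : ℂ}
    (hP : (P : Plane) = Projectivization.mk ℂ (M ![X, Y, 1]) (affineVector_ne_zero M X Y))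
    (h : M ![0, 1, 0] ≠ 0) (hQ : (Q : Plane) = Projectivization.mk ℂ (M ![0, 1, 0]) h) :
    ¬IsAssociated F P Q := by
  rw [IsAssociated, hP, hQ, isAssociated_iff hF, polar_apply_of_subst_eq hFM, polar_wForm]
  simp [hc]

end AssociatedPoints

/-! ### Reality of the associated points. -/

section RealAssociatedPoints

variable {c : ℂ} {F : Forms} {M : (Fin 3 → ℝ) ≃ₗ[ℝ] (Fin 3 → ℝ)}

/-- A point on the unbounded branch of a cubic with three real roots that is not an inflection
point has four associated points, all of them real. -/
theorem associated_real_of_three_roots (hc : c ≠ 0) (hF : F.IsHomogeneous 3) {a₂ a₄ a₆ : ℝ}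
    (hFM : subst (complexify M).toLinearMap F = C c * wForm (a₂ : ℂ) a₄ a₆)
    {p q r X : ℝ} (hr : 0 < r) (hqr : r < q) (hpq : q < p)
    (hcub : ∀ x : ℂ, x ^ 3 + a₂ * x ^ 2 + a₄ * x + a₆ =
      (x - X + p ^ 2) * (x - X + q ^ 2) * (x - X + r ^ 2))
    (hder : ∀ x : ℂ, 3 * x ^ 2 + 2 * a₂ * x + a₄ =
      (x - X + p ^ 2) * (x - X + q ^ 2) + (x - X + p ^ 2) * (x - X + r ^ 2) +
        (x - X + q ^ 2) * (x - X + r ^ 2))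
    (hflex : ∀ i, halfX p q r i ≠ 0) {P : curve F}
    (hP : (P : Plane) = Projectivization.mk ℂ (complexify M ![(X : ℂ), (p * q * r : ℝ), 1])
      (affineVector_ne_zero (complexify M) _ _)) :
    {Q | IsAssociated F P Q}.ncard = 4 ∧ ∀ Q, IsAssociated F P Q → IsReal Q := by
  have hpqr : (p : ℂ) * q * r ≠ 0 := by
    have : p * q * r ≠ 0 := by
      have := hr.trans hqr
      have := this.trans hpq
      positivity
    exact_mod_cast this
  set ξ : Fin 4 → ℝ := fun i => X + halfX p q r i with hξ
  set η : Fin 4 → ℝ := halfY p q r with hη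
  have hηξ : ∀ i, (η i : ℂ) ^ 2 = (ξ i : ℂ) ^ 3 + a₂ * (ξ i : ℂ) ^ 2 + a₄ * ξ i + a₆ := fun i => by
    rw [hcub, hξ, hη]
    push_cast
    rw [ofReal_halfX, ofReal_halfY, halfY_sq]
    ring
  have hmem : ∀ i, Projectivization.mk ℂ (complexify M ![(ξ i : ℂ), η i, 1])
      (affineVector_ne_zero (complexify M) _ _) ∈ curve F := fun i => by
    rw [mem_curve_mk hF, eval_apply_of_subst_eq hFM, eval_wForm]
    simp only [Matrix.cons_val]
    linear_combination c * hηξ i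
  set A : Fin 4 → curve F := fun i => ⟨_, hmem i⟩ with hA
  have hinj : Function.Injective A := fun i j hij => by
    have := (affine_mk_injective (congrArg Subtype.val hij)).1
    have h' : ξ i = ξ j := by exact_mod_cast this
    exact halfX_injective hr hqr hpq (add_left_cancel h')
  have hset : {Q | IsAssociated F P Q} = Set.range A := by
    ext Q
    constructor
    · intro hQ
      rcases eq_infinity_or_affine hc hFM Q with ⟨h, he⟩ | ⟨x, y, hxy, he⟩
      · exact absurd hQ (not_isAssociated_infinity hc hF hFM hP h he)
      · rw [wCurve_equation_iff] at hxy
        obtain ⟨hne, hrel⟩ := (isAssociated_affine_iff hc hF hFM hP he hxy).mp hQ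
        rw [hder] at hrel
        rw [hcub] at hxy
        push_cast at hrel hne
        rcases eq_half hpqr hxy (by linear_combination hrel) with ⟨h1, h2⟩ | ⟨i, h1, h2⟩
        · exact absurd ⟨sub_eq_zero.mp h1, h2⟩ hne
        · refine ⟨i, Subtype.ext ?_⟩
          have hx : (ξ i : ℂ) = x := by
            rw [hξ]
            push_cast
            rw [ofReal_halfX, ← h1]
            ring
          have hy : (η i : ℂ) = y := by rw [h2, hη, ofReal_halfY]
          rw [he]
          simp only [hA, hx, hy]
    · rintro ⟨i, rfl⟩
      refine (isAssociated_affine_iff hc hF hFM hP rfl (hηξ i)).mpr ⟨?_, ?_⟩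
      · rintro ⟨h, -⟩
        have h' : ξ i = X := by exact_mod_cast h
        exact hflex i (by simpa [hξ] using h')
      · rw [hder, hξ, hη]
        push_cast
        rw [ofReal_halfX, ofReal_halfY]
        linear_combination halfY_mul (p : ℂ) q r i
  constructor
  · rw [hset, ← Set.image_univ, Set.ncard_image_of_injective _ hinj, Set.ncard_univ, Nat.card_fin]
  · intro Q hQ
    obtain ⟨i, rfl⟩ : Q ∈ Set.range A := hset ▸ hQ
    exact isReal_affine M _ _

end RealAssociatedPoints
end PlaneCubic

namespace PlaneCubic
open MvPolynomial

/-! ### Two real components force three real roots. -/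

section RealNormalForm

/-- A smooth real plane cubic whose real locus has two components has a Weierstrass form whose
cubic polynomial has three real roots. -/
theorem exists_weierstrass_three_roots {f : MvPolynomial (Fin 3) ℝ} {F : Forms}
    (hfF : F = map (algebraMap ℝ ℂ) f) (hF : F.IsHomogeneous 3) (hsmooth : IsSmooth F)
    (hcomp : Nat.card (ConnectedComponents (realPoints F)) = 2) :
    ∃ (M : (Fin 3 → ℝ) ≃ₗ[ℝ] (Fin 3 → ℝ)) (c e₁ e₂ e₃ a₂ a₄ a₆ : ℝ), c ≠ 0 ∧ e₁ < e₂ ∧ e₂ < e₃ ∧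
      a₂ = -(e₁ + e₂ + e₃) ∧ a₄ = e₁ * e₂ + e₁ * e₃ + e₂ * e₃ ∧ a₆ = -(e₁ * e₂ * e₃) ∧
      subst (complexify M).toLinearMap F = C (c : ℂ) * wForm (a₂ : ℂ) a₄ a₆ := by
  have hf : f.IsHomogeneous 3 := fun d hd => hF (by
    rw [hfF, coeff_map]
    exact (map_ne_zero _).mpr hd)
  obtain ⟨⟨P, hPF, v₀, hv₀, rfl⟩⟩ : Nonempty (realPoints F) := by
    by_contra h
    rw [not_nonempty_iff] at h
    have : IsEmpty (ConnectedComponents (realPoints F)) :=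
      ⟨fun x => by obtain ⟨y, -⟩ := ConnectedComponents.surjective_coe x; exact h.false y⟩
    simp at hcomp
  rw [mem_curve_mk hF, hfF, eval_ofReal] at hPF
  have hsm : IsSmooth (map (algebraMap ℝ ℂ) f) := hfF ▸ hsmooth
  have hv₀' : v₀ ≠ 0 := by
    rintro rfl
    exact hv₀ (by ext i; simp)
  obtain ⟨v, w, hvw, hv, hvw0, hwv0⟩ := exists_real_inflection hf (smooth_of_isSmooth hsm) hv₀'
    (by exact_mod_cast hPF)
  obtain ⟨M, c, a₂, a₄, a₆, hc, hM⟩ := exists_weierstrass_form hf hsm hvw hv hvw0 hwv0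
  have hFM : subst (complexify M).toLinearMap F = C (c : ℂ) * wForm (a₂ : ℂ) a₄ a₆ := by
    rw [hfF, subst_complexify, hM]
    simp [wForm]
  have hsq : ∀ x, x ^ 3 + a₂ * x ^ 2 + a₄ * x + a₆ = 0 → 3 * x ^ 2 + 2 * a₂ * x + a₄ ≠ 0 := by
    intro x hx
    have hns := wCurve_nonsingular_of_isSmooth (x := (x : ℂ)) (y := 0) hsmooth hFM (by
      rw [wCurve_equation_iff]
      have : (x : ℂ) ^ 3 + a₂ * x ^ 2 + a₄ * x + a₆ = 0 := by exact_mod_cast hx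
      rw [this]
      simp)
    have := ((wCurve_nonsingular_iff ..).mp hns).2.resolve_right (by simp)
    exact_mod_cast this
  rcases cubic_single_sign_change_or_three_roots hsq with
    ⟨e, hlt, hgt⟩ | ⟨e₁, e₂, e₃, h12, h23, h2, h4, h6⟩
  · exact absurd hcomp
      (card_connectedComponents_of_isPreconnected (realPoints_isPreconnected hc hF hFM hlt hgt))
  · exact ⟨M, c, e₁, e₂, e₃, a₂, a₄, a₆, hc, h12, h23, h2, h4, h6, hFM⟩

end RealNormalForm
end PlaneCubic

end

/-! ### The main theorem. -/

open PlaneCubic in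
theorem mainTheorem5 (f : MvPolynomial (Fin 3) ℝ) (F : MvPolynomial (Fin 3) ℂ)
    (hF : F = MvPolynomial.map (algebraMap ℝ ℂ) f)
    (hcubic : F.IsHomogeneous 3) (hsmooth : PlaneCubic.IsSmooth F)
    (hcomp : Nat.card (ConnectedComponents (PlaneCubic.realPoints F)) = 2)
    (r : ℕ) (hr : 1 ≤ r) :
    ∃ p : Fin r → PlaneCubic.curve F,
      (∀ p₀ : PlaneCubic.curve F, PlaneCubic.IsInflection F p₀ →
        PlaneCubic.Independent F p₀ p) ∧
      ∀ i, PlaneCubic.IsReal (p i) ∧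
        ¬ PlaneCubic.IsInflection F (p i) ∧
        {q | PlaneCubic.IsAssociated F (p i) q}.ncard = 4 ∧
        ∀ q, PlaneCubic.IsAssociated F (p i) q → PlaneCubic.IsReal q := by
  obtain ⟨M, c, e₁, e₂, e₃, a₂, a₄, a₆, hc, h12, h23, h2, h4, h6, hFM⟩ :=
    exists_weierstrass_three_roots hF hcubic hsmooth hcomp
  have hc' : (c : ℂ) ≠ 0 := by exact_mod_cast hc
  obtain ⟨X, δ, hX, hδ, hdiag, hlow⟩ := exists_reals_derivations {(a₂ : ℂ), (a₄ : ℂ), (a₆ : ℂ)}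
    (Set.toFinite _).countable e₃ r
  set k := Subfield.closure {(a₂ : ℂ), (a₄ : ℂ), (a₆ : ℂ)}
  have k2 : (a₂ : ℂ) ∈ k := Subfield.subset_closure (by simp)
  have k4 : (a₄ : ℂ) ∈ k := Subfield.subset_closure (by simp)
  have k6 : (a₆ : ℂ) ∈ k := Subfield.subset_closure (by simp)
  have htr : ∀ i, ¬IsAlgebraic k (X i : ℂ) := fun i h => by
    have := hdiag i
    rw [hδ i _ h] at this
    exact zero_ne_one this
  -- Since X i > e₃, all three differences are positive, and the order of the eⱼ gives s₃ < s₂ < s₁.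
  obtain ⟨s₁, hs₁⟩ : ∃ s : Fin r → ℝ, s = fun i => √(X i - e₁) := ⟨_, rfl⟩
  obtain ⟨s₂, hs₂⟩ : ∃ s : Fin r → ℝ, s = fun i => √(X i - e₂) := ⟨_, rfl⟩
  obtain ⟨s₃, hs₃⟩ : ∃ s : Fin r → ℝ, s = fun i => √(X i - e₃) := ⟨_, rfl⟩
  have pos : ∀ i, 0 < s₃ i := fun i => by
    rw [hs₃]; exact Real.sqrt_pos.mpr (sub_pos.mpr (hX i))
  have lt32 : ∀ i, s₃ i < s₂ i := fun i => by
    rw [hs₃, hs₂]; exact Real.sqrt_lt_sqrt (sub_pos.mpr (hX i)).le (by linarith)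
  have lt21 : ∀ i, s₂ i < s₁ i := fun i => by
    rw [hs₂, hs₁]; exact Real.sqrt_lt_sqrt (by linarith [hX i]) (by linarith)
  have sq₁ : ∀ i, e₁ = X i - s₁ i ^ 2 := fun i => by
    rw [hs₁, Real.sq_sqrt (by linarith [hX i])]; ring
  have sq₂ : ∀ i, e₂ = X i - s₂ i ^ 2 := fun i => by
    rw [hs₂, Real.sq_sqrt (by linarith [hX i])]; ring
  have sq₃ : ∀ i, e₃ = X i - s₃ i ^ 2 := fun i => by
    rw [hs₃, Real.sq_sqrt (by linarith [hX i])]; ring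
  have hcub : ∀ i (x : ℂ), x ^ 3 + a₂ * x ^ 2 + a₄ * x + a₆ =
      (x - X i + s₁ i ^ 2) * (x - X i + s₂ i ^ 2) * (x - X i + s₃ i ^ 2) := fun i x => by
    rw [h2, h4, h6, sq₁ i, sq₂ i, sq₃ i]
    push_cast
    ring
  have hder : ∀ i (x : ℂ), 3 * x ^ 2 + 2 * a₂ * x + a₄ =
      (x - X i + s₁ i ^ 2) * (x - X i + s₂ i ^ 2) + (x - X i + s₁ i ^ 2) * (x - X i + s₃ i ^ 2) +
        (x - X i + s₂ i ^ 2) * (x - X i + s₃ i ^ 2) := fun i x => by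
    rw [h2, h4, sq₁ i, sq₂ i, sq₃ i]
    push_cast
    ring
  have heq : ∀ i, (wCurve (a₂ : ℂ) a₄ a₆).Equation (X i) (s₁ i * s₂ i * s₃ i : ℝ) := fun i => by
    rw [wCurve_equation_iff, hcub i]
    push_cast
    ring
  have hy : ∀ i, ((s₁ i * s₂ i * s₃ i : ℝ) : ℂ) ≠ 0 := fun i => by
    have h3 := pos i
    have h2 := h3.trans (lt32 i)
    have h1 := h2.trans (lt21 i)
    have : s₁ i * s₂ i * s₃ i ≠ 0 := by positivity
    exact_mod_cast this
  -- A half equal to the point itself would make X i a root of the three-division polynomial, hence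
  -- algebraic over k.
  have hflex : ∀ i j, halfX (s₁ i) (s₂ i) (s₃ i) j ≠ 0 := fun i j hj => by
    have hprod := prod_halfX (s₁ i) (s₂ i) (s₃ i)
    have h0 : halfX (s₁ i) (s₂ i) (s₃ i) 0 * halfX (s₁ i) (s₂ i) (s₃ i) 1 *
        halfX (s₁ i) (s₂ i) (s₃ i) 2 * halfX (s₁ i) (s₂ i) (s₃ i) 3 = 0 := by
      fin_cases j <;> simp at hj <;> simp [hj]
    rw [h0] at hprod
    have hprod' : (0 : ℂ) = (s₁ i ^ 2 * s₂ i ^ 2 + s₁ i ^ 2 * s₃ i ^ 2 + s₂ i ^ 2 * s₃ i ^ 2) ^ 2 -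
        4 * (s₁ i * s₂ i * s₃ i) ^ 2 * (s₁ i ^ 2 + s₂ i ^ 2 + s₃ i ^ 2) := by
      exact_mod_cast hprod
    refine htr i (isAlgebraic_of_inflection_relation k2 k4 k6 ?_)
    rw [hcub i, hder i]
    have ha : (3 : ℂ) * X i + a₂ = s₁ i ^ 2 + s₂ i ^ 2 + s₃ i ^ 2 := by
      rw [h2, sq₁ i, sq₂ i, sq₃ i]
      push_cast
      ring
    rw [ha]
    linear_combination -hprod'
  have hmem : ∀ i, Projectivization.mk ℂ (complexify M ![(X i : ℂ), (s₁ i * s₂ i * s₃ i : ℝ), 1])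
      (affineVector_ne_zero (complexify M) _ _) ∈ curve F := fun i => by
    have h := heq i
    rw [wCurve_equation_iff] at h
    rw [mem_curve_mk hcubic, eval_apply_of_subst_eq hFM, eval_wForm]
    simp only [Matrix.cons_val]
    linear_combination c * h
  refine ⟨fun i => ⟨_, hmem i⟩, fun p₀ hp₀ => ?_, fun i => ⟨isReal_affine M _ _, fun h => ?_, ?_⟩⟩
  · exact independent_of_derivations hc' hsmooth hcubic hFM heq hy (fun _ => rfl) k2 k4 k6 hδ hdiag
      hlow hp₀
  · exact htr i (inflection_isAlgebraic hc' hsmooth hcubic hFM h (heq i) rfl k2 k4 k6)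
  · exact associated_real_of_three_roots hc' hcubic hFM (pos i) (lt32 i) (lt21 i) (hcub i) (hder i)
      (hflex i) rfl
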